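/- **Setting.** Let $d\ge 2$, let $\mathbb S^{d-1}$ be the unit sphere of $\mathbb R^d$ with surface measure $\sigma$ (total mass $|\mathbb S^{d-1}|$) and norms $\|\cdot\|_q$ of $L^q(\mathbb S^{d-1})$, and let $H^+=\{x\in\mathbb S^{d-1}: x_1\ge 0\}$. Let $(X_i,\beta_i)_{i\ge1}$ be i.i.d. pairs of $\mathbb S^{d-1}$-valued random vectors, $\beta_i$ independent of $X_i$, and $Y_i=\mathbb 1\{X_i'\beta_i\ge 0\}$. The law of $X_i$ has a density $f_X$ with respect to $\sigma$, and $X_i$ is supported on $H^+$ in the sense that, up to $\sigma$-null sets, $f_X$ is positive exactly on $H^+$. Let $r(x)=\mathbb P(Y=1\mid X=x)$ (any version) and extend it to the sphere by $R(x)=r(x)$ for $x\in H^+$ and $R(x)=1-r(-x)$ for $x\notin H^+$. Let $H^{n,d}$ be the space of surface harmonics of degree $n$ (restrictions to $\mathbb S^{d-1}$ of homogeneous harmonic polynomials of degree $n$), $Q_{n,d}$ the $L^2$-projector onto $H^{n,d}$, $q_{n,d}(x,y)$ its kernel, and $\zeta_{n,d}=n(n+d-2)$. For $p\in[1,\infty]$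 and $s>0$, $W_p^s(\mathbb S^{d-1})$ is the space of $f\in L^p(\mathbb S^{d-1})$ for which the distribution $(-\Delta^S)^{s/2}f=\sum_n\zeta_{n,d}^{s/2}Q_{n,d}f$ is in $L^p(\mathbb S^{d-1})$, with norm $\|f\|_{p,s}=\|f\|_p+\|(-\Delta^S)^{s/2}f\|_p$. Fix $s>0$, $\rho>0$, weights $\chi(n,T)$ and nonnegative integers $T_N$, and let $\hat f_X=\hat f_{X,N}$ be a (random) estimator of $f_X$. Put $$K_T(x,y)=\sum_{n=0}^T\chi(n,T)\,q_{n,d}(x,y),\qquad K_T^-(x,y)=\tfrac12\bigl(K_T(x,y)-K_T(x,-y)\bigr),$$ $$\hat R(x)=\frac12+\frac1N\sum_{i=1}^N\frac{(2Y_i-1)K^-_{2T_N}(X_i,x)}{\max\bigl(\hat f_X(X_i),(\log N)^{-\rho}\bigr)},\qquad A_N(q)=\frac{N}{(\log N)^{2\rho+(1-2/q)\mathbb 1\{q\ge2\}}}$$ (with $2/\infty=0$), and $$D_N=\max_{1\le i\le N}\left|\frac{\max\bigl(f_X(X_i),(\log N)^{-\rho}\bigr)}{\max\bigl(\hat f_X(X_i),(\log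 N)^{-\rho}\bigr)}-1\right| .$$ For positive sequences, $a_N\asymp b_N$ means $M^{-1}b_N\le a_N\le Mb_N$ for some $M>0$ and all large $N$. **Conditions** (for a given $q\in[1,\infty]$). - (K) $\sup_{T\ge1}\sup_x\|K_T(x,\cdot)\|_1<\infty$. There are constants $C,\alpha$ with $|K_T(z,x)-K_T(z,y)|\le C\|x-y\|T^\alpha$ for all $x,y,z\in\mathbb S^{d-1}$ and $T\ge1$. There is a constant $C$ such that $\|f-\int_{\mathbb S^{d-1}} K_T(\cdot,y)f(y)\,d\sigma(y)\|_q\le CT^{-s}\|f\|_{q,s}$ for all $T\ge1$ and real $f\in W_q^s(\mathbb S^{d-1})$. Finally $\chi(n,T)\in[0,1]$ for $n\le T$, and there is $c>0$ with $\chi(n,T)\ge c$ for $0\le n\le\lfloor T/2\rfloor$. - (T) $\sup_{H^+}f_X<\infty$ and $\sigma(\{0<f_X<(\log N)^{-\rho}\})=o\Bigl(A_N(q)^{-\frac{s+(d-1)(1-1/q)}{2s+d-1}}\Bigr)$. - (P) $A_N(q)^{\frac{s}{2s+d-1}}(\log N)^{\rho}D_N=O_p(1)$. - (P$'$) For some (nonrandom)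 constant $C$, $\displaystyle\limsup_{N\to\infty}\Bigl(\frac{N}{(\log N)^{2\rho+1}}\Bigr)^{\frac{s}{2s+d-1}}(\log N)^{\rho}D_N\le C$ almost surely. **Theorem 4.2 (Convergence rates of $\hat R$).** 1. Let $q\in[1,\infty]$. If (K), (T) and (P) hold for $q$, $R\in W_q^{s}(\mathbb S^{d-1})$ and $T_N\asymp A_N(q)^{\frac1{2s+d-1}}$, then $$\|\hat R-R\|_q=O_p\Bigl(A_N(q)^{-\frac{s}{2s+d-1}}\Bigr).$$ 2. If (K) and (T) hold for $q=\infty$, (P$'$) holds, $R\in W_\infty^{s}(\mathbb S^{d-1})$ and $T_N\asymp A_N(\infty)^{\frac1{2s+d-1}}=\bigl(N/(\log N)^{2\rho+1}\bigr)^{\frac1{2s+d-1}}$, then there is a (nonrandom) constant $C$ such that $$\limsup_{N\to\infty}\Bigl(\frac{N}{(\log N)^{2\rho+1}}\Bigr)^{\frac{s}{2s+d-1}}\|\hat R-R\|_\infty\le C\quad\text{almost surely.}$$ -/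

import Mathlib

open MeasureTheory ProbabilityTheory Filter
open scoped ENNReal NNReal Topology

noncomputable section

namespace BinaryChoice

/-! ### The sphere and its surface measure -/

/-- The unit sphere `𝕊^{d-1}` of `ℝ^d`. -/
abbrev Sph (d : ℕ) : Type := Metric.sphere (0 : EuclideanSpace ℝ (Fin d)) 1

/-- The spherical (surface) measure on `𝕊^{d-1}`, of total mass `|𝕊^{d-1}|`. -/
def surf (d : ℕ) : Measure (Sph d) :=
  (volume : Measure (EuclideanSpace ℝ (Fin d))).toSphere

instance (d : ℕ) : IsFiniteMeasure (surf d) := by unfold surf; infer_instance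

instance (d : ℕ) : (surf d).IsOpenPosMeasure := by unfold surf; infer_instance

/-- The northern hemisphere `H⁺ = {x : x'n ≥ 0}`, with `n = (1, 0, …, 0)'`. -/
def northHemi (d : ℕ) [NeZero d] : Set (Sph d) := {x | 0 ≤ (x : EuclideanSpace ℝ (Fin d)) 0}

/-! ### Surface harmonics and the projection kernels -/

/-- The space `H^{n,d}` of surface harmonics of degree `n`: restrictions to the sphere of
homogeneous polynomials of degree `n` with zero Laplacian. -/
def surfaceHarmonics (d n : ℕ) : Submodule ℝ C(Sph d, ℝ) where
  carrier := {f | ∃ p : MvPolynomial (Fin d) ℝ, p.IsHomogeneous n ∧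
    ∑ i, MvPolynomial.pderiv i (MvPolynomial.pderiv i p) = 0 ∧
    ∀ x : Sph d, f x = MvPolynomial.eval (fun i => (x : EuclideanSpace ℝ (Fin d)) i) p}
  zero_mem' := ⟨0, MvPolynomial.isHomogeneous_zero _ _ _, by simp, by simp⟩
  add_mem' := by
    rintro f g ⟨p, hp, hp', hp''⟩ ⟨q, hq, hq', hq''⟩
    refine ⟨p + q, hp.add hq, ?_, fun x => by simp [hp'', hq'']⟩
    simp [Finset.sum_add_distrib, hp', hq']
  smul_mem' := by
    rintro c f ⟨p, hp, hp', hp''⟩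
    refine ⟨c • p, ?_, ?_, fun x => by simp [hp'']⟩
    · exact (MvPolynomial.homogeneousSubmodule (Fin d) ℝ n).smul_mem c hp
    · simp only [Derivation.map_smul, ← Finset.smul_sum, hp', smul_zero]

/-- `Y` is an `L²(𝕊^{d-1})`-orthonormal basis of `H^{n,d}`. -/
structure IsOrthonormalHarmonicBasis (d n : ℕ) {m : ℕ} (Y : Fin m → C(Sph d, ℝ)) : Prop where
  orthonormal : ∀ k l, ∫ x, Y k x * Y l x ∂(surf d) = if k = l then 1 else 0
  span_eq : Submodule.span ℝ (Set.range Y) = surfaceHarmonics d n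

instance (d n : ℕ) : Module.Finite ℝ (surfaceHarmonics d n) := by
  let ev : MvPolynomial (Fin d) ℝ →ₗ[ℝ] (Sph d → ℝ) :=
    { toFun := fun p x => MvPolynomial.eval (fun i => (x : EuclideanSpace ℝ (Fin d)) i) p
      map_add' := fun p q => by ext x; simp
      map_smul' := fun c p => by ext x; simp }
  let co : C(Sph d, ℝ) →ₗ[ℝ] (Sph d → ℝ) := ContinuousMap.coeFnLinearMap ℝ
  have hco : Function.Injective co := DFunLike.coe_injective
  have hfin : (MvPolynomial.homogeneousSubmodule (Fin d) ℝ n).FG :=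
    MvPolynomial.homogeneousSubmodule_fg _ _ n
  have h1 : ((MvPolynomial.homogeneousSubmodule (Fin d) ℝ n).map ev).FG := hfin.map ev
  have hle : (surfaceHarmonics d n).map co ≤
      (MvPolynomial.homogeneousSubmodule (Fin d) ℝ n).map ev := by
    rintro _ ⟨f, ⟨p, hp, -, hpf⟩, rfl⟩
    refine ⟨p, hp, ?_⟩
    ext x
    exact (hpf x).symm
  have : Module.Finite ℝ ((MvPolynomial.homogeneousSubmodule (Fin d) ℝ n).map ev) :=
    Module.Finite.iff_fg.2 h1
  have : Module.Finite ℝ ((surfaceHarmonics d n).map co) :=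
    Submodule.finiteDimensional_of_le hle
  exact Module.Finite.equiv
    (Submodule.equivMapOfInjective co hco (surfaceHarmonics d n)).symm

theorem exists_orthonormalHarmonicBasis (d n : ℕ) :
    ∃ (m : ℕ) (Y : Fin m → C(Sph d, ℝ)), IsOrthonormalHarmonicBasis d n Y := by
  let L : C(Sph d, ℝ) →ₗ[ℝ] Lp ℝ 2 (surf d) :=
    (ContinuousMap.toLp (E := ℝ) 2 (surf d) ℝ).toLinearMap
  have hL : Function.Injective L := ContinuousMap.toLp_injective (surf d)
  let V := (surfaceHarmonics d n).map L
  have : FiniteDimensional ℝ V := inferInstance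
  let b := stdOrthonormalBasis ℝ V
  have hmem : ∀ l, ∃ f ∈ surfaceHarmonics d n, L f = (b l : Lp ℝ 2 (surf d)) := fun l =>
    (b l).2
  choose Y hY hYb using hmem
  refine ⟨_, Y, ?_, ?_⟩
  · intro k l
    have h := orthonormal_iff_ite.1 b.orthonormal l k
    rw [Submodule.coe_inner, ← hYb, ← hYb] at h
    have h2 := ContinuousMap.inner_toLp (𝕜 := ℝ) (surf d) (Y l) (Y k)
    have h3 : inner ℝ (L (Y l)) (L (Y k)) = ∫ x, Y k x * Y l x ∂(surf d) := by
      refine h2.trans ?_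
      simp
    rw [← h3, h]
    simp [eq_comm]
  · apply le_antisymm
    · exact Submodule.span_le.2 (by rintro _ ⟨l, rfl⟩; exact hY l)
    · intro f hf
      have hfV : L f ∈ V := ⟨f, hf, rfl⟩
      have hs := b.sum_repr ⟨L f, hfV⟩
      have hs' : ∑ l, b.repr ⟨L f, hfV⟩ l • L (Y l) = L f := by
        have := congrArg (Subtype.val) hs
        simpa [hYb] using this
      have hf' : f = ∑ l, b.repr ⟨L f, hfV⟩ l • Y l := by
        apply hL
        refine hs'.symm.trans ?_
        simp only [map_sum, map_smul]
      rw [hf']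
      exact Submodule.sum_mem _ fun l _ =>
        Submodule.smul_mem _ _ (Submodule.subset_span ⟨l, rfl⟩)

/-- The kernel `q_{n,d}(x,y) = ∑ₗ Y_{n,l}(x) Y_{n,l}(y)` of the `L²`-projector onto `H^{n,d}`,
for an orthonormal basis `(Y_{n,l})` of `H^{n,d}`. -/
def projKernel (d n : ℕ) (x y : Sph d) : ℝ :=
  ∑ l, (exists_orthonormalHarmonicBasis d n).choose_spec.choose l x *
    (exists_orthonormalHarmonicBasis d n).choose_spec.choose l y

/-- The projection `Q_{n,d} f` of an integrable function onto `H^{n,d}`. -/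
def proj (d n : ℕ) (f : Sph d → ℝ) (x : Sph d) : ℝ :=
  ∫ y, projKernel d n x y * f y ∂(surf d)

/-! ### Sobolev spaces on the sphere -/

/-- The eigenvalue `ζ_{n,d} = n(n+d-2)` of `-Δ^S` on `H^{n,d}`. -/
def zeta (d n : ℕ) : ℝ := (n : ℝ) * ((n : ℝ) + d - 2)

/-- The distribution `(-Δ^S)^{s/2} f = ∑ₙ ζ_{n,d}^{s/2} Q_{n,d} f` belongs to `L^p` and is
represented by `g`.  (A distribution on the sphere is determined by its projections on the
spaces `H^{n,d}`.) -/
def IsFracLaplacian (d : ℕ) (p : ℝ≥0∞) (s : ℝ) (f g : Sph d → ℝ) : Prop :=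
  MemLp g p (surf d) ∧ ∀ n x, proj d n g x = zeta d n ^ (s / 2) * proj d n f x

/-- `f` belongs to the Sobolev space `W_p^s(𝕊^{d-1})`. -/
def MemSobolev (d : ℕ) (p : ℝ≥0∞) (s : ℝ) (f : Sph d → ℝ) : Prop :=
  MemLp f p (surf d) ∧ ∃ g, IsFracLaplacian d p s f g

/-- The norm `‖f‖_{p,s} = ‖f‖_p + ‖(-Δ^S)^{s/2} f‖_p`.  (The representative of
`(-Δ^S)^{s/2} f` is unique up to null sets; the infimum is over its versions, and the value is
`∞` if there is none.) -/
def sobolevNorm (d : ℕ) (p : ℝ≥0∞) (s : ℝ) (f : Sph d → ℝ) : ℝ≥0∞ :=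
  eLpNorm f p (surf d) + ⨅ (g) (_ : IsFracLaplacian d p s f g), eLpNorm g p (surf d)

/-! ### Smoothed projection kernels -/

/-- The smoothed projection kernel `K_T(x,y) = ∑_{n=0}^T χ(n,T) q_{n,d}(x,y)`. -/
def smoothKernel (d : ℕ) (χ : ℕ → ℕ → ℝ) (T : ℕ) (x y : Sph d) : ℝ :=
  ∑ n ∈ Finset.range (T + 1), χ n T * projKernel d n x y

/-- The odd part `K_T^-` of the kernel. -/
def oddKernel (d : ℕ) (χ : ℕ → ℕ → ℝ) (T : ℕ) (x y : Sph d) : ℝ :=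
  (smoothKernel d χ T x y - smoothKernel d χ T x (-y)) / 2

/-- The conditions on the kernel, with the approximation property for the Sobolev space
`W_p^s`. -/
structure KernelAssumption (d : ℕ) (χ : ℕ → ℕ → ℝ) (p : ℝ≥0∞) (s : ℝ) : Prop where
  bounded : ∃ B : ℝ, ∀ T : ℕ, 1 ≤ T → ∀ x : Sph d,
    ∫ y, |smoothKernel d χ T x y| ∂(surf d) ≤ B
  lipschitz : ∃ C α : ℝ, ∀ T : ℕ, 1 ≤ T → ∀ x y z : Sph d,
    |smoothKernel d χ T z x - smoothKernel d χ T z y| ≤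
      C * ‖(x : EuclideanSpace ℝ (Fin d)) - y‖ * (T : ℝ) ^ α
  approx : ∃ C : ℝ, ∀ T : ℕ, 1 ≤ T → ∀ f : Sph d → ℝ, MemSobolev d p s f →
    eLpNorm (fun x => f x - ∫ y, smoothKernel d χ T x y * f y ∂(surf d)) p (surf d) ≤
      ENNReal.ofReal (C * (T : ℝ) ^ (-s)) * sobolevNorm d p s f
  mem_unit : ∀ T : ℕ, 1 ≤ T → ∀ n ≤ T, 0 ≤ χ n T ∧ χ n T ≤ 1
  lower : ∃ c : ℝ, 0 < c ∧ ∀ T : ℕ, 1 ≤ T → ∀ n ≤ T / 2, c ≤ χ n T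

/-! ### The random coefficients binary choice model -/

/-- An i.i.d. sequence from the model `Y = 𝟙{X'β ≥ 0}`: `β` is independent of `X`, and the law of
`X` has density `fX` with respect to the surface measure.  Only `(Yᵢ, Xᵢ)` are observed. -/
structure IsModelSample {Ω : Type*} [MeasurableSpace Ω] (P : Measure Ω) (d : ℕ)
    (X β : ℕ → Ω → Sph d) (Y : ℕ → Ω → ℝ) (fX : Sph d → ℝ) : Prop where
  measurable_X : ∀ i, Measurable (X i)
  measurable_β : ∀ i, Measurable (β i)
  choice : ∀ i ω, Y i ω =
    if 0 ≤ inner ℝ (X i ω : EuclideanSpace ℝ (Fin d)) (β i ω : EuclideanSpace ℝ (Fin d))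
    then 1 else 0
  indep : iIndepFun (fun i ω => (X i ω, β i ω)) P
  identDistrib : ∀ i, IdentDistrib (fun ω => (X i ω, β i ω)) (fun ω => (X 0 ω, β 0 ω)) P P
  exogenous : ∀ i, IndepFun (β i) (X i) P
  measurable_fX : Measurable fX
  nonneg_fX : ∀ x, 0 ≤ fX x
  law_X : ∀ i, P.map (X i) = (surf d).withDensity (fun x => ENNReal.ofReal (fX x))

/-- `X` is supported on `H⁺`: up to null sets, its density is positive exactly on `H⁺`. -/
def SupportAssumption (d : ℕ) [NeZero d] (fX : Sph d → ℝ) : Prop :=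
  ∀ᵐ x ∂(surf d), 0 < fX x ↔ x ∈ northHemi d

/-- `r` is (a version of) the choice probability function `r(x) = P(Y = 1 | X = x)`. -/
def IsChoiceProbability {Ω : Type*} [MeasurableSpace Ω] (P : Measure Ω) (d : ℕ)
    (X : ℕ → Ω → Sph d) (Y : ℕ → Ω → ℝ) (r : Sph d → ℝ) : Prop :=
  Measurable r ∧ ∀ i, P⟦{ω | Y i ω = 1} | MeasurableSpace.comap (X i) inferInstance⟧
    =ᵐ[P] fun ω => r (X i ω)

open Classical in
/-- The extension `R` of `r` to the sphere: `R(x) = r(x)` on `H⁺`, `R(x) = 1 - r(-x)` on the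
opposite hemisphere. -/
def extendedChoice (d : ℕ) [NeZero d] (r : Sph d → ℝ) (x : Sph d) : ℝ :=
  if x ∈ northHemi d then r x else 1 - r (-x)

/-- The trimming level `a_N = (log N)^{-ρ}`. -/
def trim (ρ : ℝ) (N : ℕ) : ℝ := Real.log N ^ (-ρ)

/-- The estimator `R̂ = 1/2 + R̂⁻` with
`R̂⁻(x) = N⁻¹ ∑_{i ≤ N} (2Yᵢ - 1) K⁻_{2T_N}(Xᵢ, x) / max(f̂_X(Xᵢ), a_N)`. -/
def Rhat {Ω : Type*} (d : ℕ) (χ : ℕ → ℕ → ℝ) (T : ℕ → ℕ) (ρ : ℝ)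
    (X : ℕ → Ω → Sph d) (Y : ℕ → Ω → ℝ) (fhat : ℕ → Ω → Sph d → ℝ)
    (N : ℕ) (ω : Ω) (x : Sph d) : ℝ :=
  1 / 2 + (N : ℝ)⁻¹ * ∑ i ∈ Finset.range N,
    (2 * Y i ω - 1) * oddKernel d χ (2 * T N) (X i ω) x / max (fhat N ω (X i ω)) (trim ρ N)

/-! ### Rates and stochastic orders -/

/-- `2ρ + (1 - 2/q) 𝟙{q ≥ 2}`, with `2/∞ = 0`. -/
def logExponent (ρ : ℝ) (q : ℝ≥0∞) : ℝ :=
  2 * ρ + if 2 ≤ q then 1 - 2 * (q⁻¹).toReal else 0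

/-- The effective sample size `N / (log N)^{2ρ + (1 - 2/q) 𝟙{q ≥ 2}}`. -/
def effSize (ρ : ℝ) (q : ℝ≥0∞) (N : ℕ) : ℝ := N / Real.log N ^ logExponent ρ q

/-- `a_N ≍ b_N`. -/
def SameOrder (a b : ℕ → ℝ) : Prop :=
  ∃ M : ℝ, 0 < M ∧ ∀ᶠ N in atTop, M⁻¹ * b N ≤ a N ∧ a N ≤ M * b N

/-- `Z_N = O_p(a_N)` for nonnegative `Z_N`. -/
def IsBigOInProb {Ω : Type*} [MeasurableSpace Ω] (P : Measure Ω) (Z : ℕ → Ω → ℝ≥0∞)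
    (a : ℕ → ℝ) : Prop :=
  ∀ ε : ℝ, 0 < ε → ∃ M : ℝ, ∀ᶠ N in atTop,
    P {ω | ENNReal.ofReal (M * a N) < Z N ω} ≤ ENNReal.ofReal ε

/-- `max_{i ≤ N} |max(f_X(Xᵢ), a_N) / max(f̂_X(Xᵢ), a_N) - 1|`. -/
def plugInError {Ω : Type*} {d : ℕ} (ρ : ℝ) (X : ℕ → Ω → Sph d) (fX : Sph d → ℝ)
    (fhat : ℕ → Ω → Sph d → ℝ) (N : ℕ) (ω : Ω) : ℝ≥0∞ :=
  ⨆ i ∈ Finset.range N, ENNReal.ofReal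
    |max (fX (X i ω)) (trim ρ N) / max (fhat N ω (X i ω)) (trim ρ N) - 1|

/-- The condition on the size of the trimmed region, and boundedness of `f_X` on `H⁺`. -/
def TrimmingAssumption (d : ℕ) [NeZero d] (q : ℝ≥0∞) (s ρ : ℝ) (fX : Sph d → ℝ) : Prop :=
  ((fun N : ℕ => (surf d).real {x | 0 < fX x ∧ fX x < trim ρ N}) =o[atTop]
    fun N : ℕ => effSize ρ q N ^ (-((s + (d - 1) * (1 - (q⁻¹).toReal)) / (2 * s + d - 1)))) ∧
  BddAbove (fX '' northHemi d)

/-- The plug-in condition in probability. -/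
def PlugInAssumptionProb {Ω : Type*} [MeasurableSpace Ω] (P : Measure Ω) (d : ℕ) (q : ℝ≥0∞)
    (s ρ : ℝ) (X : ℕ → Ω → Sph d) (fX : Sph d → ℝ) (fhat : ℕ → Ω → Sph d → ℝ) : Prop :=
  IsBigOInProb P (fun N ω =>
    ENNReal.ofReal (effSize ρ q N ^ (s / (2 * s + d - 1)) * Real.log N ^ ρ) *
      plugInError ρ X fX fhat N ω) (fun _ => 1)

/-- The almost sure plug-in condition, at the rate for the sup-norm, with a nonrandom constant. -/
def PlugInAssumptionAS {Ω : Type*} [MeasurableSpace Ω] (P : Measure Ω) (d : ℕ)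
    (s ρ : ℝ) (X : ℕ → Ω → Sph d) (fX : Sph d → ℝ) (fhat : ℕ → Ω → Sph d → ℝ) : Prop :=
  ∃ C : ℝ≥0, ∀ᵐ ω ∂P, limsup (fun N : ℕ =>
    ENNReal.ofReal ((N / Real.log N ^ (2 * ρ + 1)) ^ (s / (2 * s + d - 1)) * Real.log N ^ ρ) *
      plugInError ρ X fX fhat N ω) atTop ≤ C

end BinaryChoice

end

open BinaryChoice

/-!
Write `K_T` for the smoothed kernel, `a` for the trimming level and `φ` for the odd part of `R`.
Up to null sets `R = 1/2 + φ`, and `φ` is in the same Sobolev space as `R`, because harmonics of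
degree `n` have the parity of `n`. The error `R̂ - R` splits into four terms
(`eLpNorm_Rhat_sub_le`): the approximation error `K_T φ - φ`, of order `T^{-s}` by hypothesis; the
trimming bias, an integral of the odd kernel over `{0 < f_X < a}`, controlled by interpolating
between `L¹` and `L^∞` (`eLpNorm_trimming_bias_le`); the centred oracle estimator; and the plug-in
error, at most `a⁻¹ D_N` times the sample mean of `|K_T⁻(X_i, x)|`.

All kernel bounds come from polynomials. By rotation invariance of the surface measure, a
polynomial of degree `D` satisfies `f(x)² ≤ c_D ∫ f²` with `c_D` of order `D^{d-1}`
(`sq_le_nikolskii_mul_integral_sq`), hence also `|f(x)| ≤ c_D ∫ |f|`. As `K_T(x, ·)` is a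
polynomial of degree `T`, bounded in `L¹`, it is of order `T^{d-1}` in the sup-norm and
`T^{(d-1)/2}` in `L²`; no orthogonality of harmonics and no addition formula are needed.

The same inequality replaces a chaining argument for the suprema over the sphere. Applied to
`f^k`, it gives `sup |f|^{2k} ≤ c_{kD} ∫ f^{2k}` (`IsPolyEnvelope.pow_le`), so that with `k` of
order `log N` the supremum costs only a constant factor over the pointwise moments of order `2k`
(`measure_exists_lt_le_of_log_le`). These moments follow from the exponential moments of means of
bounded i.i.d. variables (`lintegral_pow_mean_le`, `lintegral_pow_centred_mean_le`). It also applies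
to sums of absolute values of polynomials, so to the mean of `|K_T⁻(X_i, x)|`, which is therefore
uniformly bounded; and the centred oracle estimator is uniformly of order
`(T^{d-1} (log N)^{2ρ+1} / N)^{1/2}`. Both hold outside events of probability `O(N^{-2})`
(`eventually_measure_badEvent_le`).

In `L²` a variance computation saves the factor `(log N)^{1/2}`, and interpolation between `L²` and
`L^∞` produces the exponent `1 - 2/q` in `A_N(q)` (`eLpNorm_le_noiseLevel`). The order of `T_N`
makes the noise and the bias comparable, which gives the rate in probability; the almost sure
statement uses only the summable sup-norm tails and the Borel–Cantelli lemma.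
-/

noncomputable section

namespace BinaryChoice

open scoped Pointwise

/-! ### Symmetries of the surface measure -/

/-- The action of a linear isometry on the sphere. -/
def sphMap {d : ℕ} (U : EuclideanSpace ℝ (Fin d) ≃ₗᵢ[ℝ] EuclideanSpace ℝ (Fin d)) (x : Sph d) :
    Sph d :=
  ⟨U x, by simp⟩

theorem continuous_sphMap {d : ℕ}
    (U : EuclideanSpace ℝ (Fin d) ≃ₗᵢ[ℝ] EuclideanSpace ℝ (Fin d)) : Continuous (sphMap U) :=
  (U.continuous.comp continuous_subtype_val).subtype_mk _

theorem measurePreserving_sphMap {d : ℕ}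
    (U : EuclideanSpace ℝ (Fin d) ≃ₗᵢ[ℝ] EuclideanSpace ℝ (Fin d)) :
    MeasurePreserving (sphMap U) (surf d) (surf d) := by
  refine ⟨(continuous_sphMap U).measurable, ?_⟩
  ext s hs
  have hs' := (continuous_sphMap U).measurable hs
  rw [Measure.map_apply (continuous_sphMap U).measurable hs, surf, Measure.toSphere_apply' _ hs',
    Measure.toSphere_apply' _ hs]
  congr 1
  rw [← U.measurePreserving.measure_preimage_emb U.toHomeomorph.measurableEmbedding
    (Set.Ioo (0 : ℝ) 1 • (Subtype.val '' s))]
  congr 1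
  ext y
  simp only [Set.mem_smul, Set.mem_image, Set.mem_preimage]
  constructor
  · rintro ⟨t, ht, _, ⟨x, hx, rfl⟩, rfl⟩
    exact ⟨t, ht, _, ⟨sphMap U x, hx, rfl⟩, by simp [sphMap]⟩
  · rintro ⟨t, ht, _, ⟨x, hx, rfl⟩, h⟩
    refine ⟨t, ht, U.symm x, ⟨sphMap U.symm x, ?_, rfl⟩, ?_⟩
    · simpa [sphMap] using hx
    · apply U.injective
      simpa using h

theorem sphMap_neg {d : ℕ} (x : Sph d) : sphMap (LinearIsometryEquiv.neg ℝ) x = -x := by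
  ext; simp [sphMap]

theorem measurePreserving_neg_surf (d : ℕ) :
    MeasurePreserving (fun x : Sph d => -x) (surf d) (surf d) := by
  have h := measurePreserving_sphMap (d := d) (LinearIsometryEquiv.neg ℝ)
  rwa [show sphMap (d := d) (LinearIsometryEquiv.neg ℝ) = fun x => -x from
    funext sphMap_neg] at h

theorem integral_neg_surf {d : ℕ} (f : Sph d → ℝ) :
    ∫ x, f (-x) ∂(surf d) = ∫ x, f x ∂(surf d) :=
  (measurePreserving_neg_surf d).integral_comp (Homeomorph.neg (Sph d)).measurableEmbedding f

theorem exists_sphMap_eq {d : ℕ} (x y : Sph d) :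
    ∃ U : EuclideanSpace ℝ (Fin d) ≃ₗᵢ[ℝ] EuclideanSpace ℝ (Fin d), sphMap U x = y := by
  refine ⟨(ℝ ∙ ((x : EuclideanSpace ℝ (Fin d)) - y))ᗮ.reflection, ?_⟩
  ext1
  exact Submodule.reflection_sub (by simp)

/-- The equator is a null set. -/
theorem surf_equator (d : ℕ) [NeZero d] :
    surf d {x : Sph d | (x : EuclideanSpace ℝ (Fin d)) 0 = 0} = 0 := by
  have hm : MeasurableSet {x : Sph d | (x : EuclideanSpace ℝ (Fin d)) 0 = 0} := by
    apply IsClosed.measurableSet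
    exact isClosed_eq (by fun_prop) continuous_const
  rw [surf, Measure.toSphere_apply' _ hm]
  let p : EuclideanSpace ℝ (Fin d) →ₗ[ℝ] ℝ :=
    (EuclideanSpace.proj (0 : Fin d) : EuclideanSpace ℝ (Fin d) →L[ℝ] ℝ).toLinearMap
  have hp : ∀ y, p y = y 0 := fun y => rfl
  have hne : LinearMap.ker p ≠ ⊤ := by
    intro h
    have : EuclideanSpace.single (0 : Fin d) (1 : ℝ) ∈ LinearMap.ker p := h ▸ trivial
    rw [LinearMap.mem_ker, hp] at this
    simp at this
  have h0 := Measure.addHaar_submodule (volume : Measure (EuclideanSpace ℝ (Fin d))) _ hne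
  have : volume (Set.Ioo (0 : ℝ) 1 • ((↑) '' {x : Sph d | (x : EuclideanSpace ℝ (Fin d)) 0 = 0} :
      Set (EuclideanSpace ℝ (Fin d)))) = 0 := by
    refine measure_mono_null ?_ h0
    rintro _ ⟨t, ht, _, ⟨x, hx, rfl⟩, rfl⟩
    have hx' : (x : EuclideanSpace ℝ (Fin d)) 0 = 0 := hx
    simp [hp, hx']
  rw [this, mul_zero]

/-! ### Polynomials on the sphere -/

/-- The `i`-th coordinate as a function on the sphere. -/
def coordFun (d : ℕ) (i : Fin d) : C(Sph d, ℝ) :=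
  ⟨fun x => (x : EuclideanSpace ℝ (Fin d)) i, by fun_prop⟩

/-- The affine functions on the sphere. -/
def affSpace (d : ℕ) : Submodule ℝ C(Sph d, ℝ) :=
  Submodule.span ℝ (insert 1 (Set.range (coordFun d)))

/-- The restrictions to the sphere of the polynomials of degree at most `D`, as the `D`-th power of
the space of affine functions in the algebra of continuous functions. -/
def polySpace (d D : ℕ) : Submodule ℝ C(Sph d, ℝ) := affSpace d ^ D

theorem one_le_affSpace (d : ℕ) : (1 : Submodule ℝ C(Sph d, ℝ)) ≤ affSpace d := by
  rw [Submodule.one_le]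
  exact Submodule.subset_span (Set.mem_insert _ _)

theorem polySpace_mono {d D D' : ℕ} (h : D ≤ D') : polySpace d D ≤ polySpace d D' :=
  pow_le_pow_right' (one_le_affSpace d) h

theorem one_mem_polySpace (d D : ℕ) : (1 : C(Sph d, ℝ)) ∈ polySpace d D := by
  have := polySpace_mono (d := d) (Nat.zero_le D)
  refine this ?_
  rw [polySpace, pow_zero]
  exact Submodule.one_le.1 le_rfl

theorem coordFun_mem (d : ℕ) (i : Fin d) : coordFun d i ∈ affSpace d :=
  Submodule.subset_span (Set.mem_insert_of_mem _ ⟨i, rfl⟩)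

theorem mul_mem_polySpace {d a b : ℕ} {f g : C(Sph d, ℝ)} (hf : f ∈ polySpace d a)
    (hg : g ∈ polySpace d b) : f * g ∈ polySpace d (a + b) := by
  rw [polySpace, pow_add]
  exact Submodule.mul_mem_mul hf hg

theorem pow_mem_polySpace {d a : ℕ} {f : C(Sph d, ℝ)} (hf : f ∈ polySpace d a) (k : ℕ) :
    f ^ k ∈ polySpace d (k * a) := by
  rw [polySpace, mul_comm, pow_mul]
  exact Submodule.pow_mem_pow _ hf k

theorem monomial_mem_polySpace {d : ℕ} (m : Fin d → ℕ) :
    ∏ i, coordFun d i ^ m i ∈ polySpace d (∑ i, m i) := by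
  classical
  suffices h : ∀ s : Finset (Fin d), ∏ i ∈ s, coordFun d i ^ m i ∈ polySpace d (∑ i ∈ s, m i) from
    h _
  intro s
  induction s using Finset.induction_on with
  | empty =>
    rw [Finset.prod_empty]
    exact one_mem_polySpace d _
  | insert a s ha ih =>
    rw [Finset.prod_insert ha, Finset.sum_insert ha]
    refine mul_mem_polySpace ?_ ih
    exact Submodule.pow_mem_pow _ (coordFun_mem d a) _

theorem mem_polySpace_of_isHomogeneous {d n : ℕ} {f : C(Sph d, ℝ)} {p : MvPolynomial (Fin d) ℝ}
    (hp : p.IsHomogeneous n)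
    (hf : ∀ x : Sph d, f x = MvPolynomial.eval (fun i => (x : EuclideanSpace ℝ (Fin d)) i) p) :
    f ∈ polySpace d n := by
  have : f = ∑ m ∈ p.support, p.coeff m • ∏ i, coordFun d i ^ m i := by
    ext x
    rw [hf, MvPolynomial.eval_eq']
    simp [coordFun, ContinuousMap.sum_apply]
  rw [this]
  refine Submodule.sum_mem _ fun m hm => Submodule.smul_mem _ _ ?_
  have h1 : ∑ i, m i = n := by
    have := hp (MvPolynomial.mem_support_iff.1 hm)
    rw [Finsupp.weight_apply, Finsupp.sum_fintype _ _ (by simp)] at this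
    simpa using this
  rw [← h1]
  exact monomial_mem_polySpace _

theorem surfaceHarmonics_le_polySpace (d n : ℕ) : surfaceHarmonics d n ≤ polySpace d n := by
  rintro f ⟨p, hp, -, hf⟩
  exact mem_polySpace_of_isHomogeneous hp hf

theorem comp_sphMap_mem_polySpace {d D : ℕ} {f : C(Sph d, ℝ)} (hf : f ∈ polySpace d D)
    (U : EuclideanSpace ℝ (Fin d) ≃ₗᵢ[ℝ] EuclideanSpace ℝ (Fin d)) :
    f.comp ⟨sphMap U, continuous_sphMap U⟩ ∈ polySpace d D := by
  let Φ : C(Sph d, ℝ) →ₐ[ℝ] C(Sph d, ℝ) :=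
    ContinuousMap.compRightAlgHom ℝ ℝ ⟨sphMap U, continuous_sphMap U⟩
  have h1 : (affSpace d).map Φ.toLinearMap ≤ affSpace d := by
    rw [affSpace, Submodule.map_span, Submodule.span_le]
    rintro _ ⟨g, hg, rfl⟩
    rcases hg with rfl | ⟨i, rfl⟩
    · have : Φ.toLinearMap 1 = 1 := map_one Φ
      rw [this]
      exact Submodule.subset_span (Set.mem_insert _ _)
    · have : Φ.toLinearMap (coordFun d i) =
          ∑ j, (U (EuclideanSpace.single j 1)) i • coordFun d j := by
        ext x
        have hx : (x : EuclideanSpace ℝ (Fin d)) =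
            ∑ j, (x : EuclideanSpace ℝ (Fin d)) j • EuclideanSpace.single j (1 : ℝ) := by
          ext k
          simp [Finset.sum_apply, Pi.single_apply]
        have h2 : (U x) i = ∑ j, (x : EuclideanSpace ℝ (Fin d)) j *
            (U (EuclideanSpace.single j (1 : ℝ))) i := by
          conv_lhs => rw [hx]
          simp [map_sum]
        simp only [ContinuousMap.sum_apply, ContinuousMap.smul_apply]
        change (U x) i = _
        rw [h2]
        exact Finset.sum_congr rfl fun j _ => mul_comm _ _
      rw [this]
      exact Submodule.sum_mem _ fun j _ => Submodule.smul_mem _ _ (coordFun_mem d j)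
  have h2 : (polySpace d D).map Φ.toLinearMap ≤ polySpace d D := by
    rw [polySpace, Submodule.map_pow]
    exact pow_le_pow_left' h1 D
  exact h2 ⟨f, hf, rfl⟩

theorem sum_coordFun_sq (d : ℕ) : ∑ i, coordFun d i ^ 2 = 1 := by
  ext x
  have h : ‖(x : EuclideanSpace ℝ (Fin d))‖ ^ 2 = 1 := by simp
  rw [EuclideanSpace.real_norm_sq_eq] at h
  simpa [ContinuousMap.sum_apply, coordFun] using h

/-- Modulo `∑ xᵢ² = 1` every polynomial is of degree at most one in `x₀`. -/
theorem polySpace_le_span (d D : ℕ) [NeZero d] :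
    polySpace d D ≤ Submodule.span ℝ
      ((fun m : Fin d → ℕ => ∏ i, coordFun d i ^ m i) '' {m | m 0 ≤ 1 ∧ ∑ i, m i ≤ D}) := by
  induction D with
  | zero =>
    rw [polySpace, pow_zero, Submodule.one_le]
    exact Submodule.subset_span ⟨0, by simp, by simp⟩
  | succ D ih =>
    rw [polySpace, pow_succ]
    refine (mul_le_mul_left ih _).trans ?_
    rw [affSpace, Submodule.span_mul_span, Submodule.span_le]
    have key : ∀ (m : Fin d → ℕ) (j : Fin d), (∏ i, coordFun d i ^ m i) * coordFun d j =
        ∏ i, coordFun d i ^ ((m + Pi.single j 1 : Fin d → ℕ) i) := by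
      intro m j
      have h : ∀ i, coordFun d i ^ ((m + Pi.single j 1 : Fin d → ℕ) i) =
          coordFun d i ^ m i * (if i = j then coordFun d j else 1) := by
        intro i
        by_cases hij : i = j
        · subst hij; simp [pow_succ]
        · simp [hij]
      simp_rw [h, Finset.prod_mul_distrib]
      simp
    have sumkey : ∀ (m : Fin d → ℕ) (j : Fin d),
        ∑ i, (m + Pi.single j 1 : Fin d → ℕ) i = ∑ i, m i + 1 := by
      intro m j
      simp [Finset.sum_add_distrib]
    rintro _ ⟨_, ⟨m, ⟨hm0, hm⟩, rfl⟩, g, hg, rfl⟩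
    rcases hg with rfl | ⟨j, rfl⟩
    · exact Submodule.subset_span ⟨m, ⟨hm0, by omega⟩, by simp⟩
    · simp only
      by_cases hj : j = 0 ∧ m 0 = 1
      · obtain ⟨rfl, h1⟩ := hj
        -- replace `x₀²` by `1 - ∑_{i ≠ 0} xᵢ²`
        obtain ⟨m', rfl⟩ : ∃ m' : Fin d → ℕ, m = m' + Pi.single 0 1 := by
          refine ⟨fun i => if i = 0 then 0 else m i, ?_⟩
          ext i
          by_cases hi : i = 0
          · subst hi; simp [h1]
          · simp [hi]
        have h0 : m' 0 = 0 := by simpa using h1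
        have hsq : coordFun d 0 * coordFun d 0 =
            1 - ∑ i ∈ Finset.univ.erase 0, coordFun d i * coordFun d i := by
          rw [← sum_coordFun_sq d, ← Finset.add_sum_erase _ _ (Finset.mem_univ (0 : Fin d))]
          simp only [pow_two]
          abel
        rw [sumkey] at hm
        rw [← key, mul_assoc, hsq, mul_sub, mul_one, Finset.mul_sum]
        refine Submodule.sub_mem _ (Submodule.subset_span ⟨m', ⟨by omega, by omega⟩, rfl⟩)
          (Submodule.sum_mem _ fun i hi => ?_)
        rw [← mul_assoc, key, key]
        refine Submodule.subset_span ⟨_, ⟨?_, ?_⟩, rfl⟩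
        · have : (0 : Fin d) ≠ i := (Finset.ne_of_mem_erase hi).symm
          simp [h0, this]
        · rw [sumkey, sumkey]; omega
      · rw [key]
        refine Submodule.subset_span ⟨_, ⟨?_, ?_⟩, rfl⟩
        · by_cases hj0 : j = 0
          · subst hj0
            have : m 0 ≠ 1 := fun h => hj ⟨rfl, h⟩
            have : m 0 = 0 := by omega
            simp [this]
          · have : (0 : Fin d) ≠ j := fun h => hj0 h.symm
            simpa [this] using hm0
        · rw [sumkey]; omega

theorem finite_monomialSet (d D : ℕ) [NeZero d] :
    ∃ s : Finset C(Sph d, ℝ), s.card ≤ 2 * (D + 1) ^ (d - 1) ∧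
      polySpace d D ≤ Submodule.span ℝ (s : Set C(Sph d, ℝ)) := by
  classical
  let I : Finset (Fin d → ℕ) :=
    Fintype.piFinset fun i => if i = 0 then Finset.range 2 else Finset.range (D + 1)
  refine ⟨I.image fun m => ∏ i, coordFun d i ^ m i, ?_, ?_⟩
  · refine Finset.card_image_le.trans (le_of_eq ?_)
    rw [Fintype.card_piFinset, ← Finset.mul_prod_erase _ _ (Finset.mem_univ (0 : Fin d))]
    have : ∏ x ∈ Finset.univ.erase (0 : Fin d),
        (if x = 0 then Finset.range 2 else Finset.range (D + 1)).card =
        ∏ x ∈ Finset.univ.erase (0 : Fin d), (D + 1) := by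
      refine Finset.prod_congr rfl fun x hx => ?_
      rw [if_neg (Finset.ne_of_mem_erase hx)]
      simp
    rw [this]
    simp
  · refine (polySpace_le_span d D).trans (Submodule.span_mono ?_)
    rintro _ ⟨m, ⟨h0, hm⟩, rfl⟩
    simp only [Finset.coe_image, Set.mem_image, Finset.mem_coe]
    refine ⟨m, ?_, rfl⟩
    rw [Fintype.mem_piFinset]
    intro i
    by_cases hi : i = 0
    · subst hi; simp; omega
    · simp only [hi, if_false, Finset.mem_range]
      have := Finset.single_le_sum (f := m) (fun _ _ => Nat.zero_le _) (Finset.mem_univ i)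
      omega

instance (d D : ℕ) [NeZero d] : FiniteDimensional ℝ (polySpace d D) := by
  obtain ⟨s, -, hs⟩ := finite_monomialSet d D
  exact Submodule.finiteDimensional_of_le hs

theorem finrank_polySpace_le (d D : ℕ) [NeZero d] :
    Module.finrank ℝ (polySpace d D) ≤ 2 * (D + 1) ^ (d - 1) := by
  obtain ⟨s, hc, hs⟩ := finite_monomialSet d D
  exact (Submodule.finrank_mono hs).trans ((finrank_span_finset_le_card s).trans hc)

/-! ### Nikolskii inequalities -/

theorem integrable_continuousMap {d : ℕ} (f : C(Sph d, ℝ)) : Integrable f (surf d) :=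
  f.continuous.integrable_of_hasCompactSupport (HasCompactSupport.of_compactSpace f)

theorem integrable_of_continuous {d : ℕ} {f : Sph d → ℝ} (hf : Continuous f) :
    Integrable f (surf d) := integrable_continuousMap ⟨f, hf⟩

theorem exists_orthonormal_polySpace (d D : ℕ) [NeZero d] :
    ∃ e : Fin (Module.finrank ℝ (polySpace d D)) → C(Sph d, ℝ), (∀ l, e l ∈ polySpace d D) ∧
      (∀ k l, ∫ x, e k x * e l x ∂(surf d) = if k = l then 1 else 0) ∧
      ∀ f ∈ polySpace d D, ∃ c : Fin (Module.finrank ℝ (polySpace d D)) → ℝ,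
        f = ∑ l, c l • e l := by
  let L : C(Sph d, ℝ) →ₗ[ℝ] Lp ℝ 2 (surf d) :=
    (ContinuousMap.toLp (E := ℝ) 2 (surf d) ℝ).toLinearMap
  have hL : Function.Injective L := ContinuousMap.toLp_injective (surf d)
  let V := (polySpace d D).map L
  have hV : Module.finrank ℝ V = Module.finrank ℝ (polySpace d D) :=
    (Submodule.equivMapOfInjective L hL (polySpace d D)).finrank_eq.symm
  let b := (stdOrthonormalBasis ℝ V).reindex (finCongr hV)
  have hmem : ∀ l, ∃ f ∈ polySpace d D, L f = (b l : Lp ℝ 2 (surf d)) := fun l => (b l).2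
  choose Y hY hYb using hmem
  refine ⟨Y, hY, ?_, ?_⟩
  · intro k l
    have h := orthonormal_iff_ite.1 b.orthonormal l k
    rw [Submodule.coe_inner, ← hYb, ← hYb] at h
    have h2 := ContinuousMap.inner_toLp (𝕜 := ℝ) (surf d) (Y l) (Y k)
    have h3 : inner ℝ (L (Y l)) (L (Y k)) = ∫ x, Y k x * Y l x ∂(surf d) := by
      refine h2.trans ?_
      simp
    rw [← h3, h]
    simp [eq_comm]
  · intro f hf
    have hfV : L f ∈ V := ⟨f, hf, rfl⟩
    have hs := b.sum_repr ⟨L f, hfV⟩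
    have hs' : ∑ l, b.repr ⟨L f, hfV⟩ l • L (Y l) = L f := by
      have := congrArg (Subtype.val) hs
      simpa [hYb] using this
    refine ⟨fun l => b.repr ⟨L f, hfV⟩ l, hL ?_⟩
    refine hs'.symm.trans ?_
    simp only [map_sum, map_smul]

/-- The constant in the Nikolskii inequalities for polynomials of degree at most `D`: a bound
for the dimension of their space, divided by the area of the sphere. -/
def nikolskii (d D : ℕ) : ℝ := 2 * ((D : ℝ) + 1) ^ (d - 1) / (surf d).real Set.univ

theorem surf_real_univ_pos (d : ℕ) [NeZero d] : 0 < (surf d).real Set.univ := by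
  have : Nonempty (Fin d) := ⟨0⟩
  have h : surf d ≠ 0 := by
    unfold surf
    exact Measure.toSphere_ne_zero _
  have : NeZero (surf d) := ⟨h⟩
  exact measureReal_univ_pos

theorem nikolskii_pos (d D : ℕ) [NeZero d] : 0 < nikolskii d D := by
  have := surf_real_univ_pos d
  unfold nikolskii
  positivity

/-- By rotation invariance the Christoffel function `∑ₗ eₗ(x)²` of the polynomials of degree at
most `D` is constant, hence equal to their dimension divided by the area of the sphere. -/
theorem sq_le_nikolskii_mul_integral_sq {d D : ℕ} [NeZero d] {f : C(Sph d, ℝ)}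
    (hf : f ∈ polySpace d D) (x : Sph d) :
    f x ^ 2 ≤ nikolskii d D * ∫ y, f y ^ 2 ∂(surf d) := by
  obtain ⟨e, he, horth, hspan⟩ := exists_orthonormal_polySpace d D
  have hnorm : ∀ c : Fin (Module.finrank ℝ (polySpace d D)) → ℝ,
      ∫ y, (∑ l, c l • e l : C(Sph d, ℝ)) y ^ 2 ∂(surf d) = ∑ l, c l ^ 2 := by
    intro c
    have h1 : ∀ y, (∑ l, c l • e l : C(Sph d, ℝ)) y ^ 2 =
        ∑ k, ∑ l, (c k * c l) * (e k y * e l y) := by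
      intro y
      rw [pow_two, ContinuousMap.sum_apply, Finset.sum_mul_sum]
      refine Finset.sum_congr rfl fun k _ => Finset.sum_congr rfl fun l _ => ?_
      simp only [ContinuousMap.smul_apply, smul_eq_mul]
      ring
    have hint : ∀ k l, Integrable (fun y => (c k * c l) * (e k y * e l y)) (surf d) := fun k l =>
      (integrable_continuousMap (e k * e l)).const_mul _
    simp_rw [h1]
    rw [integral_finsetSum _ fun k _ => integrable_finsetSum _ fun l _ => hint k l]
    simp_rw [fun k => integral_finsetSum (μ := surf d) Finset.univ fun l _ => hint k l,
      integral_const_mul, horth]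
    simp [pow_two]
  let S : Sph d → ℝ := fun x => ∑ l, e l x ^ 2
  have hCS : ∀ g ∈ polySpace d D, ∀ x, g x ^ 2 ≤ S x * ∫ y, g y ^ 2 ∂(surf d) := by
    intro g hg x
    obtain ⟨c, rfl⟩ := hspan g hg
    rw [hnorm, mul_comm]
    have := Finset.sum_mul_sq_le_sq_mul_sq Finset.univ c (fun l => e l x)
    simpa [ContinuousMap.sum_apply] using this
  have hle : ∀ x x', S x' ≤ S x := by
    intro x x'
    -- the reproducing kernel at `x' = Ux`, composed with `U`, has the value `S x'` at `x` and the
    -- squared norm `S x'`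
    obtain ⟨U, rfl⟩ := exists_sphMap_eq x x'
    let g : C(Sph d, ℝ) := ∑ l, e l (sphMap U x) • e l
    have hg : g ∈ polySpace d D :=
      Submodule.sum_mem _ fun l _ => Submodule.smul_mem _ _ (he l)
    have h1 := hCS _ (comp_sphMap_mem_polySpace hg U) x
    have h2 : ∫ y, (g.comp ⟨sphMap U, continuous_sphMap U⟩) y ^ 2 ∂(surf d) =
        S (sphMap U x) := by
      refine Eq.trans ?_ (hnorm fun l => e l (sphMap U x))
      have hemb : MeasurableEmbedding (sphMap U) := by
        refine (continuous_sphMap U).measurableEmbedding ?_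
        intro a b hab
        have : U a = U b := congrArg Subtype.val hab
        exact Subtype.ext (U.injective this)
      exact (measurePreserving_sphMap U).integral_comp hemb fun y => g y ^ 2
    have h3 : (g.comp ⟨sphMap U, continuous_sphMap U⟩) x = S (sphMap U x) := by
      simp only [ContinuousMap.comp_apply, ContinuousMap.coe_mk, g, ContinuousMap.sum_apply,
        ContinuousMap.smul_apply, smul_eq_mul, S, pow_two]
    rw [h2, h3, pow_two] at h1
    rcases (show 0 ≤ S (sphMap U x) from
      Finset.sum_nonneg fun l _ => sq_nonneg _).eq_or_lt with h0 | h0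
    · rw [← h0]; exact Finset.sum_nonneg fun l _ => sq_nonneg _
    · exact le_of_mul_le_mul_right h1 h0
  have hint : ∫ y, S y ∂(surf d) = Module.finrank ℝ (polySpace d D) := by
    simp only [S]
    rw [integral_finsetSum _ fun l _ => integrable_of_continuous (by fun_prop)]
    simp_rw [pow_two, horth]
    simp
  have hpos := surf_real_univ_pos d
  have hS : ∀ x, S x ≤ nikolskii d D := by
    intro x
    have h1 : ∫ _y, S x ∂(surf d) ≤ ∫ y, S y ∂(surf d) := by
      refine integral_mono (integrable_const _) ?_ fun y => hle y x
      exact integrable_of_continuous (by fun_prop)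
    rw [hint, integral_const, smul_eq_mul] at h1
    have h2 : (Module.finrank ℝ (polySpace d D) : ℝ) ≤ 2 * ((D : ℝ) + 1) ^ (d - 1) := by
      exact_mod_cast finrank_polySpace_le d D
    rw [nikolskii, le_div_iff₀ hpos, mul_comm]
    exact h1.trans h2
  exact (hCS f hf x).trans
    (mul_le_mul_of_nonneg_right (hS x) (integral_nonneg fun y => sq_nonneg _))

theorem abs_le_nikolskii_mul_integral_abs {d D : ℕ} [NeZero d] {f : C(Sph d, ℝ)}
    (hf : f ∈ polySpace d D) (x : Sph d) :
    |f x| ≤ nikolskii d D * ∫ y, |f y| ∂(surf d) := by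
  obtain ⟨z, -, hz⟩ := isCompact_univ.exists_isMaxOn ⟨x, Set.mem_univ x⟩
    (f.continuous.abs.continuousOn (s := Set.univ))
  have hz' : ∀ y, |f y| ≤ |f z| := fun y => hz (Set.mem_univ y)
  refine (hz' x).trans ?_
  rcases (abs_nonneg (f z)).eq_or_lt with h0 | h0
  · rw [← h0]
    exact mul_nonneg (nikolskii_pos d D).le (integral_nonneg fun y => abs_nonneg _)
  have h1 := sq_le_nikolskii_mul_integral_sq hf z
  have h2 : ∫ y, f y ^ 2 ∂(surf d) ≤ |f z| * ∫ y, |f y| ∂(surf d) := by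
    rw [← integral_const_mul]
    refine integral_mono (integrable_continuousMap (f ^ 2))
      ((integrable_continuousMap |f|).const_mul _) fun y => ?_
    simp only
    rw [← sq_abs, pow_two]
    exact mul_le_mul_of_nonneg_right (hz' y) (abs_nonneg _)
  have h3 : |f z| * |f z| ≤ (nikolskii d D * ∫ y, |f y| ∂(surf d)) * |f z| := by
    rw [← pow_two, sq_abs]
    refine h1.trans ((mul_le_mul_of_nonneg_left h2 (nikolskii_pos d D).le).trans (le_of_eq ?_))
    ring
  exact le_of_mul_le_mul_right h3 h0

/-- `H` is an upper envelope of (absolute values of) polynomials of degree at most `D`: at every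
point its value is attained by such a polynomial, which it dominates everywhere. -/
def IsPolyEnvelope (d D : ℕ) (H : Sph d → ℝ) : Prop :=
  ∀ x, ∃ f ∈ polySpace d D, f x = H x ∧ ∀ y, |f y| ≤ H y

/-- Nikolskii's inequality in `L^{2k}`, by applying the one in `L²` to `k`-th powers. -/
theorem IsPolyEnvelope.pow_le {d D : ℕ} [NeZero d] {H : Sph d → ℝ} (hH : IsPolyEnvelope d D H)
    (hc : Continuous H) (k : ℕ) (x : Sph d) :
    H x ^ (2 * k) ≤ nikolskii d (k * D) * ∫ y, H y ^ (2 * k) ∂(surf d) := by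
  obtain ⟨f, hf, hfx, hfy⟩ := hH x
  have h1 := sq_le_nikolskii_mul_integral_sq (pow_mem_polySpace hf k) x
  simp only [ContinuousMap.pow_apply, ← pow_mul, mul_comm k 2] at h1
  rw [← hfx]
  refine h1.trans (mul_le_mul_of_nonneg_left ?_ (nikolskii_pos d _).le)
  refine integral_mono (integrable_continuousMap (f ^ (2 * k)))
    (integrable_of_continuous (by fun_prop)) fun y => ?_
  have := pow_le_pow_left₀ (abs_nonneg _) (hfy y) (2 * k)
  simp only
  rwa [Even.pow_abs (by simp)] at this

theorem isPolyEnvelope_abs {d D : ℕ} {f : C(Sph d, ℝ)} (hf : f ∈ polySpace d D) :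
    IsPolyEnvelope d D fun x => |f x| := by
  intro x
  rcases le_total 0 (f x) with h | h
  · exact ⟨f, hf, (abs_of_nonneg h).symm, fun y => le_rfl⟩
  · exact ⟨-f, Submodule.neg_mem _ hf, by simp [abs_of_nonpos h], fun y => by simp⟩

/-- A sum of absolute values is the envelope of the combinations with signs as coefficients. -/
theorem isPolyEnvelope_sum_abs {d D : ℕ} {ι : Type*} (s : Finset ι) {f : ι → C(Sph d, ℝ)}
    (hf : ∀ i ∈ s, f i ∈ polySpace d D) {c : ℝ} (hc : 0 ≤ c) :
    IsPolyEnvelope d D fun x => c * ∑ i ∈ s, |f i x| := by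
  intro x
  refine ⟨c • ∑ i ∈ s, (SignType.sign (f i x) : ℝ) • f i, ?_, ?_, fun y => ?_⟩
  · exact Submodule.smul_mem _ _ (Submodule.sum_mem _ fun i hi => Submodule.smul_mem _ _ (hf i hi))
  · simp [sign_mul_self]
  · simp only [ContinuousMap.smul_apply, ContinuousMap.sum_apply, smul_eq_mul, abs_mul,
      abs_of_nonneg hc]
    refine mul_le_mul_of_nonneg_left ((Finset.abs_sum_le_sum_abs _ _).trans
      (Finset.sum_le_sum fun i _ => ?_)) hc
    rw [abs_mul]
    refine mul_le_of_le_one_left (abs_nonneg _) ?_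
    rcases lt_trichotomy (f i x) 0 with h | h | h <;> simp [h]

/-! ### The smoothed projection kernels -/

theorem projKernel_comm (d n : ℕ) (x y : Sph d) : projKernel d n x y = projKernel d n y x :=
  Finset.sum_congr rfl fun _ _ => mul_comm _ _

theorem continuous_projKernel (d n : ℕ) :
    Continuous fun z : Sph d × Sph d => projKernel d n z.1 z.2 := by
  unfold projKernel
  fun_prop

theorem eval_neg_sphere {d n : ℕ} {p : MvPolynomial (Fin d) ℝ} (hp : p.IsHomogeneous n)
    (y : Sph d) :
    MvPolynomial.eval (fun i => ((-y : Sph d) : EuclideanSpace ℝ (Fin d)) i) p =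
      (-1) ^ n * MvPolynomial.eval (fun i => (y : EuclideanSpace ℝ (Fin d)) i) p := by
  rw [MvPolynomial.eval_eq', MvPolynomial.eval_eq', Finset.mul_sum]
  refine Finset.sum_congr rfl fun m hm => ?_
  have h1 : ∑ i, m i = n := by
    have := hp (MvPolynomial.mem_support_iff.1 hm)
    rw [Finsupp.weight_apply, Finsupp.sum_fintype _ _ (by simp)] at this
    simpa using this
  have h2 : ∀ i, ((-y : Sph d) : EuclideanSpace ℝ (Fin d)) i ^ m i =
      (-1) ^ m i * (y : EuclideanSpace ℝ (Fin d)) i ^ m i := fun i => by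
    rw [← mul_pow]
    simp
  simp_rw [h2, Finset.prod_mul_distrib, Finset.prod_pow_eq_pow_sum, h1]
  ring

/-- Harmonics of degree `n` have the parity of `n`. -/
theorem projKernel_neg_right (d n : ℕ) (x y : Sph d) :
    projKernel d n x (-y) = (-1) ^ n * projKernel d n x y := by
  unfold projKernel
  rw [Finset.mul_sum]
  refine Finset.sum_congr rfl fun l _ => ?_
  have hmem : (exists_orthonormalHarmonicBasis d n).choose_spec.choose l ∈
      surfaceHarmonics d n := by
    rw [← (exists_orthonormalHarmonicBasis d n).choose_spec.choose_spec.span_eq]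
    exact Submodule.subset_span ⟨l, rfl⟩
  obtain ⟨p, hp, -, hf⟩ := hmem
  rw [hf (-y), hf y]
  rw [eval_neg_sphere hp y]
  ring

variable {d : ℕ} {χ : ℕ → ℕ → ℝ} {T : ℕ}

theorem smoothKernel_comm (χ : ℕ → ℕ → ℝ) (T : ℕ) (x y : Sph d) :
    smoothKernel d χ T x y = smoothKernel d χ T y x :=
  Finset.sum_congr rfl fun n _ => by rw [projKernel_comm]

theorem continuous_smoothKernel (d : ℕ) (χ : ℕ → ℕ → ℝ) (T : ℕ) :
    Continuous fun z : Sph d × Sph d => smoothKernel d χ T z.1 z.2 := by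
  unfold smoothKernel
  exact continuous_finsetSum _ fun n _ => (continuous_projKernel d n).const_mul _

theorem continuous_smoothKernel_right (χ : ℕ → ℕ → ℝ) (T : ℕ) (x : Sph d) :
    Continuous fun y => smoothKernel d χ T x y :=
  (continuous_smoothKernel d χ T).comp (Continuous.prodMk_right x)

theorem continuous_smoothKernel_left (χ : ℕ → ℕ → ℝ) (T : ℕ) (x : Sph d) :
    Continuous fun y => smoothKernel d χ T y x :=
  (continuous_smoothKernel d χ T).comp (Continuous.prodMk_left x)

/-- The kernel maps integrable functions to polynomials of degree at most `T`. -/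
theorem exists_polySpace_eq_integral_smoothKernel (χ : ℕ → ℕ → ℝ) (T : ℕ) {φ : Sph d → ℝ}
    (μ : Measure (Sph d)) [IsFiniteMeasure μ] (hφ : Integrable φ μ) :
    ∃ f ∈ polySpace d T, ∀ x, f x = ∫ y, smoothKernel d χ T y x * φ y ∂μ := by
  have hint : ∀ g : C(Sph d, ℝ), Integrable (fun y => g y * φ y) μ := fun g =>
    hφ.bdd_mul g.continuous.aestronglyMeasurable (Eventually.of_forall g.norm_coe_le_norm)
  refine ⟨∑ n ∈ Finset.range (T + 1), χ n T •
    ∑ l, (∫ y, (exists_orthonormalHarmonicBasis d n).choose_spec.choose l y * φ y ∂μ) •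
      (exists_orthonormalHarmonicBasis d n).choose_spec.choose l, ?_, fun x => ?_⟩
  · refine Submodule.sum_mem _ fun n hn => Submodule.smul_mem _ _ (Submodule.sum_mem _ fun l _ =>
      Submodule.smul_mem _ _ (polySpace_mono (Nat.le_of_lt_succ (Finset.mem_range.1 hn))
        (surfaceHarmonics_le_polySpace d n ?_)))
    rw [← (exists_orthonormalHarmonicBasis d n).choose_spec.choose_spec.span_eq]
    exact Submodule.subset_span ⟨l, rfl⟩
  · have h1 : ∀ y, smoothKernel d χ T y x * φ y = ∑ n ∈ Finset.range (T + 1),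
        ∑ l, (χ n T * (exists_orthonormalHarmonicBasis d n).choose_spec.choose l x) *
          ((exists_orthonormalHarmonicBasis d n).choose_spec.choose l y * φ y) := by
      intro y
      rw [smoothKernel, Finset.sum_mul]
      refine Finset.sum_congr rfl fun n _ => ?_
      rw [projKernel, Finset.mul_sum, Finset.sum_mul]
      exact Finset.sum_congr rfl fun l _ => by ring
    simp_rw [h1]
    rw [integral_finsetSum _ fun n _ => integrable_finsetSum _ fun l _ => (hint _).const_mul _]
    simp_rw [ContinuousMap.sum_apply]
    refine Finset.sum_congr rfl fun n _ => ?_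
    rw [integral_finsetSum _ fun l _ => (hint _).const_mul _, ContinuousMap.smul_apply,
      ContinuousMap.sum_apply, smul_eq_mul, Finset.mul_sum]
    refine Finset.sum_congr rfl fun l _ => ?_
    rw [integral_const_mul, ContinuousMap.smul_apply, smul_eq_mul]
    ring

theorem exists_polySpace_eq_smoothKernel (χ : ℕ → ℕ → ℝ) (T : ℕ) (y : Sph d) :
    ∃ f ∈ polySpace d T, ∀ x, f x = smoothKernel d χ T y x := by
  obtain ⟨f, hf, h⟩ := exists_polySpace_eq_integral_smoothKernel χ T
    (φ := fun _ => 1) (Measure.dirac y) (integrable_const _)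
  exact ⟨f, hf, fun x => by simp [h x]⟩

/-- The weights of the odd part of a smoothed projection kernel. -/
def oddWeights (χ : ℕ → ℕ → ℝ) (n T : ℕ) : ℝ := χ n T * ((1 - (-1) ^ n) / 2)

theorem oddKernel_eq_smoothKernel (χ : ℕ → ℕ → ℝ) (T : ℕ) (x y : Sph d) :
    oddKernel d χ T x y = smoothKernel d (oddWeights χ) T x y := by
  unfold oddKernel smoothKernel
  rw [← Finset.sum_sub_distrib, Finset.sum_div]
  refine Finset.sum_congr rfl fun n _ => ?_
  rw [projKernel_neg_right, oddWeights]
  ring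

theorem integral_abs_oddKernel_le {B : ℝ}
    (hB : ∀ x : Sph d, ∫ y, |smoothKernel d χ T x y| ∂(surf d) ≤ B) (x : Sph d) :
    ∫ y, |smoothKernel d (oddWeights χ) T x y| ∂(surf d) ≤ B := by
  have hc := continuous_smoothKernel_right (d := d) χ T x
  have h1 : ∀ y, |smoothKernel d (oddWeights χ) T x y| ≤
      (|smoothKernel d χ T x y| + |smoothKernel d χ T x (-y)|) / 2 := by
    intro y
    rw [← oddKernel_eq_smoothKernel, oddKernel, abs_div, abs_two]
    gcongr
    exact abs_sub _ _
  have h2 : Integrable (fun y => |smoothKernel d χ T x y|) (surf d) :=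
    integrable_of_continuous hc.abs
  have h3 : Integrable (fun y => |smoothKernel d χ T x (-y)|) (surf d) :=
    integrable_of_continuous (hc.comp continuous_neg).abs
  calc _ ≤ ∫ y, (|smoothKernel d χ T x y| + |smoothKernel d χ T x (-y)|) / 2 ∂(surf d) :=
        integral_mono (integrable_of_continuous (continuous_smoothKernel_right _ T x).abs)
          ((h2.add h3).div_const 2) h1
    _ = (∫ y, |smoothKernel d χ T x y| ∂(surf d) +
          ∫ y, |smoothKernel d χ T x (-y)| ∂(surf d)) / 2 := by
        rw [integral_div, integral_add h2 h3]
    _ = ∫ y, |smoothKernel d χ T x y| ∂(surf d) := by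
        rw [integral_neg_surf fun y => |smoothKernel d χ T x y|]
        ring
    _ ≤ B := hB x

theorem abs_smoothKernel_le [NeZero d] {B : ℝ}
    (hB : ∀ x : Sph d, ∫ y, |smoothKernel d χ T x y| ∂(surf d) ≤ B) (x y : Sph d) :
    |smoothKernel d χ T x y| ≤ nikolskii d T * B := by
  obtain ⟨f, hf, hfx⟩ := exists_polySpace_eq_smoothKernel χ T x
  have h := abs_le_nikolskii_mul_integral_abs hf y
  simp only [hfx] at h
  exact h.trans (mul_le_mul_of_nonneg_left (hB x) (nikolskii_pos d T).le)

theorem integral_sq_smoothKernel_le [NeZero d] {B : ℝ}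
    (hB : ∀ x : Sph d, ∫ y, |smoothKernel d χ T x y| ∂(surf d) ≤ B) (x : Sph d) :
    ∫ y, smoothKernel d χ T x y ^ 2 ∂(surf d) ≤ nikolskii d T * B * B := by
  have hB0 : 0 ≤ B := (integral_nonneg fun y => abs_nonneg _).trans (hB x)
  have hc := continuous_smoothKernel_right (d := d) χ T x
  calc _ ≤ ∫ y, nikolskii d T * B * |smoothKernel d χ T x y| ∂(surf d) := by
        refine integral_mono (integrable_of_continuous (hc.pow 2))
          ((integrable_of_continuous hc.abs).const_mul _) fun y => ?_
        simp only
        rw [← sq_abs, pow_two]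
        exact mul_le_mul_of_nonneg_right (abs_smoothKernel_le hB x y) (abs_nonneg _)
    _ ≤ _ := by
        rw [integral_const_mul]
        exact mul_le_mul_of_nonneg_left (hB x) (mul_nonneg (nikolskii_pos d T).le hB0)

theorem nikolskii_two_mul_le (d : ℕ) {T : ℕ} (hT : 1 ≤ T) :
    nikolskii d (2 * T) ≤ nikolskii d 2 * (T : ℝ) ^ (d - 1) := by
  have h1 : (1 : ℝ) ≤ T := by exact_mod_cast hT
  unfold nikolskii
  rw [div_mul_eq_mul_div, mul_assoc, ← mul_pow]
  push_cast
  gcongr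
  linarith

/-! ### Moments of means of bounded i.i.d. variables -/

section Moments

variable {Ω : Type*} [MeasurableSpace Ω] {P : Measure Ω}

theorem mgf_sum_le_exp {W : ℕ → Ω → ℝ} (hm : ∀ i, Measurable (W i)) (hind : iIndepFun W P)
    {t c : ℝ} (h : ∀ i, mgf (W i) P t ≤ Real.exp c) (N : ℕ) :
    mgf (∑ i ∈ Finset.range N, W i) P t ≤ Real.exp (N * c) := by
  rw [hind.mgf_sum hm]
  refine (Finset.prod_le_prod (fun i _ => mgf_nonneg) fun i _ => h i).trans (le_of_eq ?_)
  rw [Finset.prod_const, Finset.card_range, ← Real.exp_nat_mul]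

theorem lintegral_pow_le_of_integral_exp_le {H : Ω → ℝ} (h0 : ∀ ω, 0 ≤ H ω) {t K : ℝ}
    (ht : 0 < t) (hi : Integrable (fun ω => Real.exp (t * H ω)) P)
    (hK : ∫ ω, Real.exp (t * H ω) ∂P ≤ K) (k : ℕ) :
    ∫⁻ ω, ENNReal.ofReal (H ω ^ (2 * k)) ∂P ≤
      ENNReal.ofReal ((2 * k / t) ^ (2 * k) * K) := by
  have hle : ∀ ω, H ω ^ (2 * k) ≤ (2 * k / t) ^ (2 * k) * Real.exp (t * H ω) := by
    intro ω
    have h1 := Real.pow_div_factorial_le_exp _ (mul_nonneg ht.le (h0 ω)) (2 * k)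
    have h2 : (((2 * k).factorial : ℕ) : ℝ) ≤ ((2 * k : ℕ) : ℝ) ^ (2 * k) := by
      exact_mod_cast Nat.factorial_le_pow (2 * k)
    rw [div_le_iff₀ (by positivity)] at h1
    have h3 : (t * H ω) ^ (2 * k) ≤ Real.exp (t * H ω) * (2 * k) ^ (2 * k) := by
      refine h1.trans (mul_le_mul_of_nonneg_left ?_ (Real.exp_pos _).le)
      exact_mod_cast h2
    rw [div_pow, div_mul_eq_mul_div, le_div_iff₀ (by positivity), ← mul_pow, mul_comm (H ω)]
    linarith
  calc _ ≤ ∫⁻ ω, ENNReal.ofReal ((2 * k / t) ^ (2 * k) * Real.exp (t * H ω)) ∂P :=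
        lintegral_mono fun ω => ENNReal.ofReal_le_ofReal (hle ω)
    _ = ENNReal.ofReal (∫ ω, (2 * k / t) ^ (2 * k) * Real.exp (t * H ω) ∂P) :=
        (ofReal_integral_eq_lintegral_ofReal (hi.const_mul _)
          (Eventually.of_forall fun ω => by positivity)).symm
    _ ≤ _ := by
        rw [integral_const_mul]
        exact ENNReal.ofReal_le_ofReal (mul_le_mul_of_nonneg_left hK (by positivity))

variable [IsProbabilityMeasure P]

theorem integrable_of_abs_le {W : Ω → ℝ} (hm : Measurable W) {b : ℝ} (hb : ∀ ω, |W ω| ≤ b) :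
    Integrable W P :=
  Integrable.of_bound hm.aestronglyMeasurable b (Eventually.of_forall hb)

theorem integrable_exp_mul_of_abs_le {W : Ω → ℝ} (hm : Measurable W) {b : ℝ}
    (hb : ∀ ω, |W ω| ≤ b) (t : ℝ) : Integrable (fun ω => Real.exp (t * W ω)) P := by
  refine integrable_of_abs_le (b := Real.exp (|t| * b)) (by fun_prop) fun ω => ?_
  rw [Real.abs_exp]
  refine Real.exp_le_exp.2 ((le_abs_self _).trans ?_)
  rw [abs_mul]
  exact mul_le_mul_of_nonneg_left (hb ω) (abs_nonneg _)

/-- Bernstein's bound for the moment generating function of a bounded centred variable. -/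
theorem mgf_le_exp_sq_mul {W : Ω → ℝ} (hm : Measurable W) {b v t : ℝ} (hb : ∀ ω, |W ω| ≤ b)
    (h0 : ∫ ω, W ω ∂P = 0) (hv : ∫ ω, W ω ^ 2 ∂P ≤ v) (ht : |t| * b ≤ 1) :
    mgf W P t ≤ Real.exp (t ^ 2 * v) := by
  have hsq : Integrable (fun ω => W ω ^ 2) P := by
    refine integrable_of_abs_le (b := b ^ 2) (by fun_prop) fun ω => ?_
    rw [abs_pow]
    exact pow_le_pow_left₀ (abs_nonneg _) (hb ω) 2
  have hi := integrable_of_abs_le (P := P) hm hb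
  have hle : ∀ ω, Real.exp (t * W ω) ≤ 1 + t * W ω + t ^ 2 * W ω ^ 2 := by
    intro ω
    have h1 : |t * W ω| ≤ 1 := by
      rw [abs_mul]
      exact (mul_le_mul_of_nonneg_left (hb ω) (abs_nonneg _)).trans ht
    have h2 := (abs_le.1 (Real.abs_exp_sub_one_sub_id_le h1)).2
    rw [mul_pow] at h2
    linarith
  have hi1 : Integrable (fun ω => 1 + t * W ω) P := (integrable_const _).add (hi.const_mul _)
  calc mgf W P t ≤ ∫ ω, (1 + t * W ω + t ^ 2 * W ω ^ 2) ∂P :=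
        integral_mono (integrable_exp_mul_of_abs_le hm hb t) (hi1.add (hsq.const_mul _)) hle
    _ = 1 + t ^ 2 * ∫ ω, W ω ^ 2 ∂P := by
        rw [integral_add hi1 (hsq.const_mul _),
          integral_add (integrable_const _) (hi.const_mul _), integral_const_mul,
          integral_const_mul, h0]
        simp
    _ ≤ t ^ 2 * v + 1 := by nlinarith [sq_nonneg t]
    _ ≤ _ := Real.add_one_le_exp _

theorem mgf_le_exp_two_mul {W : Ω → ℝ} (hm : Measurable W) {b μ t : ℝ} (h0 : ∀ ω, 0 ≤ W ω)
    (hb : ∀ ω, W ω ≤ b) (hμ : ∫ ω, W ω ∂P ≤ μ) (ht0 : 0 ≤ t) (ht : t * b ≤ 1) :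
    mgf W P t ≤ Real.exp (2 * t * μ) := by
  have hb' : ∀ ω, |W ω| ≤ b := fun ω => by rw [abs_of_nonneg (h0 ω)]; exact hb ω
  have hi := integrable_of_abs_le (P := P) hm hb'
  have hle : ∀ ω, Real.exp (t * W ω) ≤ 1 + 2 * t * W ω := by
    intro ω
    have h3 : 0 ≤ t * W ω := mul_nonneg ht0 (h0 ω)
    have h1 : t * W ω ≤ 1 := (mul_le_mul_of_nonneg_left (hb ω) ht0).trans ht
    have h2 := (abs_le.1 (Real.abs_exp_sub_one_sub_id_le (x := t * W ω)
      (by rwa [abs_of_nonneg h3]))).2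
    nlinarith
  calc mgf W P t ≤ ∫ ω, (1 + 2 * t * W ω) ∂P :=
        integral_mono (integrable_exp_mul_of_abs_le hm hb' t)
          ((integrable_const _).add (hi.const_mul _)) hle
    _ = 1 + 2 * t * ∫ ω, W ω ∂P := by
        rw [integral_add (integrable_const _) (hi.const_mul _), integral_const_mul]
        simp
    _ ≤ 2 * t * μ + 1 := by
        have := mul_le_mul_of_nonneg_left hμ (show 0 ≤ 2 * t by linarith)
        linarith
    _ ≤ _ := Real.add_one_le_exp _

variable {W : ℕ → Ω → ℝ}

theorem lintegral_pow_mean_le (hm : ∀ i, Measurable (W i)) (hind : iIndepFun W P)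
    (hid : ∀ i, IdentDistrib (W i) (W 0) P P) {c μ : ℝ} (h0 : ∀ i ω, 0 ≤ W i ω)
    (hc : ∀ i ω, W i ω ≤ c) (hμ : ∫ ω, W 0 ω ∂P ≤ μ) {N k : ℕ} (hN : 1 ≤ N) (hk : 1 ≤ k)
    (hkN : k * c ≤ N) :
    ∫⁻ ω, ENNReal.ofReal (((N : ℝ)⁻¹ * ∑ i ∈ Finset.range N, W i ω) ^ (2 * k)) ∂P ≤
      ENNReal.ofReal (2 * (2 * Real.exp μ) ^ (2 * k)) := by
  have hN' : (0 : ℝ) < N := by exact_mod_cast hN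
  have hk' : (0 : ℝ) < k := by exact_mod_cast hk
  have hmgf : mgf (∑ i ∈ Finset.range N, W i) P (k / N) ≤ Real.exp (N * (2 * (k / N) * μ)) := by
    refine mgf_sum_le_exp hm hind (fun i => ?_) N
    refine mgf_le_exp_two_mul (hm i) (h0 i) (hc i) ?_ (by positivity) ?_
    · rwa [(hid i).integral_eq]
    · rwa [div_mul_eq_mul_div, div_le_one hN']
  have hsum : ∀ ω, (k : ℝ) * ((N : ℝ)⁻¹ * ∑ i ∈ Finset.range N, W i ω) =
      k / N * (∑ i ∈ Finset.range N, W i) ω := by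
    intro ω
    rw [Finset.sum_apply]
    ring
  refine (lintegral_pow_le_of_integral_exp_le (t := k) (K := Real.exp (2 * k * μ))
    (fun ω => mul_nonneg (by positivity) (Finset.sum_nonneg fun i _ => h0 i ω)) hk' ?_ ?_ k).trans
    (ENNReal.ofReal_le_ofReal ?_)
  · simp_rw [hsum]
    refine integrable_exp_mul_of_abs_le (P := P) (b := N * c)
      (by rw [Finset.sum_fn]; exact Finset.measurable_sum _ fun i _ => hm i) (fun ω => ?_) _
    rw [Finset.sum_apply, abs_of_nonneg (Finset.sum_nonneg fun i _ => h0 i ω)]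
    refine (Finset.sum_le_card_nsmul _ _ _ fun i _ => hc i ω).trans (le_of_eq (by simp))
  · simp_rw [hsum]
    refine hmgf.trans (le_of_eq ?_)
    congr 1
    field_simp
  · rw [mul_div_assoc, div_self hk'.ne', mul_one, mul_pow, ← Real.exp_nat_mul]
    have : 0 ≤ 2 ^ (2 * k) * Real.exp (2 * k * μ) := by positivity
    push_cast
    linarith

theorem lintegral_pow_centred_mean_le (hm : ∀ i, Measurable (W i)) (hind : iIndepFun W P)
    (hid : ∀ i, IdentDistrib (W i) (W 0) P P) {b v : ℝ} (hb : ∀ i ω, |W i ω| ≤ b)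
    (hv0 : 0 < v) (hv : ∫ ω, W 0 ω ^ 2 ∂P ≤ v) {N k : ℕ} (hN : 1 ≤ N) (hk : 1 ≤ k)
    (hkN : 4 * b ^ 2 * k ≤ v * N) :
    ∫⁻ ω, ENNReal.ofReal
        (|(N : ℝ)⁻¹ * ∑ i ∈ Finset.range N, W i ω - ∫ ω, W 0 ω ∂P| ^ (2 * k)) ∂P ≤
      ENNReal.ofReal (2 * (2 * Real.exp (1 / 2) * √(k * v / N)) ^ (2 * k)) := by
  have hN' : (0 : ℝ) < N := by exact_mod_cast hN
  have hk' : (0 : ℝ) < k := by exact_mod_cast hk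
  have : Nonempty Ω := P.nonempty_of_neZero
  have hb0 : 0 ≤ b := (abs_nonneg _).trans (hb 0 (Classical.arbitrary Ω))
  set μ := ∫ ω, W 0 ω ∂P with hμ
  have hμb : |μ| ≤ b := by
    refine (norm_integral_le_of_norm_le_const (μ := P) (f := W 0)
      (Eventually.of_forall (hb 0))).trans (le_of_eq ?_)
    simp
  let V : ℕ → Ω → ℝ := fun i ω => W i ω - μ
  have hVm : ∀ i, Measurable (V i) := fun i => (hm i).sub_const _
  have hVind : iIndepFun V P := hind.comp (fun _ x => x - μ) fun _ => by fun_prop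
  have hVb : ∀ i ω, |V i ω| ≤ 2 * b := fun i ω => by
    refine (abs_sub _ _).trans ?_
    have := hb i ω
    linarith
  have hi : ∀ i, Integrable (W i) P := fun i => integrable_of_abs_le (hm i) (hb i)
  have hV0 : ∀ i, ∫ ω, V i ω ∂P = 0 := fun i => by
    simp only [V]
    rw [integral_sub (hi i) (integrable_const _), (hid i).integral_eq]
    simp [hμ]
  have hV2 : ∀ i, ∫ ω, V i ω ^ 2 ∂P ≤ v := fun i => by
    have h1 : ∫ ω, V i ω ^ 2 ∂P = ∫ ω, V 0 ω ^ 2 ∂P :=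
      ((hid i).comp (u := fun x : ℝ => (x - μ) ^ 2) (by fun_prop)).integral_eq
    have hsq : Integrable (fun ω => W 0 ω ^ 2) P := by
      refine integrable_of_abs_le (b := b ^ 2) (by fun_prop) fun ω => ?_
      rw [abs_pow]
      exact pow_le_pow_left₀ (abs_nonneg _) (hb 0 ω) 2
    have h2 : ∫ ω, V 0 ω ^ 2 ∂P = ∫ ω, W 0 ω ^ 2 ∂P - μ ^ 2 := by
      have : ∀ ω, V 0 ω ^ 2 = W 0 ω ^ 2 - 2 * μ * W 0 ω + μ ^ 2 := fun ω => by
        simp only [V]; ring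
      simp_rw [this]
      have hi1 : Integrable (fun ω => W 0 ω ^ 2 - 2 * μ * W 0 ω) P :=
        hsq.sub ((hi 0).const_mul _)
      rw [integral_add hi1 (integrable_const _),
        integral_sub hsq ((hi 0).const_mul _), integral_const_mul, ← hμ]
      simp
      ring
    rw [h1, h2]
    nlinarith [sq_nonneg μ]
  -- the exponential moment at this `t` is of order `e^k`, matching the moment of order `2k`
  set t := √(k * N / v) with ht
  have ht0 : 0 < t := Real.sqrt_pos.2 (by positivity)
  have ht2 : t ^ 2 = k * N / v := Real.sq_sqrt (by positivity)
  have hmgf : ∀ ε : ℝ, |ε| = 1 →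
      mgf (∑ i ∈ Finset.range N, V i) P (ε * (t / N)) ≤ Real.exp k := by
    intro ε hε
    have h : (N : ℝ) * ((ε * (t / N)) ^ 2 * v) = k := by
      have hε2 : ε ^ 2 = 1 := by rw [← sq_abs, hε, one_pow]
      rw [mul_pow, hε2, div_pow, ht2]
      field_simp
    rw [← h]
    refine mgf_sum_le_exp hVm hVind (fun i => ?_) N
    refine mgf_le_exp_sq_mul (hVm i) (hVb i) (hV0 i) (hV2 i) ?_
    rw [abs_mul, hε, one_mul, abs_of_pos (by positivity), div_mul_eq_mul_div, div_le_one hN']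
    refine abs_le_of_sq_le_sq' ?_ hN'.le |>.2
    rw [mul_pow, ht2, div_mul_eq_mul_div, div_le_iff₀ hv0]
    nlinarith
  have hsum : ∀ ω, t * |(N : ℝ)⁻¹ * ∑ i ∈ Finset.range N, W i ω - μ| =
      |t / N * (∑ i ∈ Finset.range N, V i) ω| := by
    intro ω
    have : (N : ℝ)⁻¹ * ∑ i ∈ Finset.range N, W i ω - μ =
        (N : ℝ)⁻¹ * (∑ i ∈ Finset.range N, V i) ω := by
      rw [Finset.sum_apply]
      simp only [V, Finset.sum_sub_distrib, Finset.sum_const, Finset.card_range, nsmul_eq_mul]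
      field_simp
    rw [this, ← abs_of_pos ht0, ← abs_mul, abs_of_pos ht0]
    congr 1
    ring
  have hSm : Measurable (∑ i ∈ Finset.range N, V i) := by
    rw [Finset.sum_fn]
    exact Finset.measurable_sum _ fun i _ => hVm i
  have hSb : ∀ ω, |(∑ i ∈ Finset.range N, V i) ω| ≤ N * (2 * b) := fun ω => by
    rw [Finset.sum_apply]
    refine (Finset.abs_sum_le_sum_abs _ _).trans
      ((Finset.sum_le_card_nsmul _ _ _ fun i _ => hVb i ω).trans (le_of_eq (by simp)))
  have he : ∀ s, Integrable (fun ω => Real.exp (s * (∑ i ∈ Finset.range N, V i) ω)) P :=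
    integrable_exp_mul_of_abs_le hSm hSb
  have hexp : ∀ ω, Real.exp (t * |(N : ℝ)⁻¹ * ∑ i ∈ Finset.range N, W i ω - μ|) ≤
      Real.exp (1 * (t / N) * (∑ i ∈ Finset.range N, V i) ω) +
        Real.exp (-1 * (t / N) * (∑ i ∈ Finset.range N, V i) ω) := by
    intro ω
    rw [hsum, one_mul, neg_one_mul, neg_mul]
    exact Real.exp_abs_le _
  have hWm : Measurable fun ω => t * |(N : ℝ)⁻¹ * ∑ i ∈ Finset.range N, W i ω - μ| := by
    simp_rw [hsum]
    exact (hSm.const_mul _).abs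
  refine (lintegral_pow_le_of_integral_exp_le (t := t) (K := 2 * Real.exp k)
    (fun ω => abs_nonneg _) ht0 ?_ ?_ k).trans (ENNReal.ofReal_le_ofReal (le_of_eq ?_))
  · refine Integrable.mono' ((he (1 * (t / N))).add (he (-1 * (t / N))))
      (Real.measurable_exp.comp hWm).aestronglyMeasurable (Eventually.of_forall fun ω => ?_)
    rw [Real.norm_eq_abs, Real.abs_exp]
    exact hexp ω
  · calc _ ≤ ∫ ω, (Real.exp (1 * (t / N) * (∑ i ∈ Finset.range N, V i) ω) +
          Real.exp (-1 * (t / N) * (∑ i ∈ Finset.range N, V i) ω)) ∂P :=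
          integral_mono_of_nonneg (Eventually.of_forall fun ω => (Real.exp_pos _).le)
            ((he _).add (he _)) (Eventually.of_forall hexp)
      _ = _ := integral_add (he _) (he _)
      _ ≤ 2 * Real.exp k := by
          have h1 := hmgf 1 (by simp)
          have h2 := hmgf (-1) (by simp)
          unfold mgf at h1 h2
          linarith
  · have h1 : 2 * (k : ℝ) / t = 2 * √(k * v / N) := by
      rw [div_eq_iff ht0.ne', ht, mul_assoc, ← Real.sqrt_mul (by positivity)]
      have : k * v / N * (k * N / v) = (k : ℝ) ^ 2 := by field_simp
      rw [this, Real.sqrt_sq hk'.le]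
    have h2 : Real.exp k = Real.exp (1 / 2) ^ (2 * k) := by
      rw [← Real.exp_nat_mul]
      congr 1
      push_cast
      ring
    rw [h1, h2, mul_pow, mul_pow, mul_pow]
    ring

theorem lintegral_sq_centred_mean_le (hm : ∀ i, Measurable (W i)) (hind : iIndepFun W P)
    (hid : ∀ i, IdentDistrib (W i) (W 0) P P) {b v : ℝ} (hb : ∀ i ω, |W i ω| ≤ b)
    (hv : ∫ ω, W 0 ω ^ 2 ∂P ≤ v) {N : ℕ} (hN : 1 ≤ N) :
    ∫⁻ ω, ENNReal.ofReal
        (((N : ℝ)⁻¹ * ∑ i ∈ Finset.range N, W i ω - ∫ ω, W 0 ω ∂P) ^ 2) ∂P ≤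
      ENNReal.ofReal (v / N) := by
  have hN' : (0 : ℝ) < N := by exact_mod_cast hN
  have hL : ∀ i, MemLp (W i) 2 P := fun i =>
    MemLp.of_bound (hm i).aestronglyMeasurable b (Eventually.of_forall (hb i))
  have hi : ∀ i, Integrable (W i) P := fun i => integrable_of_abs_le (hm i) (hb i)
  have hSL : MemLp (fun ω => (N : ℝ)⁻¹ * ∑ i ∈ Finset.range N, W i ω) 2 P :=
    (memLp_finsetSum _ fun i _ => hL i).const_mul _
  have hmean : ∫ ω, (N : ℝ)⁻¹ * ∑ i ∈ Finset.range N, W i ω ∂P = ∫ ω, W 0 ω ∂P := by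
    rw [integral_const_mul, integral_finsetSum _ fun i _ => hi i,
      Finset.sum_congr rfl fun i _ => (hid i).integral_eq]
    simp [hN'.ne']
  have hvar : Var[fun ω => (N : ℝ)⁻¹ * ∑ i ∈ Finset.range N, W i ω; P] ≤ v / N := by
    rw [variance_const_mul]
    have h1 : Var[fun ω => ∑ i ∈ Finset.range N, W i ω; P] = N * Var[W 0; P] := by
      have h2 := IndepFun.variance_sum (s := Finset.range N) (fun i _ => hL i)
        fun i _ j _ hij => hind.indepFun hij
      have h3 : (fun ω => ∑ i ∈ Finset.range N, W i ω) = ∑ i ∈ Finset.range N, W i := by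
        ext ω; simp
      rw [h3, h2, Finset.sum_congr rfl fun i _ => (hid i).variance_eq]
      simp
    have h4 : Var[W 0; P] ≤ v := (variance_le_expectation_sq (hm 0).aestronglyMeasurable).trans hv
    rw [h1]
    calc _ = Var[W 0; P] / N := by field_simp
      _ ≤ _ := by gcongr
  rw [variance_eq_integral hSL.aemeasurable, hmean] at hvar
  have hint : Integrable (fun ω =>
      ((N : ℝ)⁻¹ * ∑ i ∈ Finset.range N, W i ω - ∫ ω, W 0 ω ∂P) ^ 2) P :=
    (hSL.sub (memLp_const _)).integrable_sq
  rw [← ofReal_integral_eq_lintegral_ofReal hint (Eventually.of_forall fun ω => sq_nonneg _)]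
  exact ENNReal.ofReal_le_ofReal hvar

end Moments

/-! ### Tail bounds for random polynomial envelopes -/

theorem measure_exists_lt_le {Ω : Type*} [MeasurableSpace Ω] {P : Measure Ω}
    [IsProbabilityMeasure P] {d D k : ℕ} [NeZero d] {H : Ω → Sph d → ℝ}
    (hm : Measurable fun z : Ω × Sph d => H z.1 z.2) (hc : ∀ ω, Continuous (H ω))
    (hpos : ∀ ω x, 0 ≤ H ω x) (hH : ∀ ω, IsPolyEnvelope d D (H ω)) {m t : ℝ} (hm0 : 0 < m)
    (ht : 0 < t)
    (hmom : ∀ x, ∫⁻ ω, ENNReal.ofReal (H ω x ^ (2 * k)) ∂P ≤ ENNReal.ofReal (2 * m ^ (2 * k))) :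
    P {ω | ∃ x, t * m < H ω x} ≤
      ENNReal.ofReal (4 * ((k * D : ℕ) + 1 : ℝ) ^ (d - 1) / t ^ (2 * k)) := by
  have hnik := nikolskii_pos d (k * D)
  set A := (t * m) ^ (2 * k) / nikolskii d (k * D) with hA
  have hA0 : 0 < A := by positivity
  have hsub : {ω | ∃ x, t * m < H ω x} ⊆
      {ω | ENNReal.ofReal A ≤ ∫⁻ x, ENNReal.ofReal (H ω x ^ (2 * k)) ∂(surf d)} := by
    rintro ω ⟨x, hx⟩
    have h1 := (hH ω).pow_le (hc ω) k x
    have h2 : (t * m) ^ (2 * k) ≤ H ω x ^ (2 * k) :=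
      pow_le_pow_left₀ (by positivity) hx.le _
    have hi : Integrable (fun x => H ω x ^ (2 * k)) (surf d) :=
      integrable_of_continuous ((hc ω).pow _)
    rw [Set.mem_ofPred_eq, ← ofReal_integral_eq_lintegral_ofReal hi
      (Eventually.of_forall fun x => pow_nonneg (hpos ω x) _)]
    refine ENNReal.ofReal_le_ofReal ?_
    rw [hA, div_le_iff₀' hnik]
    exact h2.trans h1
  have hmeas : Measurable fun z : Ω × Sph d => ENNReal.ofReal (H z.1 z.2 ^ (2 * k)) :=
    (hm.pow_const _).ennreal_ofReal
  have hswap : ∫⁻ ω, ∫⁻ x, ENNReal.ofReal (H ω x ^ (2 * k)) ∂(surf d) ∂P ≤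
      ENNReal.ofReal (2 * m ^ (2 * k) * (surf d).real Set.univ) := by
    rw [lintegral_lintegral_swap hmeas.aemeasurable]
    refine (lintegral_mono hmom).trans (le_of_eq ?_)
    rw [lintegral_const, ENNReal.ofReal_mul (p := 2 * m ^ (2 * k)) (by positivity),
      ofReal_measureReal]
  calc P {ω | ∃ x, t * m < H ω x}
      ≤ (∫⁻ ω, ∫⁻ x, ENNReal.ofReal (H ω x ^ (2 * k)) ∂(surf d) ∂P) / ENNReal.ofReal A :=
        (measure_mono hsub).trans (meas_ge_le_lintegral_div hmeas.lintegral_prod_right'.aemeasurable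
          (by simpa using hA0) ENNReal.ofReal_ne_top)
    _ ≤ ENNReal.ofReal (2 * m ^ (2 * k) * (surf d).real Set.univ) / ENNReal.ofReal A :=
        ENNReal.div_le_div_right hswap _
    _ = _ := by
        rw [← ENNReal.ofReal_div_of_pos hA0]
        congr 1
        have := surf_real_univ_pos d
        rw [hA, nikolskii, mul_pow]
        field_simp
        ring

/-- Moments of order `2k ≥ 2 log N` turn the polynomial loss `(kD+1)^{d-1}` of Nikolskii's
inequality into a constant factor, with a summable tail. -/
theorem measure_exists_lt_le_of_log_le {Ω : Type*} [MeasurableSpace Ω] {P : Measure Ω}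
    [IsProbabilityMeasure P] {d D k N : ℕ} [NeZero d] {H : Ω → Sph d → ℝ}
    (hm : Measurable fun z : Ω × Sph d => H z.1 z.2) (hc : ∀ ω, Continuous (H ω))
    (hpos : ∀ ω x, 0 ≤ H ω x) (hH : ∀ ω, IsPolyEnvelope d D (H ω)) {m : ℝ} (hm0 : 0 < m)
    (hmom : ∀ x, ∫⁻ ω, ENNReal.ofReal (H ω x ^ (2 * k)) ∂P ≤ ENNReal.ofReal (2 * m ^ (2 * k)))
    (hN : 1 ≤ N) (hk : Real.log N ≤ k) (hD : k * D + 1 ≤ N ^ 2) :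
    P {ω | ∃ x, Real.exp d * m < H ω x} ≤ ENNReal.ofReal (4 / (N : ℝ) ^ 2) := by
  refine (measure_exists_lt_le hm hc hpos hH hm0 (Real.exp_pos d) hmom).trans
    (ENNReal.ofReal_le_ofReal ?_)
  have hN' : (0 : ℝ) < N := by exact_mod_cast hN
  have h1 : ((k * D : ℕ) + 1 : ℝ) ^ (d - 1) ≤ ((N : ℝ) ^ 2) ^ (d - 1) := by
    refine pow_le_pow_left₀ (by positivity) ?_ _
    exact_mod_cast hD
  have h2 : ((N : ℝ) ^ 2) ^ d ≤ Real.exp d ^ (2 * k) := by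
    have h3 : (N : ℝ) ≤ Real.exp k := by
      rw [← Real.exp_log hN']
      exact Real.exp_le_exp.2 hk
    calc ((N : ℝ) ^ 2) ^ d ≤ (Real.exp k ^ 2) ^ d := by gcongr
      _ = _ := by
        rw [← Real.exp_nat_mul, ← Real.exp_nat_mul, ← Real.exp_nat_mul]
        congr 1
        push_cast
        ring
  have hd : ((N : ℝ) ^ 2) ^ d = ((N : ℝ) ^ 2) ^ (d - 1) * (N : ℝ) ^ 2 := by
    rw [← pow_succ, Nat.sub_add_cancel (Nat.one_le_iff_ne_zero.2 (NeZero.ne d))]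
  rw [div_le_div_iff₀ (by positivity) (by positivity)]
  rw [hd] at h2
  have h4 : ((k * D : ℕ) + 1 : ℝ) ^ (d - 1) * (N : ℝ) ^ 2 ≤ Real.exp d ^ (2 * k) :=
    (mul_le_mul_of_nonneg_right h1 (by positivity)).trans h2
  linarith

/-! ### Interpolation of norms -/

/-- Log-convexity of the norms between `L^p` and `L^∞`. -/
theorem eLpNorm_le_rpow_mul_rpow {α : Type*} [MeasurableSpace α] {μ : Measure α} {u : α → ℝ}
    {p q : ℝ≥0∞} (hp : p ≠ 0) (hp' : p ≠ ∞) (hpq : p ≤ q) {A M : ℝ≥0∞}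
    (hA : eLpNorm u p μ ≤ A) (hM : ∀ x, ‖u x‖ₑ ≤ M)
    (hM' : M ≠ ∞) :
    eLpNorm u q μ ≤
      A ^ (p.toReal * (q⁻¹).toReal) * M ^ (1 - p.toReal * (q⁻¹).toReal) := by
  rcases eq_or_ne q ∞ with rfl | hq
  · simp only [ENNReal.inv_top, ENNReal.toReal_zero, mul_zero, ENNReal.rpow_zero, sub_zero,
      ENNReal.rpow_one, one_mul, eLpNorm_exponent_top]
    exact essSup_le_of_ae_le _ (Eventually.of_forall hM)
  have hp0 : 0 < p.toReal := ENNReal.toReal_pos hp hp'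
  have hpq' : p.toReal ≤ q.toReal := ENNReal.toReal_mono hq hpq
  have hq0 : 0 < q.toReal := hp0.trans_le hpq'
  have hq00 : q ≠ 0 := fun h => by simp [h] at hq0
  rw [ENNReal.toReal_inv]
  rw [eLpNorm_eq_lintegral_rpow_enorm_toReal hp hp'] at hA
  rw [eLpNorm_eq_lintegral_rpow_enorm_toReal hq00 hq]
  have h1 : ∫⁻ x, ‖u x‖ₑ ^ p.toReal ∂μ ≤ A ^ p.toReal := by
    have := ENNReal.rpow_le_rpow hA hp0.le
    rwa [← ENNReal.rpow_mul, one_div, inv_mul_cancel₀ hp0.ne', ENNReal.rpow_one] at this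
  have h2 : ∫⁻ x, ‖u x‖ₑ ^ q.toReal ∂μ ≤ A ^ p.toReal * M ^ (q.toReal - p.toReal) := by
    calc _ ≤ ∫⁻ x, ‖u x‖ₑ ^ p.toReal * M ^ (q.toReal - p.toReal) ∂μ := by
          refine lintegral_mono fun x => ?_
          calc ‖u x‖ₑ ^ q.toReal = ‖u x‖ₑ ^ (p.toReal + (q.toReal - p.toReal)) := by
                congr 1; ring
            _ = ‖u x‖ₑ ^ p.toReal * ‖u x‖ₑ ^ (q.toReal - p.toReal) :=
                ENNReal.rpow_add_of_nonneg _ _ hp0.le (by linarith)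
            _ ≤ _ := by
                gcongr
                exact hM x
      _ ≤ _ := by
          rw [lintegral_mul_const' _ _ (ENNReal.rpow_ne_top_of_nonneg (by linarith) hM')]
          gcongr
  refine (ENNReal.rpow_le_rpow h2 (by positivity)).trans (le_of_eq ?_)
  rw [ENNReal.mul_rpow_of_nonneg _ _ (by positivity), ← ENNReal.rpow_mul, ← ENNReal.rpow_mul]
  congr 2
  · ring
  · field_simp

/-! ### Odd parts and Sobolev spaces -/

/-- The odd part of a function on the sphere. -/
def oddPart {d : ℕ} (f : Sph d → ℝ) (x : Sph d) : ℝ := (f x - f (-x)) / 2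

variable {d : ℕ} {χ : ℕ → ℕ → ℝ} {T : ℕ}

theorem oddPart_neg (f : Sph d → ℝ) (x : Sph d) : oddPart f (-x) = -oddPart f x := by
  simp only [oddPart, neg_neg]
  ring

theorem memLp_comp_neg {f : Sph d → ℝ} {p : ℝ≥0∞} (hf : MemLp f p (surf d)) :
    MemLp (fun x => f (-x)) p (surf d) :=
  hf.comp_measurePreserving (measurePreserving_neg_surf d)

theorem memLp_oddPart {f : Sph d → ℝ} {p : ℝ≥0∞} (hf : MemLp f p (surf d)) :
    MemLp (oddPart f) p (surf d) := by
  refine ((hf.sub (memLp_comp_neg hf)).const_mul (1 / 2)).ae_eq (Eventually.of_forall fun x => ?_)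
  simp only [oddPart, Pi.sub_apply]
  ring

theorem proj_oddPart {f : Sph d → ℝ} (hf : Integrable f (surf d)) (n : ℕ) (x : Sph d) :
    proj d n (oddPart f) x = (1 - (-1) ^ n) / 2 * proj d n f x := by
  have hc : Continuous fun y => projKernel d n x y :=
    (continuous_projKernel d n).comp (Continuous.prodMk_right x)
  have hint : ∀ {g : Sph d → ℝ}, Integrable g (surf d) →
      Integrable (fun y => projKernel d n x y * g y) (surf d) := fun hg =>
    hg.bdd_mul hc.aestronglyMeasurable
      (Eventually.of_forall (⟨_, hc⟩ : C(Sph d, ℝ)).norm_coe_le_norm)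
  have hneg : Integrable (fun y => f (-y)) (surf d) :=
    memLp_one_iff_integrable.1 (memLp_comp_neg (memLp_one_iff_integrable.2 hf))
  have h1 : ∫ y, projKernel d n x y * f (-y) ∂(surf d) = (-1) ^ n * proj d n f x := by
    rw [← integral_neg_surf fun y => projKernel d n x y * f (-y)]
    simp only [neg_neg, projKernel_neg_right, mul_assoc]
    rw [integral_const_mul, proj]
  have h2 : ∀ y, projKernel d n x y * oddPart f y =
      (projKernel d n x y * f y - projKernel d n x y * f (-y)) / 2 := fun y => by
    rw [oddPart]; ring
  simp_rw [proj, h2]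
  rw [integral_div, integral_sub (hint hf) (hint hneg), h1, proj]
  ring

/-- Taking odd parts multiplies each projection on `H^{n,d}` by `0` or `1`. -/
theorem MemSobolev.oddPart {p : ℝ≥0∞} {s : ℝ} (hp : 1 ≤ p) {f : Sph d → ℝ}
    (hf : MemSobolev d p s f) : MemSobolev d p s (oddPart f) := by
  obtain ⟨hf, g, hg, h⟩ := hf
  refine ⟨memLp_oddPart hf, BinaryChoice.oddPart g, memLp_oddPart hg, fun n x => ?_⟩
  rw [proj_oddPart (hf.integrable hp), proj_oddPart (hg.integrable hp), h]
  ring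

theorem MemSobolev.sobolevNorm_lt_top {p : ℝ≥0∞} {s : ℝ} {f : Sph d → ℝ}
    (hf : MemSobolev d p s f) : sobolevNorm d p s f < ∞ := by
  obtain ⟨hf, g, hg⟩ := hf
  exact ENNReal.add_lt_top.2 ⟨hf.eLpNorm_lt_top,
    (iInf₂_le g hg).trans_lt hg.1.eLpNorm_lt_top⟩

theorem smoothKernel_oddWeights_neg (χ : ℕ → ℕ → ℝ) (T : ℕ) (x y : Sph d) :
    smoothKernel d (oddWeights χ) T x (-y) = -smoothKernel d (oddWeights χ) T x y := by
  simp only [← oddKernel_eq_smoothKernel, oddKernel, neg_neg]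
  ring

theorem integrable_smoothKernel_mul {f : Sph d → ℝ} (hf : Integrable f (surf d))
    (χ : ℕ → ℕ → ℝ) (T : ℕ) (x : Sph d) :
    Integrable (fun y => smoothKernel d χ T x y * f y) (surf d) :=
  hf.bdd_mul (continuous_smoothKernel_right χ T x).aestronglyMeasurable
    (Eventually.of_forall (⟨_, continuous_smoothKernel_right χ T x⟩ : C(Sph d, ℝ)).norm_coe_le_norm)

/-- On odd functions a smoothed projection kernel acts through its odd part. -/
theorem integral_smoothKernel_mul_oddPart {f : Sph d → ℝ} (hf : Integrable f (surf d))
    (χ : ℕ → ℕ → ℝ) (T : ℕ) (x : Sph d) :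
    ∫ y, smoothKernel d χ T x y * oddPart f y ∂(surf d) =
      ∫ y, smoothKernel d (oddWeights χ) T x y * oddPart f y ∂(surf d) := by
  have hφ : Integrable (oddPart f) (surf d) :=
    memLp_one_iff_integrable.1 (memLp_oddPart (memLp_one_iff_integrable.2 hf))
  have h1 := integrable_smoothKernel_mul hφ χ T x
  have h2 : Integrable (fun y => smoothKernel d χ T x (-y) * oddPart f y) (surf d) := by
    have := memLp_one_iff_integrable.1 (memLp_comp_neg (memLp_one_iff_integrable.2 h1)) |>.neg
    refine this.congr (Eventually.of_forall fun y => ?_)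
    simp [oddPart_neg]
  have h3 : ∫ y, smoothKernel d χ T x (-y) * oddPart f y ∂(surf d) =
      -∫ y, smoothKernel d χ T x y * oddPart f y ∂(surf d) := by
    rw [← integral_neg_surf, ← integral_neg]
    simp [oddPart_neg]
  have h4 : ∀ y, smoothKernel d (oddWeights χ) T x y * oddPart f y =
      (smoothKernel d χ T x y * oddPart f y - smoothKernel d χ T x (-y) * oddPart f y) / 2 :=
    fun y => by
      rw [← oddKernel_eq_smoothKernel, oddKernel]; ring
  simp_rw [h4]
  rw [integral_div, integral_sub h1 h2, h3]
  ring

/-! ### The extended choice probability -/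

theorem ae_ne_equator (d : ℕ) [NeZero d] :
    ∀ᵐ x : Sph d ∂(surf d), (x : EuclideanSpace ℝ (Fin d)) 0 ≠ 0 := by
  rw [ae_iff]
  simpa using surf_equator d

theorem mem_northHemi_neg_iff [NeZero d] {x : Sph d} (hx : (x : EuclideanSpace ℝ (Fin d)) 0 ≠ 0) :
    -x ∈ northHemi d ↔ x ∉ northHemi d := by
  simp only [northHemi, Set.mem_ofPred_eq]
  have : ((-x : Sph d) : EuclideanSpace ℝ (Fin d)) 0 = -(x : EuclideanSpace ℝ (Fin d)) 0 := by simp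
  rw [this]
  constructor
  · intro h h'
    exact hx (by linarith)
  · intro h
    linarith [not_le.1 h]

theorem two_mul_oddPart_extendedChoice [NeZero d] (r : Sph d → ℝ) {x : Sph d}
    (hx : (x : EuclideanSpace ℝ (Fin d)) 0 ≠ 0) (hxH : x ∈ northHemi d) :
    2 * oddPart (extendedChoice d r) x = 2 * r x - 1 := by
  have h := (mem_northHemi_neg_iff hx).not.2 (not_not.2 hxH)
  rw [oddPart, extendedChoice, extendedChoice, if_pos hxH, if_neg h, neg_neg]
  ring

theorem extendedChoice_ae_eq [NeZero d] (r : Sph d → ℝ) :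
    ∀ᵐ x ∂(surf d), extendedChoice d r x = 1 / 2 + oddPart (extendedChoice d r) x := by
  filter_upwards [ae_ne_equator d] with x hx
  have h := mem_northHemi_neg_iff hx
  by_cases hxH : x ∈ northHemi d
  · rw [oddPart, extendedChoice, extendedChoice, if_pos hxH, if_neg (h.not.2 (not_not.2 hxH)),
      neg_neg]
    ring
  · rw [oddPart, extendedChoice, extendedChoice, if_neg hxH, if_pos (h.2 hxH)]
    ring

theorem measurableSet_northHemi (d : ℕ) [NeZero d] : MeasurableSet (northHemi d) :=
  (isClosed_le continuous_const (by fun_prop)).measurableSet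

/-- The odd kernel applied to the odd part of the choice probability only involves `r` on the
support of the density. -/
theorem integral_oddKernel_mul_oddPart_eq [NeZero d] {fX r : Sph d → ℝ}
    (hsupp : SupportAssumption d fX)
    (hR : Integrable (extendedChoice d r) (surf d)) (χ : ℕ → ℕ → ℝ) (T : ℕ) (x : Sph d) :
    ∫ y, smoothKernel d (oddWeights χ) T x y * oddPart (extendedChoice d r) y ∂(surf d) =
      ∫ y, {y | 0 < fX y}.indicator
        (fun y => smoothKernel d (oddWeights χ) T x y * (2 * r y - 1)) y ∂(surf d) := by
  have hφ : Integrable (oddPart (extendedChoice d r)) (surf d) :=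
    memLp_one_iff_integrable.1 (memLp_oddPart (memLp_one_iff_integrable.2 hR))
  set u : Sph d → ℝ := fun y =>
    smoothKernel d (oddWeights χ) T x y * oddPart (extendedChoice d r) y with hu_def
  have hu : Integrable u (surf d) := integrable_smoothKernel_mul hφ _ T x
  have hu_neg : ∀ y, u (-y) = u y := fun y => by
    simp [hu_def, smoothKernel_oddWeights_neg, oddPart_neg]
  have hi : Integrable ((northHemi d).indicator u) (surf d) :=
    hu.indicator (measurableSet_northHemi d)
  have hi' : Integrable (fun y => (northHemi d).indicator u (-y)) (surf d) :=
    memLp_one_iff_integrable.1 (memLp_comp_neg (memLp_one_iff_integrable.2 hi))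
  calc ∫ y, u y ∂(surf d)
      = ∫ y, ((northHemi d).indicator u y + (northHemi d).indicator u (-y)) ∂(surf d) := by
        refine integral_congr_ae ?_
        filter_upwards [ae_ne_equator d] with y hy
        have h := mem_northHemi_neg_iff hy
        by_cases hyH : y ∈ northHemi d
        · simp [hyH, h]
        · simp [hyH, h, hu_neg]
    _ = ∫ y, 2 * (northHemi d).indicator u y ∂(surf d) := by
        rw [integral_add hi hi', integral_neg_surf, integral_const_mul, two_mul]
    _ = _ := by
        refine integral_congr_ae ?_
        filter_upwards [ae_ne_equator d, hsupp] with y hy hyH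
        by_cases h : y ∈ northHemi d
        · have h' : y ∈ {y | 0 < fX y} := hyH.2 h
          simp only [Set.indicator_of_mem h, Set.indicator_of_mem h']
          rw [← two_mul_oddPart_extendedChoice r hy h, hu_def]
          ring
        · have h' : y ∉ {y | 0 < fX y} := fun h' => h (hyH.1 h')
          simp only [Set.indicator_of_notMem h, Set.indicator_of_notMem h', mul_zero]

/-! ### The trimming bias -/

/-- The part of the expectation of the estimator (with known `f_X`, trimmed at `a`) that depends
on the sample. -/
def trimmedMean (d : ℕ) (χ : ℕ → ℕ → ℝ) (T : ℕ) (a : ℝ) (fX r : Sph d → ℝ) (x : Sph d) : ℝ :=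
  ∫ y, fX y * ((2 * r y - 1) * smoothKernel d (oddWeights χ) T y x / max (fX y) a) ∂(surf d)

theorem integrable_trimmed_mul {fX r : Sph d → ℝ} (hfm : Measurable fX) (hf0 : ∀ x, 0 ≤ fX x)
    (hrm : Measurable r) (hr : ∀ᵐ y ∂(surf d), 0 < fX y → |2 * r y - 1| ≤ 1) (a : ℝ) :
    Integrable (fun y => fX y * (2 * r y - 1) / max (fX y) a) (surf d) := by
  refine Integrable.of_bound (C := 1) ?_ ?_
  · exact ((hfm.mul ((hrm.const_mul 2).sub_const 1)).div
      (hfm.max measurable_const)).aestronglyMeasurable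
  · filter_upwards [hr] with y hy
    rcases (hf0 y).eq_or_lt with h | h
    · simp [← h]
    · rw [Real.norm_eq_abs, abs_div, abs_mul, abs_of_pos h,
        abs_of_pos (h.trans_le (le_max_left _ _)), div_le_one (h.trans_le (le_max_left _ _))]
      calc fX y * |2 * r y - 1| ≤ fX y * 1 := by gcongr; exact hy h
        _ ≤ _ := by rw [mul_one]; exact le_max_left _ _

theorem exists_polySpace_eq_trimmedMean {fX r : Sph d → ℝ} (hfm : Measurable fX)
    (hf0 : ∀ x, 0 ≤ fX x) (hrm : Measurable r)
    (hr : ∀ᵐ y ∂(surf d), 0 < fX y → |2 * r y - 1| ≤ 1) (χ : ℕ → ℕ → ℝ) (T : ℕ) (a : ℝ) :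
    ∃ g ∈ polySpace d T, ∀ x, g x = trimmedMean d χ T a fX r x := by
  obtain ⟨g, hg, h⟩ := exists_polySpace_eq_integral_smoothKernel (oddWeights χ) T (surf d)
    (integrable_trimmed_mul hfm hf0 hrm hr a)
  refine ⟨g, hg, fun x => ?_⟩
  rw [h, trimmedMean]
  refine integral_congr_ae (Eventually.of_forall fun y => ?_)
  simp only
  ring

/-- The trimming bias is dominated by the integral of the kernel over the trimmed region. -/
theorem abs_trimmedMean_sub_le [NeZero d] {fX r : Sph d → ℝ} (hfm : Measurable fX)
    (hf0 : ∀ x, 0 ≤ fX x)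
    (hsupp : SupportAssumption d fX) (hrm : Measurable r)
    (hr : ∀ᵐ y ∂(surf d), 0 < fX y → |2 * r y - 1| ≤ 1)
    (hR : Integrable (extendedChoice d r) (surf d)) (χ : ℕ → ℕ → ℝ) (T : ℕ) {a : ℝ} (ha : 0 < a)
    (x : Sph d) :
    |trimmedMean d χ T a fX r x -
        ∫ y, smoothKernel d χ T x y * oddPart (extendedChoice d r) y ∂(surf d)| ≤
      ∫ y in {y | 0 < fX y ∧ fX y < a}, |smoothKernel d (oddWeights χ) T x y| ∂(surf d) := by
  have hpos : MeasurableSet {y | 0 < fX y} := measurableSet_lt measurable_const hfm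
  have hE : MeasurableSet {y | 0 < fX y ∧ fX y < a} :=
    hpos.inter (measurableSet_lt hfm measurable_const)
  have hc := continuous_smoothKernel_right (d := d) (oddWeights χ) T x
  have hκ : Integrable (fun y => smoothKernel d (oddWeights χ) T x y) (surf d) :=
    integrable_of_continuous hc
  have hi2 : Integrable ({y | 0 < fX y}.indicator
      (fun y => smoothKernel d (oddWeights χ) T x y * (2 * r y - 1))) (surf d) := by
    refine hκ.norm.mono' (Measurable.aestronglyMeasurable
      ((hc.measurable.mul ((hrm.const_mul 2).sub_const 1)).indicator hpos)) ?_
    filter_upwards [hr] with y hy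
    by_cases h : 0 < fX y
    · rw [Set.indicator_of_mem (show y ∈ {y | 0 < fX y} from h), norm_mul]
      exact mul_le_of_le_one_right (norm_nonneg _) (hy h)
    · rw [Set.indicator_of_notMem (show y ∉ {y | 0 < fX y} from h), norm_zero]
      exact norm_nonneg _
  have hi1 : Integrable (fun y => fX y * ((2 * r y - 1) *
      smoothKernel d (oddWeights χ) T y x / max (fX y) a)) (surf d) := by
    refine (integrable_smoothKernel_mul (integrable_trimmed_mul hfm hf0 hrm hr a)
      (oddWeights χ) T x).congr (Eventually.of_forall fun y => ?_)
    simp only [smoothKernel_comm _ _ y x]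
    ring
  rw [integral_smoothKernel_mul_oddPart hR, integral_oddKernel_mul_oddPart_eq hsupp hR,
    trimmedMean, ← integral_sub hi1 hi2, ← integral_indicator hE, ← Real.norm_eq_abs]
  refine norm_integral_le_of_norm_le (hκ.abs.indicator hE) ?_
  filter_upwards [hr] with y hy
  rw [smoothKernel_comm _ _ y x]
  by_cases h : 0 < fX y
  · rw [Set.indicator_of_mem (show y ∈ {y | 0 < fX y} from h)]
    by_cases h' : fX y < a
    · rw [Set.indicator_of_mem (show y ∈ {y | 0 < fX y ∧ fX y < a} from ⟨h, h'⟩),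
        max_eq_right h'.le]
      have h1 : fX y * ((2 * r y - 1) * smoothKernel d (oddWeights χ) T x y / a) -
          smoothKernel d (oddWeights χ) T x y * (2 * r y - 1) =
          smoothKernel d (oddWeights χ) T x y * ((2 * r y - 1) * (fX y / a - 1)) := by
        field_simp
      rw [h1, norm_mul]
      refine mul_le_of_le_one_right (norm_nonneg _) ?_
      rw [norm_mul]
      refine mul_le_one₀ (hy h) (norm_nonneg _) ?_
      have h2 : fX y / a ≤ 1 := (div_le_one ha).2 h'.le
      have h3 : 0 ≤ fX y / a := by positivity
      rw [Real.norm_eq_abs, abs_le]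
      constructor <;> linarith
    · rw [Set.indicator_of_notMem (fun h2 => h' h2.2), max_eq_left (not_lt.1 h')]
      have h1 : fX y * ((2 * r y - 1) * smoothKernel d (oddWeights χ) T x y / fX y) -
          smoothKernel d (oddWeights χ) T x y * (2 * r y - 1) = 0 := by
        field_simp
        ring
      rw [h1, norm_zero]
  · have h0 : fX y = 0 := le_antisymm (not_lt.1 h) (hf0 y)
    rw [Set.indicator_of_notMem (show y ∉ {y | 0 < fX y} from h),
      Set.indicator_of_notMem (fun h2 => h h2.1)]
    simp [h0]

/-- Interpolation between `L¹`, where the kernel is bounded, and `L^∞`. -/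
theorem eLpNorm_trimming_bias_le [NeZero d] {fX r : Sph d → ℝ} (hfm : Measurable fX)
    (hf0 : ∀ x, 0 ≤ fX x)
    (hsupp : SupportAssumption d fX) (hrm : Measurable r)
    (hr : ∀ᵐ y ∂(surf d), 0 < fX y → |2 * r y - 1| ≤ 1)
    (hR : Integrable (extendedChoice d r) (surf d)) {χ : ℕ → ℕ → ℝ} {T : ℕ} {B : ℝ}
    (hB : ∀ x : Sph d, ∫ y, |smoothKernel d χ T x y| ∂(surf d) ≤ B) {a : ℝ} (ha : 0 < a)
    {q : ℝ≥0∞} (hq : 1 ≤ q) :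
    eLpNorm (fun x => trimmedMean d χ T a fX r x -
        ∫ y, smoothKernel d χ T x y * oddPart (extendedChoice d r) y ∂(surf d)) q (surf d) ≤
      ENNReal.ofReal ((surf d).real {y | 0 < fX y ∧ fX y < a} * B *
        nikolskii d T ^ (1 - (q⁻¹).toReal)) := by
  set E := {y | 0 < fX y ∧ fX y < a}
  set m := (surf d).real E with hm
  have hm0 : 0 ≤ m := measureReal_nonneg
  have hBodd := integral_abs_oddKernel_le hB
  have hnik := nikolskii_pos d T
  obtain ⟨x₀⟩ : Nonempty (Sph d) := by
    by_contra h
    rw [not_nonempty_iff] at h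
    have := surf_real_univ_pos d
    simp [Set.univ_eq_empty_iff.2 h] at this
  have hB0 : 0 ≤ B := (integral_nonneg fun y => abs_nonneg _).trans (hB x₀)
  set h : Sph d → ℝ := fun x => ∫ y in E, |smoothKernel d (oddWeights χ) T x y| ∂(surf d)
  have h0 : ∀ x, 0 ≤ h x := fun x => integral_nonneg fun y => abs_nonneg _
  have hprod : Integrable (fun z : Sph d × Sph d => |smoothKernel d (oddWeights χ) T z.1 z.2|)
      ((surf d).prod ((surf d).restrict E)) :=
    (continuous_smoothKernel d (oddWeights χ) T).abs.integrable_of_hasCompactSupport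
      (HasCompactSupport.of_compactSpace _)
  have hint : ∫ x, h x ∂(surf d) ≤ m * B := by
    simp only [h]
    rw [integral_integral_swap hprod]
    calc _ ≤ ∫ _y in E, B ∂(surf d) := by
          refine integral_mono hprod.integral_prod_right (integrable_const _) fun y => ?_
          simp only [fun x => smoothKernel_comm (oddWeights χ) T x y]
          exact hBodd y
      _ = m * B := by simp [hm]
  have hsup : ∀ x, h x ≤ nikolskii d T * B * m := by
    intro x
    calc _ ≤ ∫ _y in E, nikolskii d T * B ∂(surf d) := by
          refine integral_mono (integrable_of_continuous
            (continuous_smoothKernel_right _ T x).abs).integrableOn (integrable_const _)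
            fun y => abs_smoothKernel_le hBodd x y
      _ = _ := by simp [hm, mul_comm]
  have hL1 : eLpNorm h 1 (surf d) ≤ ENNReal.ofReal (m * B) := by
    rw [eLpNorm_one_eq_lintegral_enorm]
    simp_rw [fun x => Real.enorm_of_nonneg (h0 x)]
    rw [← ofReal_integral_eq_lintegral_ofReal hprod.integral_prod_left (Eventually.of_forall h0)]
    exact ENNReal.ofReal_le_ofReal hint
  have hq1 : (q⁻¹).toReal ≤ 1 := by
    have := ENNReal.toReal_mono ENNReal.one_ne_top (ENNReal.inv_le_one.2 hq)
    simpa using this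
  refine (eLpNorm_mono_real fun x => (Real.norm_eq_abs _).trans_le
    (abs_trimmedMean_sub_le hfm hf0 hsupp hrm hr hR χ T ha x)).trans ?_
  refine (eLpNorm_le_rpow_mul_rpow one_ne_zero ENNReal.one_ne_top hq hL1
    (M := ENNReal.ofReal (nikolskii d T * B * m)) (fun x => ?_) ENNReal.ofReal_ne_top).trans
    (le_of_eq ?_)
  · rw [Real.enorm_of_nonneg (h0 x)]
    exact ENNReal.ofReal_le_ofReal (hsup x)
  · have hq0 : 0 ≤ (q⁻¹).toReal := ENNReal.toReal_nonneg
    rw [ENNReal.toReal_one, one_mul, ENNReal.ofReal_rpow_of_nonneg (by positivity) hq0,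
      ENNReal.ofReal_rpow_of_nonneg (by positivity) (by linarith),
      ← ENNReal.ofReal_mul (by positivity)]
    congr 1
    rw [mul_assoc (nikolskii d T), mul_comm B m,
      Real.mul_rpow (x := nikolskii d T) hnik.le (by positivity)]
    have : (m * B) ^ (q⁻¹).toReal * (m * B) ^ (1 - (q⁻¹).toReal) = m * B := by
      rw [← Real.rpow_add_of_nonneg (by positivity) hq0 (by linarith)]
      simp
    linear_combination (nikolskii d T ^ (1 - (q⁻¹).toReal)) * this

/-! ### The sample means entering the estimator -/

/-- The sample mean of the absolute values of the kernel. -/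
def kernelMean {Ω : Type*} (d : ℕ) (χ : ℕ → ℕ → ℝ) (T : ℕ) (X : ℕ → Ω → Sph d) (N : ℕ) (ω : Ω)
    (x : Sph d) : ℝ :=
  (N : ℝ)⁻¹ * ∑ i ∈ Finset.range N, |smoothKernel d (oddWeights χ) T (X i ω) x|

/-- The odd part of the estimator when `f_X` is known. -/
def oracleMean {Ω : Type*} (d : ℕ) (χ : ℕ → ℕ → ℝ) (T : ℕ) (a : ℝ) (X : ℕ → Ω → Sph d)
    (Y : ℕ → Ω → ℝ) (fX : Sph d → ℝ) (N : ℕ) (ω : Ω) (x : Sph d) : ℝ :=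
  (N : ℝ)⁻¹ * ∑ i ∈ Finset.range N,
    (2 * Y i ω - 1) * smoothKernel d (oddWeights χ) T (X i ω) x / max (fX (X i ω)) a

section SampleMeans

variable {Ω : Type*} {d : ℕ} {X : ℕ → Ω → Sph d} {Y : ℕ → Ω → ℝ} {fX : Sph d → ℝ}
  {χ : ℕ → ℕ → ℝ} {T : ℕ} {a : ℝ} {N : ℕ}

theorem continuous_kernelMean (ω : Ω) : Continuous (kernelMean d χ T X N ω) :=
  continuous_const.mul (continuous_finsetSum _ fun i _ =>
    (continuous_smoothKernel_right _ T (X i ω)).abs)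

theorem isPolyEnvelope_kernelMean (ω : Ω) : IsPolyEnvelope d T (kernelMean d χ T X N ω) := by
  choose f hf hfx using fun i => exists_polySpace_eq_smoothKernel (oddWeights χ) T (X i ω)
  have := isPolyEnvelope_sum_abs (Finset.range N) (fun i _ => hf i)
    (c := (N : ℝ)⁻¹) (by positivity)
  simp only [hfx] at this
  exact this

theorem exists_polySpace_eq_oracleMean (ω : Ω) :
    ∃ g ∈ polySpace d T, ∀ x, g x = oracleMean d χ T a X Y fX N ω x := by
  choose f hf hfx using fun i => exists_polySpace_eq_smoothKernel (oddWeights χ) T (X i ω)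
  refine ⟨(N : ℝ)⁻¹ • ∑ i ∈ Finset.range N,
    ((2 * Y i ω - 1) / max (fX (X i ω)) a) • f i, ?_, fun x => ?_⟩
  · exact Submodule.smul_mem _ _ (Submodule.sum_mem _ fun i _ => Submodule.smul_mem _ _ (hf i))
  · simp only [ContinuousMap.smul_apply, ContinuousMap.sum_apply, smul_eq_mul, hfx, oracleMean]
    congr 1
    exact Finset.sum_congr rfl fun i _ => by ring

end SampleMeans

/-! ### The binary choice model -/

section Model

variable {Ω : Type*} [MeasurableSpace Ω] {P : Measure Ω} {d : ℕ}
  {X β : ℕ → Ω → Sph d} {Y : ℕ → Ω → ℝ} {fX r : Sph d → ℝ}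

open Classical in
/-- The outcome `𝟙{x'b ≥ 0}` as a function of the regressor and the coefficient. -/
def choiceFun {d : ℕ} (z : Sph d × Sph d) : ℝ :=
  if 0 ≤ inner ℝ (z.1 : EuclideanSpace ℝ (Fin d)) (z.2 : EuclideanSpace ℝ (Fin d)) then 1 else 0

theorem measurable_choiceFun : Measurable (choiceFun (d := d)) := by
  refine Measurable.ite ?_ measurable_const measurable_const
  have hc : Continuous fun z : Sph d × Sph d =>
      inner ℝ (z.1 : EuclideanSpace ℝ (Fin d)) (z.2 : EuclideanSpace ℝ (Fin d)) := by fun_prop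
  exact (isClosed_le continuous_const hc).measurableSet

namespace IsModelSample

theorem eq_choiceFun (hmodel : IsModelSample P d X β Y fX) (i : ℕ) (ω : Ω) :
    Y i ω = choiceFun (X i ω, β i ω) := by
  rw [hmodel.choice, choiceFun]

theorem eq_zero_or_one (hmodel : IsModelSample P d X β Y fX) (i : ℕ) (ω : Ω) :
    Y i ω = 0 ∨ Y i ω = 1 := by
  rw [hmodel.choice]
  split_ifs <;> simp

theorem abs_two_mul_sub_one (hmodel : IsModelSample P d X β Y fX) (i : ℕ) (ω : Ω) :
    |2 * Y i ω - 1| = 1 := by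
  rcases hmodel.eq_zero_or_one i ω with h | h <;> rw [h] <;> norm_num

theorem measurable_pair (hmodel : IsModelSample P d X β Y fX) (i : ℕ) :
    Measurable fun ω => (X i ω, β i ω) :=
  (hmodel.measurable_X i).prodMk (hmodel.measurable_β i)

theorem measurable_Y (hmodel : IsModelSample P d X β Y fX) (i : ℕ) : Measurable (Y i) := by
  have : Y i = fun ω => choiceFun (X i ω, β i ω) := funext (hmodel.eq_choiceFun i)
  rw [this]
  exact measurable_choiceFun.comp (hmodel.measurable_pair i)

theorem integral_comp_X (hmodel : IsModelSample P d X β Y fX) (i : ℕ) {g : Sph d → ℝ}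
    (hg : Measurable g) : ∫ ω, g (X i ω) ∂P = ∫ y, fX y * g y ∂(surf d) := by
  rw [← integral_map (hmodel.measurable_X i).aemeasurable hg.aestronglyMeasurable,
    hmodel.law_X i, integral_withDensity_eq_integral_toReal_smul
      hmodel.measurable_fX.ennreal_ofReal (Eventually.of_forall fun _ => ENNReal.ofReal_lt_top)]
  refine integral_congr_ae (Eventually.of_forall fun y => ?_)
  simp only [ENNReal.toReal_ofReal (hmodel.nonneg_fX y), smul_eq_mul]

theorem integral_comp_X_le (hmodel : IsModelSample P d X β Y fX) (i : ℕ) {g : Sph d → ℝ}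
    (hg : Continuous g) (hg0 : ∀ y, 0 ≤ g y) {F : ℝ} (hF : ∀ᵐ y ∂(surf d), fX y ≤ F) :
    ∫ ω, g (X i ω) ∂P ≤ F * ∫ y, g y ∂(surf d) := by
  rw [hmodel.integral_comp_X i hg.measurable, ← integral_const_mul]
  refine integral_mono_of_nonneg
    (Eventually.of_forall fun y => mul_nonneg (hmodel.nonneg_fX y) (hg0 y))
    ((integrable_of_continuous hg).const_mul _) ?_
  filter_upwards [hF] with y hy
  exact mul_le_mul_of_nonneg_right hy (hg0 y)

theorem ae_of_ae_X (hmodel : IsModelSample P d X β Y fX) (i : ℕ) {p : Sph d → Prop}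
    (hp : MeasurableSet {x | p x}) (h : ∀ᵐ ω ∂P, p (X i ω)) :
    ∀ᵐ x ∂(surf d), 0 < fX x → p x := by
  have h1 := (ae_map_iff (hmodel.measurable_X i).aemeasurable hp).2 h
  rw [hmodel.law_X i, ae_withDensity_iff hmodel.measurable_fX.ennreal_ofReal] at h1
  filter_upwards [h1] with x hx hpos
  exact hx (by simpa using hpos)

theorem measurable_smoothKernel (hmodel : IsModelSample P d X β Y fX) (χ : ℕ → ℕ → ℝ) (T i : ℕ) :
    Measurable fun z : Ω × Sph d => smoothKernel d χ T (X i z.1) z.2 := by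
  have h1 : Measurable fun z : Ω × Sph d => (X i z.1, z.2) :=
    ((hmodel.measurable_X i).comp measurable_fst).prodMk measurable_snd
  have h2 := (continuous_smoothKernel d χ T).measurable.comp h1
  exact h2

end IsModelSample

theorem condExp_Y (hmodel : IsModelSample P d X β Y fX) (hr : IsChoiceProbability P d X Y r)
    (i : ℕ) : P[Y i | MeasurableSpace.comap (X i) inferInstance] =ᵐ[P] fun ω => r (X i ω) := by
  have h : {ω | Y i ω = 1}.indicator (fun _ => (1 : ℝ)) = Y i := by
    ext ω
    rcases hmodel.eq_zero_or_one i ω with h | h <;> simp [h]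
  have := hr.2 i
  rwa [h] at this

variable {χ : ℕ → ℕ → ℝ} {T : ℕ} {a B F : ℝ} {N k : ℕ}

theorem measurable_kernelMean (hmodel : IsModelSample P d X β Y fX) :
    Measurable fun z : Ω × Sph d => kernelMean d χ T X N z.1 z.2 :=
  (Finset.measurable_sum _ fun i _ => (hmodel.measurable_smoothKernel _ T i).abs).const_mul _

theorem measurable_oracleMean (hmodel : IsModelSample P d X β Y fX) :
    Measurable fun z : Ω × Sph d => oracleMean d χ T a X Y fX N z.1 z.2 := by
  refine (Finset.measurable_sum _ fun i _ => ?_).const_mul _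
  exact (((((hmodel.measurable_Y i).comp measurable_fst).const_mul 2).sub_const 1).mul
    (hmodel.measurable_smoothKernel _ T i)).div
    ((hmodel.measurable_fX.comp ((hmodel.measurable_X i).comp measurable_fst)).max
      measurable_const)

variable [IsProbabilityMeasure P]

theorem IsModelSample.integrable_Y (hmodel : IsModelSample P d X β Y fX) (i : ℕ) :
    Integrable (Y i) P :=
  integrable_of_abs_le (hmodel.measurable_Y i) (b := 1) fun ω => by
    rcases hmodel.eq_zero_or_one i ω with h | h <;> rw [h] <;> norm_num

theorem choiceProbability_mem_Icc (hmodel : IsModelSample P d X β Y fX)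
    (hr : IsChoiceProbability P d X Y r) (i : ℕ) : ∀ᵐ ω ∂P, r (X i ω) ∈ Set.Icc (0 : ℝ) 1 := by
  have hm : MeasurableSpace.comap (X i) inferInstance ≤ ‹MeasurableSpace Ω› :=
    (hmodel.measurable_X i).comap_le
  have h0 : 0 ≤ᵐ[P] P[Y i | MeasurableSpace.comap (X i) inferInstance] :=
    condExp_nonneg (Eventually.of_forall fun ω => by
      rcases hmodel.eq_zero_or_one i ω with h | h <;> simp [h])
  have h1 : P[Y i | MeasurableSpace.comap (X i) inferInstance] ≤ᵐ[P]
      P[fun _ => (1 : ℝ) | MeasurableSpace.comap (X i) inferInstance] :=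
    condExp_mono (hmodel.integrable_Y i) (integrable_const _) (Eventually.of_forall fun ω => by
      rcases hmodel.eq_zero_or_one i ω with h | h <;> simp [h])
  rw [condExp_const hm] at h1
  filter_upwards [h0, h1, condExp_Y hmodel hr i] with ω h0 h1 h
  rw [← h]
  exact ⟨h0, h1⟩

theorem abs_two_mul_choiceProbability_sub_one_le (hmodel : IsModelSample P d X β Y fX)
    (hr : IsChoiceProbability P d X Y r) :
    ∀ᵐ y ∂(surf d), 0 < fX y → |2 * r y - 1| ≤ 1 := by
  refine hmodel.ae_of_ae_X 0
    (measurableSet_le ((hr.1.const_mul 2).sub_const 1).abs measurable_const) ?_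
  filter_upwards [choiceProbability_mem_Icc hmodel hr 0] with ω h
  rw [abs_le]
  constructor <;> linarith [h.1, h.2]

theorem integral_choice_mul (hmodel : IsModelSample P d X β Y fX)
    (hr : IsChoiceProbability P d X Y r) (i : ℕ) {k : Sph d → ℝ} (hk : Measurable k) {b : ℝ}
    (hb : ∀ x, |k x| ≤ b) :
    ∫ ω, (2 * Y i ω - 1) * k (X i ω) ∂P = ∫ y, fX y * ((2 * r y - 1) * k y) ∂(surf d) := by
  rw [← hmodel.integral_comp_X i (g := fun y => (2 * r y - 1) * k y)
    (((hr.1.const_mul 2).sub_const 1).mul hk)]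
  have hm : MeasurableSpace.comap (X i) inferInstance ≤ ‹MeasurableSpace Ω› :=
    (hmodel.measurable_X i).comap_le
  have hkX : Measurable fun ω => k (X i ω) := hk.comp (hmodel.measurable_X i)
  have hkm : StronglyMeasurable[MeasurableSpace.comap (X i) inferInstance] fun ω => k (X i ω) :=
    (hk.comp (comap_measurable (X i))).stronglyMeasurable
  have hki : Integrable (fun ω => k (X i ω)) P := integrable_of_abs_le hkX fun ω => hb _
  have hYk : Integrable (fun ω => Y i ω * k (X i ω)) P :=
    (hmodel.integrable_Y i).mul_bdd hkX.aestronglyMeasurable (Eventually.of_forall fun ω => hb _)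
  have h1 := condExp_mul_of_stronglyMeasurable_right (f := Y i) hkm hYk (hmodel.integrable_Y i)
  have h2 : ∫ ω, Y i ω * k (X i ω) ∂P = ∫ ω, r (X i ω) * k (X i ω) ∂P := by
    calc ∫ ω, Y i ω * k (X i ω) ∂P
        = ∫ ω, P[Y i * fun ω => k (X i ω) | MeasurableSpace.comap (X i) inferInstance] ω ∂P :=
          (integral_condExp hm).symm
      _ = _ := by
          refine integral_congr_ae ?_
          filter_upwards [h1, condExp_Y hmodel hr i] with ω h1 h
          rw [h1, Pi.mul_apply, h]
  have hrk : Integrable (fun ω => r (X i ω) * k (X i ω)) P := by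
    refine hki.norm.mono' ((hr.1.comp (hmodel.measurable_X i)).mul hkX).aestronglyMeasurable ?_
    filter_upwards [choiceProbability_mem_Icc hmodel hr i] with ω h
    rw [norm_mul]
    refine mul_le_of_le_one_left (norm_nonneg _) ?_
    rw [Real.norm_eq_abs, abs_le]
    constructor <;> linarith [h.1, h.2]
  have e1 : ∀ ω, (2 * Y i ω - 1) * k (X i ω) = 2 * (Y i ω * k (X i ω)) - k (X i ω) :=
    fun ω => by ring
  have e2 : ∀ ω, (2 * r (X i ω) - 1) * k (X i ω) = 2 * (r (X i ω) * k (X i ω)) - k (X i ω) :=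
    fun ω => by ring
  simp_rw [e1, e2]
  rw [integral_sub (hYk.const_mul 2) hki, integral_sub (hrk.const_mul 2) hki,
    integral_const_mul, integral_const_mul]
  congr 2

theorem exists_polySpace_eq_centred (hmodel : IsModelSample P d X β Y fX)
    (hr : IsChoiceProbability P d X Y r) (ω : Ω) :
    ∃ g ∈ polySpace d T,
      ∀ x, g x = oracleMean d χ T a X Y fX N ω x - trimmedMean d χ T a fX r x := by
  obtain ⟨g, hg, h⟩ := exists_polySpace_eq_oracleMean (d := d) (χ := χ) (T := T) (a := a) (X := X)
    (Y := Y) (fX := fX) (N := N) ω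
  obtain ⟨g', hg', h'⟩ := exists_polySpace_eq_trimmedMean hmodel.measurable_fX hmodel.nonneg_fX
    hr.1 (abs_two_mul_choiceProbability_sub_one_le hmodel hr) χ T a
  exact ⟨g - g', Submodule.sub_mem _ hg hg', fun x => by simp [h, h']⟩

theorem continuous_centred (hmodel : IsModelSample P d X β Y fX)
    (hr : IsChoiceProbability P d X Y r) (ω : Ω) :
    Continuous fun x => oracleMean d χ T a X Y fX N ω x - trimmedMean d χ T a fX r x := by
  obtain ⟨g, -, h⟩ := exists_polySpace_eq_centred (χ := χ) (T := T) (a := a) (N := N) hmodel hr ω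
  simp_rw [← h]
  exact g.continuous

theorem measurable_centred (hmodel : IsModelSample P d X β Y fX)
    (hr : IsChoiceProbability P d X Y r) :
    Measurable fun z : Ω × Sph d =>
      oracleMean d χ T a X Y fX N z.1 z.2 - trimmedMean d χ T a fX r z.2 := by
  obtain ⟨g, -, h⟩ := exists_polySpace_eq_trimmedMean hmodel.measurable_fX hmodel.nonneg_fX
    hr.1 (abs_two_mul_choiceProbability_sub_one_le hmodel hr) χ T a
  refine (measurable_oracleMean hmodel).sub ?_
  simp_rw [← h]
  exact g.continuous.measurable.comp measurable_snd

variable [NeZero d]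

theorem measure_kernelMean_gt_le (hmodel : IsModelSample P d X β Y fX)
    (hF : ∀ᵐ y ∂(surf d), fX y ≤ F) (hF0 : 0 ≤ F)
    (hB : ∀ x : Sph d, ∫ y, |smoothKernel d χ T x y| ∂(surf d) ≤ B)
    (hN : 1 ≤ N) (hk : 1 ≤ k) (hkN : Real.log N ≤ k) (hD : k * T + 1 ≤ N ^ 2)
    (hc : k * (nikolskii d T * B) ≤ N) :
    P {ω | ∃ x, Real.exp d * (2 * Real.exp (F * B)) < kernelMean d χ T X N ω x} ≤
      ENNReal.ofReal (4 / (N : ℝ) ^ 2) := by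
  have hBodd := integral_abs_oddKernel_le hB
  refine measure_exists_lt_le_of_log_le (measurable_kernelMean hmodel) continuous_kernelMean
    (fun ω x => mul_nonneg (by positivity) (Finset.sum_nonneg fun i _ => abs_nonneg _))
    isPolyEnvelope_kernelMean (by positivity) (fun x => ?_) hN hkN hD
  let w : Sph d × Sph d → ℝ := fun z => |smoothKernel d (oddWeights χ) T z.1 x|
  have hw : Measurable w :=
    ((continuous_smoothKernel_left _ T x).comp continuous_fst).abs.measurable
  refine lintegral_pow_mean_le (W := fun i ω => w (X i ω, β i ω))
    (fun i => hw.comp (hmodel.measurable_pair i)) (hmodel.indep.comp (fun _ => w) fun _ => hw)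
    (fun i => (hmodel.identDistrib i).comp hw) (fun i ω => abs_nonneg _)
    (fun i ω => abs_smoothKernel_le hBodd _ _) ?_ hN hk hc
  refine (hmodel.integral_comp_X_le 0 (continuous_smoothKernel_left _ T x).abs
    (fun y => abs_nonneg _) hF).trans (mul_le_mul_of_nonneg_left ?_ hF0)
  simp only [fun y => smoothKernel_comm (oddWeights χ) T y x]
  exact hBodd x

/-- At each point the oracle estimator is a mean of i.i.d. variables; their sup-norm is bounded by
that of the kernel and, since `f_X` is bounded, their second moment by its `L²` norm. -/
theorem oracle_summand_bounds (hmodel : IsModelSample P d X β Y fX)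
    (hr : IsChoiceProbability P d X Y r)
    (hF : ∀ᵐ y ∂(surf d), fX y ≤ F) (hF0 : 0 ≤ F) (ha : 0 < a)
    (hB : ∀ x : Sph d, ∫ y, |smoothKernel d χ T x y| ∂(surf d) ≤ B) (x : Sph d) :
    ∃ w : Sph d × Sph d → ℝ, Measurable w ∧
      (∀ i ω, w (X i ω, β i ω) =
        (2 * Y i ω - 1) * smoothKernel d (oddWeights χ) T (X i ω) x / max (fX (X i ω)) a) ∧
      (∀ i ω, |w (X i ω, β i ω)| ≤ nikolskii d T * B / a) ∧
      ∫ ω, w (X 0 ω, β 0 ω) ∂P = trimmedMean d χ T a fX r x ∧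
      ∫ ω, w (X 0 ω, β 0 ω) ^ 2 ∂P ≤ F * (nikolskii d T * B * B) / a ^ 2 := by
  have hBodd := integral_abs_oddKernel_le hB
  have hmax : ∀ y, 0 < max (fX y) a := fun y => ha.trans_le (le_max_right _ _)
  have hκ := continuous_smoothKernel_left (d := d) (oddWeights χ) T x
  have hk : ∀ y, |smoothKernel d (oddWeights χ) T y x / max (fX y) a| ≤
      |smoothKernel d (oddWeights χ) T y x| / a := fun y => by
    rw [abs_div, abs_of_pos (hmax y)]
    gcongr
    exact le_max_right _ _
  have hk' : ∀ y, |smoothKernel d (oddWeights χ) T y x / max (fX y) a| ≤ nikolskii d T * B / a :=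
    fun y => (hk y).trans (by gcongr; exact abs_smoothKernel_le hBodd _ _)
  have hkm : Measurable fun y => smoothKernel d (oddWeights χ) T y x / max (fX y) a :=
    hκ.measurable.div (hmodel.measurable_fX.max measurable_const)
  have heq : ∀ i ω, (2 * choiceFun (X i ω, β i ω) - 1) *
      (smoothKernel d (oddWeights χ) T (X i ω) x / max (fX (X i ω)) a) =
      (2 * Y i ω - 1) * (smoothKernel d (oddWeights χ) T (X i ω) x / max (fX (X i ω)) a) :=
    fun i ω => by rw [hmodel.eq_choiceFun]
  refine ⟨fun z => (2 * choiceFun z - 1) *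
    (smoothKernel d (oddWeights χ) T z.1 x / max (fX z.1) a),
    ((measurable_choiceFun.const_mul 2).sub_const 1).mul (hkm.comp measurable_fst), ?_, ?_, ?_, ?_⟩
  · intro i ω
    simp only
    rw [heq, mul_div_assoc]
  · intro i ω
    simp only
    rw [heq, abs_mul, hmodel.abs_two_mul_sub_one, one_mul]
    exact hk' _
  · simp only
    simp_rw [heq]
    rw [integral_choice_mul hmodel hr 0 hkm hk', trimmedMean]
    simp_rw [mul_div_assoc]
  · simp only
    have h1 : ∀ ω, ((2 * choiceFun (X 0 ω, β 0 ω) - 1) *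
        (smoothKernel d (oddWeights χ) T (X 0 ω) x / max (fX (X 0 ω)) a)) ^ 2 ≤
        smoothKernel d (oddWeights χ) T (X 0 ω) x ^ 2 / a ^ 2 := fun ω => by
      rw [heq, ← sq_abs, abs_mul, hmodel.abs_two_mul_sub_one, one_mul, ← div_pow,
        ← sq_abs (smoothKernel d (oddWeights χ) T (X 0 ω) x / a), abs_div _ a, abs_of_pos ha]
      exact pow_le_pow_left₀ (abs_nonneg _) (hk _) 2
    have hc : Continuous fun y => smoothKernel d (oddWeights χ) T y x ^ 2 / a ^ 2 :=
      (hκ.pow 2).div_const _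
    calc _ ≤ ∫ ω, smoothKernel d (oddWeights χ) T (X 0 ω) x ^ 2 / a ^ 2 ∂P := by
          refine integral_mono_of_nonneg (Eventually.of_forall fun ω => sq_nonneg _) ?_
            (Eventually.of_forall h1)
          obtain ⟨b, hb⟩ := isCompact_univ.bddAbove_image (f := fun y => |_|)
            (hc.abs.continuousOn (s := Set.univ))
          exact integrable_of_abs_le (hc.measurable.comp (hmodel.measurable_X 0))
            fun ω => hb ⟨X 0 ω, Set.mem_univ _, rfl⟩
      _ ≤ F * ∫ y, smoothKernel d (oddWeights χ) T y x ^ 2 / a ^ 2 ∂(surf d) :=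
          hmodel.integral_comp_X_le 0 hc (fun y => by positivity) hF
      _ ≤ _ := by
          rw [integral_div, ← mul_div_assoc]
          have := integral_sq_smoothKernel_le hBodd x
          simp only [fun y => smoothKernel_comm (oddWeights χ) T y x]
          gcongr

theorem measure_centred_gt_le (hmodel : IsModelSample P d X β Y fX)
    (hr : IsChoiceProbability P d X Y r)
    (hF : ∀ᵐ y ∂(surf d), fX y ≤ F) (hF1 : 1 ≤ F) (ha : 0 < a) (hB1 : 1 ≤ B)
    (hB : ∀ x : Sph d, ∫ y, |smoothKernel d χ T x y| ∂(surf d) ≤ B)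
    (hN : 1 ≤ N) (hk : 1 ≤ k) (hkN : Real.log N ≤ k) (hD : k * T + 1 ≤ N ^ 2)
    (hc : 4 * (k * (nikolskii d T * B)) ≤ N) :
    P {ω | ∃ x, Real.exp d * (2 * Real.exp (1 / 2) *
        √(k * (F * (nikolskii d T * B * B) / a ^ 2) / N)) <
        |oracleMean d χ T a X Y fX N ω x - trimmedMean d χ T a fX r x|} ≤
      ENNReal.ofReal (4 / (N : ℝ) ^ 2) := by
  have hnik := nikolskii_pos d T
  have hN' : (0 : ℝ) < N := by exact_mod_cast hN
  have hk' : (0 : ℝ) < k := by exact_mod_cast hk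
  have hF0 : 0 < F := by linarith
  have hB0 : 0 < B := by linarith
  refine measure_exists_lt_le_of_log_le
    (H := fun ω x => |oracleMean d χ T a X Y fX N ω x - trimmedMean d χ T a fX r x|) (D := T)
    (measurable_centred hmodel hr).abs (fun ω => (continuous_centred hmodel hr ω).abs)
    (fun ω x => abs_nonneg _) (fun ω => ?_) (by positivity) (fun x => ?_) hN hkN hD
  · obtain ⟨g, hg, h⟩ := exists_polySpace_eq_centred (χ := χ) (T := T) (a := a) (N := N) hmodel hr ω
    simp_rw [← h]
    exact isPolyEnvelope_abs hg
  · obtain ⟨w, hw, hwe, hwb, hwm, hw2⟩ := oracle_summand_bounds hmodel hr hF hF0.le ha hB x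
    have := lintegral_pow_centred_mean_le (P := P) (W := fun i ω => w (X i ω, β i ω))
      (fun i => hw.comp (hmodel.measurable_pair i)) (hmodel.indep.comp (fun _ => w) fun _ => hw)
      (fun i => (hmodel.identDistrib i).comp hw) hwb (by positivity) hw2 hN hk ?_
    · rw [hwm] at this
      simp only [hwe] at this
      exact this
    · set c := nikolskii d T * B with hcdef
      have hc0 : 0 < c := by positivity
      have h1 : 4 * c ^ 2 * k ≤ F * (c * B) * N := by
        calc 4 * c ^ 2 * k = c * (4 * (k * c)) := by ring
          _ ≤ c * N := by gcongr
          _ ≤ F * (c * B) * N := by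
            have : 1 ≤ F * B := one_le_mul_of_one_le_of_one_le hF1 hB1
            have h2 : 0 ≤ c * N := by positivity
            nlinarith
      calc 4 * (c / a) ^ 2 * k = 4 * c ^ 2 * k / a ^ 2 := by ring
        _ ≤ F * (c * B) * N / a ^ 2 := by gcongr
        _ = _ := by ring

theorem measure_eLpNorm_centred_gt_le (hmodel : IsModelSample P d X β Y fX)
    (hr : IsChoiceProbability P d X Y r)
    (hF : ∀ᵐ y ∂(surf d), fX y ≤ F) (hF0 : 0 ≤ F) (ha : 0 < a)
    (hB : ∀ x : Sph d, ∫ y, |smoothKernel d χ T x y| ∂(surf d) ≤ B)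
    (hN : 1 ≤ N) {t : ℝ} (ht : 0 < t) :
    P {ω | ENNReal.ofReal t < eLpNorm (fun x =>
        oracleMean d χ T a X Y fX N ω x - trimmedMean d χ T a fX r x) 2 (surf d)} ≤
      ENNReal.ofReal
        (F * (nikolskii d T * B * B) / a ^ 2 / N * (surf d).real Set.univ / t ^ 2) := by
  set Z : Ω → Sph d → ℝ := fun ω x =>
    oracleMean d χ T a X Y fX N ω x - trimmedMean d χ T a fX r x with hZ
  have hmeas : Measurable fun z : Ω × Sph d => ENNReal.ofReal (Z z.1 z.2 ^ 2) :=
    ((measurable_centred hmodel hr).pow_const 2).ennreal_ofReal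
  have hsub : {ω | ENNReal.ofReal t < eLpNorm (Z ω) 2 (surf d)} ⊆
      {ω | ENNReal.ofReal (t ^ 2) ≤ ∫⁻ x, ENNReal.ofReal (Z ω x ^ 2) ∂(surf d)} := by
    intro ω hω
    rw [Set.mem_ofPred_eq, eLpNorm_eq_lintegral_rpow_enorm_toReal two_ne_zero
      ENNReal.ofNat_ne_top] at hω
    have h1 := ENNReal.rpow_le_rpow hω.le (show (0 : ℝ) ≤ 2 by norm_num)
    rw [← ENNReal.rpow_mul, ENNReal.toReal_ofNat, one_div, inv_mul_cancel₀ two_ne_zero,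
      ENNReal.rpow_one, ENNReal.ofReal_rpow_of_pos ht, Real.rpow_two] at h1
    refine h1.trans (le_of_eq (lintegral_congr fun x => ?_))
    rw [← sq_abs, ← Real.enorm_abs, Real.enorm_of_nonneg (abs_nonneg _),
      ENNReal.ofReal_rpow_of_nonneg (abs_nonneg _) (by norm_num), Real.rpow_two]
  have hmom : ∀ x, ∫⁻ ω, ENNReal.ofReal (Z ω x ^ 2) ∂P ≤
      ENNReal.ofReal (F * (nikolskii d T * B * B) / a ^ 2 / N) := by
    intro x
    obtain ⟨w, hw, hwe, hwb, hwm, hw2⟩ := oracle_summand_bounds hmodel hr hF hF0 ha hB x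
    have := lintegral_sq_centred_mean_le (P := P) (W := fun i ω => w (X i ω, β i ω))
      (fun i => hw.comp (hmodel.measurable_pair i)) (hmodel.indep.comp (fun _ => w) fun _ => hw)
      (fun i => (hmodel.identDistrib i).comp hw) hwb hw2 hN
    rw [hwm] at this
    simp only [hwe] at this
    exact this
  have hswap : ∫⁻ ω, ∫⁻ x, ENNReal.ofReal (Z ω x ^ 2) ∂(surf d) ∂P ≤
      ENNReal.ofReal (F * (nikolskii d T * B * B) / a ^ 2 / N * (surf d).real Set.univ) := by
    rw [lintegral_lintegral_swap hmeas.aemeasurable]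
    refine (lintegral_mono hmom).trans (le_of_eq ?_)
    rw [lintegral_const, ENNReal.ofReal_mul' measureReal_nonneg, ofReal_measureReal]
  calc _ ≤ (∫⁻ ω, ∫⁻ x, ENNReal.ofReal (Z ω x ^ 2) ∂(surf d) ∂P) / ENNReal.ofReal (t ^ 2) :=
        (measure_mono hsub).trans (meas_ge_le_lintegral_div hmeas.lintegral_prod_right'.aemeasurable
          (by simpa using ht.ne') ENNReal.ofReal_ne_top)
    _ ≤ _ := ENNReal.div_le_div_right hswap _
    _ = _ := (ENNReal.ofReal_div_of_pos (pow_pos ht 2)).symm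

end Model

/-! ### Rates -/

theorem logExponent_nonneg {ρ : ℝ} (hρ : 0 < ρ) (q : ℝ≥0∞) : 0 ≤ logExponent ρ q := by
  unfold logExponent
  split_ifs with h
  · have h1 : (q⁻¹).toReal ≤ 2⁻¹ := by
      have := ENNReal.toReal_mono (by simp) (ENNReal.inv_le_inv.2 h)
      simpa using this
    linarith
  · linarith

theorem eventually_one_le_log : ∀ᶠ N : ℕ in atTop, 1 ≤ Real.log N :=
  (Real.tendsto_log_atTop.comp tendsto_natCast_atTop_atTop).eventually_ge_atTop 1

theorem one_lt_of_one_le_log {N : ℕ} (h : 1 ≤ Real.log N) : 1 < N := by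
  by_contra hN
  have : N = 0 ∨ N = 1 := by omega
  rcases this with rfl | rfl <;> norm_num at h

theorem effSize_pos {ρ : ℝ} {q : ℝ≥0∞} {N : ℕ} (h : 1 ≤ Real.log N) : 0 < effSize ρ q N := by
  have hN : (0 : ℝ) < N := by exact_mod_cast (one_lt_of_one_le_log h).le
  exact div_pos hN (Real.rpow_pos_of_pos (by linarith) _)

theorem effSize_le {ρ : ℝ} (hρ : 0 < ρ) {q : ℝ≥0∞} {N : ℕ} (h : 1 ≤ Real.log N) :
    effSize ρ q N ≤ N :=
  div_le_self (Nat.cast_nonneg _) (Real.one_le_rpow h (logExponent_nonneg hρ q))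

/-- The standard deviation `(T^{d-1} (log N)^e / N)^{1/2}` of the estimator, up to constants;
`e = 2ρ` in `L²` and `e = 2ρ + 1` in `L^∞`. -/
def noiseLevel (d T : ℕ) (e : ℝ) (N : ℕ) : ℝ := √((T : ℝ) ^ (d - 1) * Real.log N ^ e / N)

theorem noiseLevel_nonneg (d T : ℕ) (e : ℝ) (N : ℕ) : 0 ≤ noiseLevel d T e N := Real.sqrt_nonneg _

theorem noiseLevel_eq (d T : ℕ) (e : ℝ) {N : ℕ} (h : 0 ≤ Real.log N) :
    noiseLevel d T e N = √((T : ℝ) ^ (d - 1) / N) * Real.log N ^ (e / 2) := by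
  rw [noiseLevel, mul_div_right_comm, Real.sqrt_mul (by positivity), Real.sqrt_eq_rpow (_ ^ e),
    ← Real.rpow_mul h, mul_one_div]

theorem noiseLevel_rpow_mul_rpow (d T : ℕ) (e : ℝ) {N : ℕ} (h : 1 ≤ Real.log N) {η : ℝ}
    (h0 : 0 ≤ η) (h1 : η ≤ 1) :
    noiseLevel d T e N ^ η * noiseLevel d T (e + 1) N ^ (1 - η) =
      noiseLevel d T (e + (1 - η)) N := by
  have hL : 0 < Real.log N := by linarith
  rw [noiseLevel_eq d T e hL.le, noiseLevel_eq d T _ hL.le, noiseLevel_eq d T _ hL.le]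
  set x := √((T : ℝ) ^ (d - 1) / N) with hx
  have hx0 : 0 ≤ x := Real.sqrt_nonneg _
  rw [Real.mul_rpow hx0 (by positivity), Real.mul_rpow hx0 (by positivity), ← Real.rpow_mul hL.le,
    ← Real.rpow_mul hL.le]
  have e1 : x ^ η * x ^ (1 - η) = x := by
    rw [← Real.rpow_add_of_nonneg hx0 h0 (by linarith)]
    simp
  have e2 : Real.log N ^ (e / 2 * η) * Real.log N ^ ((e + 1) / 2 * (1 - η)) =
      Real.log N ^ ((e + (1 - η)) / 2) := by
    rw [← Real.rpow_add hL]
    congr 1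
    ring
  rw [← e2]
  linear_combination
    (Real.log N ^ (e / 2 * η) * Real.log N ^ ((e + 1) / 2 * (1 - η))) * e1

variable {d : ℕ} {s ρ : ℝ} {q : ℝ≥0∞} {T : ℕ → ℕ}

theorem denominator_pos (hd : 2 ≤ d) (hs : 0 < s) : 0 < 2 * s + d - 1 := by
  have : (2 : ℝ) ≤ d := by exact_mod_cast hd
  linarith

/-- The consequences of `T_N ≍ A_N(q)^{1/(2s+d-1)}` used below. -/
theorem SameOrder.bounds (hd : 2 ≤ d) (hs : 0 < s)
    (hT : SameOrder (fun N => (T N : ℝ)) (fun N => effSize ρ q N ^ (1 / (2 * s + d - 1)))) :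
    ∃ M : ℝ, 0 < M ∧ ∀ᶠ N in atTop, 1 ≤ T N ∧
      (T N : ℝ) ^ (-s) ≤ M * effSize ρ q N ^ (-(s / (2 * s + d - 1))) ∧
      (T N : ℝ) ^ (d - 1) ≤ M * effSize ρ q N ^ (((d : ℝ) - 1) / (2 * s + d - 1)) := by
  obtain ⟨M, hM, h⟩ := hT
  have hD := denominator_pos hd hs
  refine ⟨max (M ^ s) (M ^ (d - 1)), lt_max_of_lt_left (by positivity), ?_⟩
  filter_upwards [h, eventually_one_le_log] with N ⟨h1, h2⟩ hL
  have hA := effSize_pos (ρ := ρ) (q := q) hL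
  set A := effSize ρ q N
  have hlow : 0 < M⁻¹ * A ^ (1 / (2 * s + d - 1)) := by positivity
  refine ⟨?_, ?_, ?_⟩
  · have : (0 : ℝ) < T N := hlow.trans_le h1
    exact_mod_cast this
  · calc (T N : ℝ) ^ (-s) ≤ (M⁻¹ * A ^ (1 / (2 * s + d - 1))) ^ (-s) :=
          Real.rpow_le_rpow_of_nonpos hlow h1 (by linarith)
      _ = M ^ s * A ^ (-(s / (2 * s + d - 1))) := by
          rw [Real.mul_rpow (by positivity) (by positivity), ← Real.rpow_mul hA.le,
            Real.inv_rpow hM.le, Real.rpow_neg hM.le, inv_inv]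
          congr 2
          ring
      _ ≤ _ := by gcongr; exact le_max_left _ _
  · calc (T N : ℝ) ^ (d - 1) ≤ (M * A ^ (1 / (2 * s + d - 1))) ^ (d - 1) := by gcongr
      _ = M ^ (d - 1) * A ^ (((d : ℝ) - 1) / (2 * s + d - 1)) := by
          rw [mul_pow, ← Real.rpow_mul_natCast hA.le]
          congr 2
          rw [Nat.cast_sub (by omega)]
          push_cast
          ring
      _ ≤ _ := by gcongr; exact le_max_right _ _

theorem eventually_mul_pow_mul_log_le (hd : 2 ≤ d) (hs : 0 < s) (hρ : 0 < ρ)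
    (hT : SameOrder (fun N => (T N : ℝ)) (fun N => effSize ρ q N ^ (1 / (2 * s + d - 1)))) (K : ℝ) :
    ∀ᶠ N : ℕ in atTop, K * ((T N : ℝ) ^ (d - 1) * Real.log N) ≤ N := by
  obtain ⟨M, hM, h⟩ := hT.bounds hd hs
  have hD := denominator_pos hd hs
  have hd' : (2 : ℝ) ≤ d := by exact_mod_cast hd
  have hlog := ((isLittleO_log_rpow_atTop (show 0 < 2 * s / (2 * s + d - 1) by positivity)).def
    (show 0 < (|K| * M + 1)⁻¹ by positivity))
  filter_upwards [h, eventually_one_le_log, tendsto_natCast_atTop_atTop.eventually hlog]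
    with N ⟨_, _, h3⟩ hL hlogN
  have hN : (0 : ℝ) < N := by exact_mod_cast (one_lt_of_one_le_log hL).le
  rw [Real.norm_of_nonneg (by linarith), Real.norm_of_nonneg (by positivity), inv_mul_eq_div,
    le_div_iff₀ (by positivity)] at hlogN
  have h4 : effSize ρ q N ^ (((d : ℝ) - 1) / (2 * s + d - 1)) ≤
      (N : ℝ) ^ (((d : ℝ) - 1) / (2 * s + d - 1)) :=
    Real.rpow_le_rpow (effSize_pos hL).le (effSize_le hρ hL)
      (div_nonneg (by linarith) hD.le)
  have hL0 : 0 ≤ Real.log N := by linarith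
  calc K * ((T N : ℝ) ^ (d - 1) * Real.log N)
      ≤ |K| * (M * (N : ℝ) ^ (((d : ℝ) - 1) / (2 * s + d - 1)) * Real.log N) := by
        refine mul_le_mul (le_abs_self K) ?_ (by positivity) (abs_nonneg K)
        exact mul_le_mul_of_nonneg_right
          (h3.trans (mul_le_mul_of_nonneg_left h4 hM.le)) hL0
    _ = (N : ℝ) ^ (((d : ℝ) - 1) / (2 * s + d - 1)) * (Real.log N * (|K| * M)) := by ring
    _ ≤ (N : ℝ) ^ (((d : ℝ) - 1) / (2 * s + d - 1)) * (N : ℝ) ^ (2 * s / (2 * s + d - 1)) := by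
        gcongr
        refine le_trans ?_ hlogN
        gcongr
        linarith
    _ = N := by
        rw [← Real.rpow_add hN, ← add_div, show (d : ℝ) - 1 + 2 * s = 2 * s + d - 1 by ring,
          div_self hD.ne', Real.rpow_one]

/-- The choice of `T_N` makes the noise level comparable to the rate. -/
theorem eventually_noiseLevel_le (hd : 2 ≤ d) (hs : 0 < s)
    (hT : SameOrder (fun N => (T N : ℝ)) (fun N => effSize ρ q N ^ (1 / (2 * s + d - 1)))) :
    ∃ C : ℝ, 0 < C ∧ ∀ᶠ N : ℕ in atTop, noiseLevel d (T N) (logExponent ρ q) N ≤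
      C * effSize ρ q N ^ (-(s / (2 * s + d - 1))) := by
  obtain ⟨M, hM, h⟩ := hT.bounds hd hs
  have hD := denominator_pos hd hs
  refine ⟨√M, Real.sqrt_pos.2 hM, ?_⟩
  filter_upwards [h, eventually_one_le_log] with N ⟨_, _, h3⟩ hL
  have hA := effSize_pos (ρ := ρ) (q := q) hL
  have hN : (0 : ℝ) < N := by exact_mod_cast (one_lt_of_one_le_log hL).le
  have h1 : (T N : ℝ) ^ (d - 1) * Real.log N ^ logExponent ρ q / N =
      (T N : ℝ) ^ (d - 1) / effSize ρ q N := by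
    rw [effSize, div_div_eq_mul_div]
  rw [noiseLevel, h1]
  refine Real.sqrt_le_iff.2 ⟨by positivity, ?_⟩
  rw [mul_pow, Real.sq_sqrt hM.le, div_le_iff₀ hA]
  refine h3.trans (le_of_eq ?_)
  rw [mul_assoc]
  congr 1
  rw [← Real.rpow_mul_natCast hA.le, ← Real.rpow_add_one hA.ne']
  congr 1
  push_cast
  field_simp
  ring

/-! ### The bias terms -/

variable [NeZero d] {χ : ℕ → ℕ → ℝ} {fX r : Sph d → ℝ}

theorem eventually_approx_le (hd : 2 ≤ d) (hs : 0 < s) (hq : 1 ≤ q)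
    (hK : KernelAssumption d χ q s) (hR : MemSobolev d q s (extendedChoice d r))
    (hT : SameOrder (fun N => (T N : ℝ)) (fun N => effSize ρ q N ^ (1 / (2 * s + d - 1)))) :
    ∃ C : ℝ, 0 ≤ C ∧ ∀ᶠ N : ℕ in atTop, eLpNorm (fun x => oddPart (extendedChoice d r) x -
        ∫ y, smoothKernel d χ (2 * T N) x y * oddPart (extendedChoice d r) y ∂(surf d)) q (surf d) ≤
      ENNReal.ofReal (C * effSize ρ q N ^ (-(s / (2 * s + d - 1)))) := by
  obtain ⟨M, hM, h⟩ := hT.bounds hd hs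
  obtain ⟨C, hC⟩ := hK.approx
  have hφ := hR.oddPart hq
  set S := (sobolevNorm d q s (oddPart (extendedChoice d r))).toReal with hS
  refine ⟨|C| * M * S, by positivity, ?_⟩
  filter_upwards [h, eventually_one_le_log] with N ⟨h1, h2, _⟩ hL
  have hA := effSize_pos (ρ := ρ) (q := q) hL
  refine (hC (2 * T N) (by omega) _ hφ).trans ?_
  rw [← ENNReal.ofReal_toReal hφ.sobolevNorm_lt_top.ne, ← hS, ← ENNReal.ofReal_mul' (by positivity)]
  refine ENNReal.ofReal_le_ofReal ?_
  have hT1 : (1 : ℝ) ≤ T N := by exact_mod_cast h1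
  have h3 : ((2 * T N : ℕ) : ℝ) ^ (-s) ≤ M * effSize ρ q N ^ (-(s / (2 * s + d - 1))) := by
    refine (Real.rpow_le_rpow_of_nonpos (by linarith) ?_ (by linarith)).trans h2
    push_cast
    linarith
  have h4 : C * ((2 * T N : ℕ) : ℝ) ^ (-s) ≤
      |C| * (M * effSize ρ q N ^ (-(s / (2 * s + d - 1)))) :=
    mul_le_mul (le_abs_self C) h3 (by positivity) (abs_nonneg C)
  calc _ ≤ |C| * (M * effSize ρ q N ^ (-(s / (2 * s + d - 1)))) * S := by gcongr
    _ = _ := by ring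

theorem eventually_trimming_bias_le (hd : 2 ≤ d) (hs : 0 < s) (hq : 1 ≤ q)
    (hfm : Measurable fX) (hf0 : ∀ x, 0 ≤ fX x) (hsupp : SupportAssumption d fX)
    (hrm : Measurable r) (hr : ∀ᵐ y ∂(surf d), 0 < fX y → |2 * r y - 1| ≤ 1)
    (hR : Integrable (extendedChoice d r) (surf d)) {B : ℝ} (hB1 : 1 ≤ B)
    (hB : ∀ T : ℕ, 1 ≤ T → ∀ x : Sph d, ∫ y, |smoothKernel d χ T x y| ∂(surf d) ≤ B)
    (htrim : TrimmingAssumption d q s ρ fX)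
    (hT : SameOrder (fun N => (T N : ℝ)) (fun N => effSize ρ q N ^ (1 / (2 * s + d - 1)))) :
    ∃ C : ℝ, 0 ≤ C ∧ ∀ᶠ N : ℕ in atTop,
      eLpNorm (fun x => trimmedMean d χ (2 * T N) (trim ρ N) fX r x -
        ∫ y, smoothKernel d χ (2 * T N) x y * oddPart (extendedChoice d r) y ∂(surf d)) q (surf d) ≤
      ENNReal.ofReal (C * effSize ρ q N ^ (-(s / (2 * s + d - 1)))) := by
  obtain ⟨M, hM, h⟩ := hT.bounds hd hs
  have hD := denominator_pos hd hs
  have hnik := nikolskii_pos d 2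
  have hq1 : (q⁻¹).toReal ≤ 1 := by
    have := ENNReal.toReal_mono ENNReal.one_ne_top (ENNReal.inv_le_one.2 hq)
    simpa using this
  set η := 1 - (q⁻¹).toReal with hη
  have hη0 : 0 ≤ η := by linarith
  refine ⟨B * (nikolskii d 2 * M) ^ η, by positivity, ?_⟩
  filter_upwards [h, eventually_one_le_log, htrim.1.def one_pos] with N ⟨h1, _, h3⟩ hL hm
  have hA := effSize_pos (ρ := ρ) (q := q) hL
  refine (eLpNorm_trimming_bias_le hfm hf0 hsupp hrm hr hR (hB (2 * T N) (by omega))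
    (Real.rpow_pos_of_pos (by linarith) _) hq).trans (ENNReal.ofReal_le_ofReal ?_)
  rw [one_mul, Real.norm_of_nonneg measureReal_nonneg, Real.norm_of_nonneg (by positivity)] at hm
  have hn : nikolskii d (2 * T N) ^ η ≤ (nikolskii d 2 * M) ^ η *
      effSize ρ q N ^ ((((d : ℝ) - 1) / (2 * s + d - 1)) * η) := by
    rw [Real.rpow_mul hA.le, ← Real.mul_rpow (by positivity) (by positivity), mul_assoc]
    refine Real.rpow_le_rpow (nikolskii_pos d _).le ?_ hη0
    exact (nikolskii_two_mul_le d h1).trans (by gcongr)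
  calc _ ≤ effSize ρ q N ^ (-((s + (d - 1) * η) / (2 * s + d - 1))) * B *
        ((nikolskii d 2 * M) ^ η * effSize ρ q N ^ ((((d : ℝ) - 1) / (2 * s + d - 1)) * η)) := by
        have := (Real.rpow_nonneg (nikolskii_pos d (2 * T N)).le η)
        gcongr
        exact hm
    _ = B * (nikolskii d 2 * M) ^ η * (effSize ρ q N ^ (-((s + (d - 1) * η) / (2 * s + d - 1))) *
        effSize ρ q N ^ ((((d : ℝ) - 1) / (2 * s + d - 1)) * η)) := by ring
    _ = _ := by
        rw [← Real.rpow_add hA]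
        congr 2
        field_simp
        ring

/-! ### The decomposition of the error -/

theorem abs_sub_le_plugInError {Ω : Type*} {d : ℕ} (ρ : ℝ) (X : ℕ → Ω → Sph d) (fX : Sph d → ℝ)
    (fhat : ℕ → Ω → Sph d → ℝ) (N : ℕ) (ω : Ω) :
    plugInError ρ X fX fhat N ω ≠ ∞ ∧ ∀ i ∈ Finset.range N,
      |max (fX (X i ω)) (trim ρ N) / max (fhat N ω (X i ω)) (trim ρ N) - 1| ≤
        (plugInError ρ X fX fhat N ω).toReal := by
  have h1 : plugInError ρ X fX fhat N ω ≠ ∞ := by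
    refine ne_top_of_le_ne_top (b := ∑ i ∈ Finset.range N, ENNReal.ofReal
      |max (fX (X i ω)) (trim ρ N) / max (fhat N ω (X i ω)) (trim ρ N) - 1|)
      (ENNReal.sum_ne_top.2 fun i _ => ENNReal.ofReal_ne_top) (iSup₂_le fun i hi => ?_)
    exact Finset.single_le_sum (f := fun i => ENNReal.ofReal
      |max (fX (X i ω)) (trim ρ N) / max (fhat N ω (X i ω)) (trim ρ N) - 1|)
      (fun _ _ => zero_le) hi
  refine ⟨h1, fun i hi => (ENNReal.ofReal_le_iff_le_toReal h1).1 ?_⟩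
  exact le_iSup₂ (f := fun i (_ : i ∈ Finset.range N) => ENNReal.ofReal
    |max (fX (X i ω)) (trim ρ N) / max (fhat N ω (X i ω)) (trim ρ N) - 1|) i hi

section Decomposition

variable {Ω : Type*} [MeasurableSpace Ω] {P : Measure Ω} [IsProbabilityMeasure P]
  {X β : ℕ → Ω → Sph d} {Y : ℕ → Ω → ℝ} {fhat : ℕ → Ω → Sph d → ℝ}

/-- The error splits into the plug-in error, the centred oracle estimator, the trimming bias and
the approximation error. The plug-in error is bounded through the mean of the absolute values of
the kernel, so no measurability of `fhat` is needed. -/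
theorem eLpNorm_Rhat_sub_le (hmodel : IsModelSample P d X β Y fX)
    (hr : IsChoiceProbability P d X Y r) (hq : 1 ≤ q)
    (hR : MemLp (extendedChoice d r) q (surf d)) {N : ℕ} (ha : 0 < trim ρ N) {ω : Ω} {M : ℝ}
    (hM0 : 0 ≤ M) (hM : ∀ x, kernelMean d χ (2 * T N) X N ω x ≤ M) :
    eLpNorm (fun x => Rhat d χ T ρ X Y fhat N ω x - extendedChoice d r x) q (surf d) ≤
      surf d Set.univ ^ (q.toReal⁻¹) *
        (ENNReal.ofReal (M / trim ρ N) * plugInError ρ X fX fhat N ω) +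
      eLpNorm (fun x => oracleMean d χ (2 * T N) (trim ρ N) X Y fX N ω x -
        trimmedMean d χ (2 * T N) (trim ρ N) fX r x) q (surf d) +
      eLpNorm (fun x => trimmedMean d χ (2 * T N) (trim ρ N) fX r x -
        ∫ y, smoothKernel d χ (2 * T N) x y * oddPart (extendedChoice d r) y ∂(surf d)) q (surf d) +
      eLpNorm (fun x => oddPart (extendedChoice d r) x -
        ∫ y, smoothKernel d χ (2 * T N) x y * oddPart (extendedChoice d r) y ∂(surf d)) q
        (surf d) := by
  set a := trim ρ N
  set φ := oddPart (extendedChoice d r) with hφdef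
  have hφ : MemLp φ q (surf d) := memLp_oddPart hR
  obtain ⟨g₁, -, hg₁⟩ := exists_polySpace_eq_oracleMean (d := d) (χ := χ) (T := 2 * T N) (a := a)
    (X := X) (Y := Y) (fX := fX) (N := N) ω
  obtain ⟨g₂, -, hg₂⟩ := exists_polySpace_eq_trimmedMean hmodel.measurable_fX hmodel.nonneg_fX
    hr.1 (abs_two_mul_choiceProbability_sub_one_le hmodel hr) χ (2 * T N) a
  obtain ⟨g₃, -, hg₃⟩ := exists_polySpace_eq_integral_smoothKernel χ (2 * T N) (surf d)
    (hφ.integrable hq)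
  simp only [fun x y => smoothKernel_comm χ (2 * T N) y x] at hg₃
  set p : Sph d → ℝ := fun x => (N : ℝ)⁻¹ * ∑ i ∈ Finset.range N,
    (2 * Y i ω - 1) * smoothKernel d (oddWeights χ) (2 * T N) (X i ω) x /
      max (fhat N ω (X i ω)) a - oracleMean d χ (2 * T N) a X Y fX N ω x with hp
  have hpc : Continuous p := by
    simp only [hp, ← hg₁]
    refine (continuous_const.mul (continuous_finsetSum _ fun i _ => ?_)).sub g₁.continuous
    exact (continuous_const.mul (continuous_smoothKernel_right _ _ _)).div_const _
  -- a maximum of finitely many real numbers, so passing to real numbers loses nothing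
  obtain ⟨hδ, hδi⟩ := abs_sub_le_plugInError ρ X fX fhat N ω
  set δ := (plugInError ρ X fX fhat N ω).toReal with hδdef
  have hδ0 : 0 ≤ δ := ENNReal.toReal_nonneg
  have hpb : ∀ x, ‖p x‖ ≤ M / a * δ := by
    intro x
    have h1 : p x = (N : ℝ)⁻¹ * ∑ i ∈ Finset.range N,
        (2 * Y i ω - 1) * smoothKernel d (oddWeights χ) (2 * T N) (X i ω) x *
          ((max (fX (X i ω)) a / max (fhat N ω (X i ω)) a - 1) / max (fX (X i ω)) a) := by
      simp only [hp, oracleMean]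
      rw [← mul_sub, ← Finset.sum_sub_distrib]
      congr 1
      refine Finset.sum_congr rfl fun i _ => ?_
      have hm1 : max (fX (X i ω)) a ≠ 0 := (ha.trans_le (le_max_right _ _)).ne'
      have hm2 : max (fhat N ω (X i ω)) a ≠ 0 := (ha.trans_le (le_max_right _ _)).ne'
      field_simp
    have h2 : ‖p x‖ ≤ (N : ℝ)⁻¹ * ∑ i ∈ Finset.range N,
        |smoothKernel d (oddWeights χ) (2 * T N) (X i ω) x| * (δ / a) := by
      rw [h1, norm_mul, Real.norm_of_nonneg (by positivity)]
      refine mul_le_mul_of_nonneg_left ((norm_sum_le _ _).trans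
        (Finset.sum_le_sum fun i hi => ?_)) (by positivity)
      rw [Real.norm_eq_abs, abs_mul, abs_mul, hmodel.abs_two_mul_sub_one, one_mul, abs_div,
        abs_of_pos (ha.trans_le (le_max_right (fX (X i ω)) a))]
      gcongr
      · exact hδi i hi
      · exact le_max_right _ _
    refine h2.trans ?_
    rw [← Finset.sum_mul, ← mul_assoc]
    calc _ = kernelMean d χ (2 * T N) X N ω x * (δ / a) := rfl
      _ ≤ M * (δ / a) := by gcongr; exact hM x
      _ = _ := by ring
  have hplug : eLpNorm p q (surf d) ≤ surf d Set.univ ^ (q.toReal⁻¹) *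
      (ENNReal.ofReal (M / a) * plugInError ρ X fX fhat N ω) := by
    refine (eLpNorm_le_of_ae_bound (Eventually.of_forall hpb)).trans (le_of_eq ?_)
    rw [ENNReal.ofReal_mul (by positivity), ENNReal.ofReal_toReal hδ]
  have hae : (fun x => Rhat d χ T ρ X Y fhat N ω x - extendedChoice d r x) =ᵐ[surf d]
      p + (fun x => oracleMean d χ (2 * T N) a X Y fX N ω x -
        trimmedMean d χ (2 * T N) a fX r x) + (fun x => trimmedMean d χ (2 * T N) a fX r x -
        ∫ y, smoothKernel d χ (2 * T N) x y * φ y ∂(surf d)) - (fun x => φ x -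
        ∫ y, smoothKernel d χ (2 * T N) x y * φ y ∂(surf d)) := by
    filter_upwards [extendedChoice_ae_eq r] with x hx
    simp only [Pi.add_apply, Pi.sub_apply, hp, Rhat, oddKernel_eq_smoothKernel]
    rw [hx]
    ring
  have m1 : AEStronglyMeasurable (fun x => oracleMean d χ (2 * T N) a X Y fX N ω x -
        trimmedMean d χ (2 * T N) a fX r x) (surf d) :=
    (continuous_centred hmodel hr ω).aestronglyMeasurable
  have m2 : AEStronglyMeasurable (fun x => trimmedMean d χ (2 * T N) a fX r x -
        ∫ y, smoothKernel d χ (2 * T N) x y * φ y ∂(surf d)) (surf d) := by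
    simp only [← hg₂, ← hg₃]
    exact (g₂.continuous.sub g₃.continuous).aestronglyMeasurable
  have m3 : AEStronglyMeasurable (fun x => φ x -
        ∫ y, smoothKernel d χ (2 * T N) x y * φ y ∂(surf d)) (surf d) := by
    simp only [← hg₃]
    exact hφ.1.sub g₃.continuous.aestronglyMeasurable
  have m0 : AEStronglyMeasurable p (surf d) := hpc.aestronglyMeasurable
  rw [eLpNorm_congr_ae hae]
  refine (eLpNorm_sub_le ((m0.add m1).add m2) m3 hq).trans (add_le_add_left ?_ _)
  refine (eLpNorm_add_le (m0.add m1) m2 hq).trans (add_le_add_left ?_ _)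
  exact (eLpNorm_add_le m0 m1 hq).trans (add_le_add_left hplug _)

end Decomposition

/-! ### Tail bounds along the sequence of sample sizes -/

section Tails

variable {Ω : Type*} [MeasurableSpace Ω] {P : Measure Ω} [IsProbabilityMeasure P] {d : ℕ} [NeZero d]
  {X β : ℕ → Ω → Sph d} {Y : ℕ → Ω → ℝ} {fX r : Sph d → ℝ} {fhat : ℕ → Ω → Sph d → ℝ}
  {χ : ℕ → ℕ → ℝ} {s ρ B F : ℝ} {q : ℝ≥0∞} {T : ℕ → ℕ}

theorem exists_kernel_bound {d : ℕ} {p : ℝ≥0∞} (hK : KernelAssumption d χ p s) :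
    ∃ B : ℝ, 1 ≤ B ∧ ∀ T : ℕ, 1 ≤ T → ∀ x : Sph d,
      ∫ y, |smoothKernel d χ T x y| ∂(surf d) ≤ B := by
  obtain ⟨B, hB⟩ := hK.bounded
  exact ⟨max B 1, le_max_right _ _, fun T hT x => (hB T hT x).trans (le_max_left _ _)⟩

theorem exists_density_bound (hsupp : SupportAssumption d fX)
    (htrim : TrimmingAssumption d q s ρ fX) : ∃ F : ℝ, 1 ≤ F ∧ ∀ᵐ y ∂(surf d), fX y ≤ F := by
  obtain ⟨F, hF⟩ := htrim.2
  refine ⟨max F 1, le_max_right _ _, ?_⟩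
  filter_upwards [hsupp] with y hy
  by_cases h : 0 < fX y
  · exact (hF ⟨y, hy.1 h, rfl⟩).trans (le_max_left _ _)
  · exact (not_lt.1 h).trans (zero_le_one.trans (le_max_right _ _))

theorem trim_pos {N : ℕ} (h : 1 ≤ Real.log N) : 0 < trim ρ N :=
  Real.rpow_pos_of_pos (by linarith) _

theorem inv_trim_sq {N : ℕ} (h : 1 ≤ Real.log N) : (trim ρ N ^ 2)⁻¹ = Real.log N ^ (2 * ρ) := by
  have hL : 0 ≤ Real.log N := by linarith
  rw [trim, ← Real.rpow_mul_natCast hL, ← Real.rpow_neg hL]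
  congr 1
  push_cast
  ring

/-- The variance bound of `oracle_summand_bounds`, divided by `N`, is of the order of the squared
noise level. -/
theorem variance_proxy_le {d : ℕ} (hF : 0 ≤ F) {N : ℕ} (hT : 1 ≤ T N) (hL : 1 ≤ Real.log N) :
    F * (nikolskii d (2 * T N) * B * B) / trim ρ N ^ 2 / N ≤
      F * nikolskii d 2 * B ^ 2 * noiseLevel d (T N) (2 * ρ) N ^ 2 := by
  have hL0 : 0 ≤ Real.log N := by linarith
  have h1 := nikolskii_two_mul_le d hT
  rw [noiseLevel, Real.sq_sqrt (by positivity), div_eq_mul_inv _ (trim ρ N ^ 2), inv_trim_sq hL]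
  calc _ ≤ F * ((nikolskii d 2 * (T N : ℝ) ^ (d - 1)) * B * B) * Real.log N ^ (2 * ρ) / N := by
        rw [mul_assoc (nikolskii d (2 * T N)), mul_assoc (nikolskii d 2 * (T N : ℝ) ^ (d - 1))]
        have := mul_self_nonneg B
        gcongr
    _ = _ := by ring

theorem noiseLevel_sq_mul_log (d T : ℕ) (e : ℝ) {N : ℕ} (hL : 1 ≤ Real.log N) :
    noiseLevel d T e N ^ 2 * Real.log N = noiseLevel d T (e + 1) N ^ 2 := by
  have hL0 : 0 < Real.log N := by linarith
  rw [noiseLevel, noiseLevel, Real.sq_sqrt (by positivity), Real.sq_sqrt (by positivity),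
    Real.rpow_add_one hL0.ne']
  ring

/-- The event that the kernel means or the centred oracle estimator are exceptionally large
somewhere on the sphere. -/
def badEvent (d : ℕ) (χ : ℕ → ℕ → ℝ) (T : ℕ → ℕ) (ρ : ℝ) (X : ℕ → Ω → Sph d) (Y : ℕ → Ω → ℝ)
    (fX r : Sph d → ℝ) (M M' : ℝ) (N : ℕ) : Set Ω :=
  {ω | ∃ x, M < kernelMean d χ (2 * T N) X N ω x} ∪
    {ω | ∃ x, M' * noiseLevel d (T N) (2 * ρ + 1) N <
      |oracleMean d χ (2 * T N) (trim ρ N) X Y fX N ω x -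
        trimmedMean d χ (2 * T N) (trim ρ N) fX r x|}

theorem eventually_measure_badEvent_le (hd : 2 ≤ d) (hmodel : IsModelSample P d X β Y fX)
    (hr : IsChoiceProbability P d X Y r)
    (hF : ∀ᵐ y ∂(surf d), fX y ≤ F) (hF1 : 1 ≤ F) (hB1 : 1 ≤ B)
    (hB : ∀ T : ℕ, 1 ≤ T → ∀ x : Sph d, ∫ y, |smoothKernel d χ T x y| ∂(surf d) ≤ B)
    (hT1 : ∀ᶠ N in atTop, 1 ≤ T N)
    (hT : ∀ K : ℝ, ∀ᶠ N : ℕ in atTop, K * ((T N : ℝ) ^ (d - 1) * Real.log N) ≤ N) :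
    ∃ M M' : ℝ, 0 < M ∧ 0 < M' ∧ ∀ᶠ N : ℕ in atTop,
      P (badEvent d χ T ρ X Y fX r M M' N) ≤ ENNReal.ofReal (8 / (N : ℝ) ^ 2) := by
  have hnik := nikolskii_pos d 2
  refine ⟨Real.exp d * (2 * Real.exp (F * B)),
    Real.exp d * (2 * Real.exp (1 / 2) * √(2 * (F * nikolskii d 2 * B ^ 2))), by positivity,
    by positivity, ?_⟩
  filter_upwards [hT1, hT (8 * (nikolskii d 2 * B)), hT 8, eventually_one_le_log]
    with N hT1 h1 h2 hL
  have hN1 := one_lt_of_one_le_log hL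
  have hN : (1 : ℝ) < N := by exact_mod_cast hN1
  have hL0 : 0 < Real.log N := by linarith
  set k := ⌈Real.log N⌉₊ with hk
  have hkL : Real.log N ≤ k := Nat.le_ceil _
  have hk2 : (k : ℝ) ≤ 2 * Real.log N := by
    have := (Nat.ceil_lt_add_one hL0.le).le
    linarith
  have hk1 : 1 ≤ k := Nat.one_le_iff_ne_zero.2 (by
    intro h
    rw [h, Nat.cast_zero] at hkL
    linarith)
  have hTr : (1 : ℝ) ≤ T N := by exact_mod_cast hT1
  have hnik2 := nikolskii_pos d (2 * T N)
  have hc : 4 * (k * (nikolskii d (2 * T N) * B)) ≤ N := by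
    refine le_trans ?_ h1
    calc 4 * (k * (nikolskii d (2 * T N) * B))
        ≤ 4 * ((2 * Real.log N) * (nikolskii d 2 * (T N : ℝ) ^ (d - 1) * B)) := by
          gcongr
          exact nikolskii_two_mul_le d hT1
      _ = _ := by ring
  have hc0 : 0 ≤ k * (nikolskii d (2 * T N) * B) := by
    positivity
  have hD : k * (2 * T N) + 1 ≤ N ^ 2 := by
    have h3 : (T N : ℝ) ≤ (T N : ℝ) ^ (d - 1) := le_self_pow₀ hTr (by omega)
    have h4 : (k : ℝ) * (2 * T N) ≤ (2 * Real.log N) * (2 * (T N : ℝ) ^ (d - 1)) := by gcongr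
    have h5 : (k : ℝ) * (2 * T N) + 1 ≤ (N : ℝ) ^ 2 := by
      have h6 : (1 : ℝ) ≤ k * (2 * T N) := by
        have : (1 : ℝ) ≤ k := by exact_mod_cast hk1
        nlinarith
      nlinarith
    exact_mod_cast h5
  have e1 := measure_kernelMean_gt_le (T := 2 * T N) hmodel hF (by linarith)
    (hB (2 * T N) (by omega)) hN1.le hk1 hkL hD (by linarith)
  have e2 := measure_centred_gt_le (T := 2 * T N) hmodel hr hF hF1 (trim_pos (ρ := ρ) hL) hB1
    (hB (2 * T N) (by omega)) hN1.le hk1 hkL hD hc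
  have hsd : √(k * (F * (nikolskii d (2 * T N) * B * B) / trim ρ N ^ 2) / N) ≤
      √(2 * (F * nikolskii d 2 * B ^ 2)) * noiseLevel d (T N) (2 * ρ + 1) N := by
    rw [← Real.sqrt_sq (noiseLevel_nonneg d (T N) (2 * ρ + 1) N), ← Real.sqrt_mul (by positivity)]
    refine Real.sqrt_le_sqrt ?_
    have h3 := variance_proxy_le (d := d) (B := B) (F := F) (ρ := ρ) (by linarith) hT1 hL
    have h4 : 0 ≤ F * nikolskii d 2 * B ^ 2 * noiseLevel d (T N) (2 * ρ) N ^ 2 := by positivity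
    calc _ = k * (F * (nikolskii d (2 * T N) * B * B) / trim ρ N ^ 2 / N) := by ring
      _ ≤ (2 * Real.log N) * (F * nikolskii d 2 * B ^ 2 * noiseLevel d (T N) (2 * ρ) N ^ 2) := by
          gcongr
      _ = _ := by
          rw [← noiseLevel_sq_mul_log d (T N) (2 * ρ) hL]
          ring
  calc _ ≤ ENNReal.ofReal (4 / (N : ℝ) ^ 2) + ENNReal.ofReal (4 / (N : ℝ) ^ 2) := by
        refine (measure_union_le _ _).trans (add_le_add e1 ((measure_mono ?_).trans e2))
        rintro ω ⟨x, hx⟩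
        refine ⟨x, lt_of_le_of_lt ?_ hx⟩
        calc _ ≤ Real.exp d * (2 * Real.exp (1 / 2) * (√(2 * (F * nikolskii d 2 * B ^ 2)) *
              noiseLevel d (T N) (2 * ρ + 1) N)) := by gcongr
          _ = _ := by ring
    _ = _ := by
        rw [← ENNReal.ofReal_add (by positivity) (by positivity)]
        congr 1
        ring

theorem exists_eventually_measure_eLpNorm_two_gt_le (hmodel : IsModelSample P d X β Y fX)
    (hr : IsChoiceProbability P d X Y r)
    (hF : ∀ᵐ y ∂(surf d), fX y ≤ F) (hF1 : 1 ≤ F)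
    (hB : ∀ T : ℕ, 1 ≤ T → ∀ x : Sph d, ∫ y, |smoothKernel d χ T x y| ∂(surf d) ≤ B)
    (hT1 : ∀ᶠ N in atTop, 1 ≤ T N) {ε : ℝ} (hε : 0 < ε) :
    ∃ M : ℝ, 0 < M ∧ ∀ᶠ N : ℕ in atTop,
      P {ω | ENNReal.ofReal (M * noiseLevel d (T N) (2 * ρ) N) < eLpNorm (fun x =>
        oracleMean d χ (2 * T N) (trim ρ N) X Y fX N ω x -
          trimmedMean d χ (2 * T N) (trim ρ N) fX r x) 2 (surf d)} ≤ ENNReal.ofReal ε := by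
  have hnik := nikolskii_pos d 2
  have hsurf := surf_real_univ_pos d
  set K := F * nikolskii d 2 * B ^ 2 * (surf d).real Set.univ with hK
  have hK0 : 0 ≤ K := by positivity
  refine ⟨√((K + 1) / ε), by positivity, ?_⟩
  filter_upwards [hT1, eventually_one_le_log] with N hT1 hL
  have hN1 := one_lt_of_one_le_log hL
  have hN : (0 : ℝ) < N := by exact_mod_cast hN1.le
  have hTr : (0 : ℝ) < T N := by exact_mod_cast hT1
  have hL0 : 0 < Real.log N := by linarith
  have hn : 0 < noiseLevel d (T N) (2 * ρ) N := Real.sqrt_pos.2 (by positivity)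
  refine (measure_eLpNorm_centred_gt_le hmodel hr hF (by linarith) (trim_pos hL)
    (hB (2 * T N) (by omega)) hN1.le (by positivity)).trans (ENNReal.ofReal_le_ofReal ?_)
  rw [mul_pow, Real.sq_sqrt (by positivity), div_le_iff₀ (by positivity)]
  calc _ ≤ F * nikolskii d 2 * B ^ 2 * noiseLevel d (T N) (2 * ρ) N ^ 2 *
        (surf d).real Set.univ := by
        gcongr
        exact variance_proxy_le (by linarith) hT1 hL
    _ = K * noiseLevel d (T N) (2 * ρ) N ^ 2 := by rw [hK]; ring
    _ ≤ (K + 1) * noiseLevel d (T N) (2 * ρ) N ^ 2 := by gcongr; linarith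
    _ = _ := by field_simp

end Tails

/-! ### Interpolation of the noise -/

/-- From the `L²` and sup-norm bounds of the noise to the `L^q` bound: only the latter costs a
factor `(log N)^{1/2}`, whence the exponent `1 - 2/q` in the effective sample size. -/
theorem eLpNorm_le_noiseLevel {d : ℕ} {ρ M M' : ℝ} {q : ℝ≥0∞} (hq : 1 ≤ q) (hM : 0 < M)
    (hM' : 0 < M') {T N : ℕ} (hL : 1 ≤ Real.log N) {u : Sph d → ℝ}
    (hu : AEStronglyMeasurable u (surf d))
    (h2 : eLpNorm u 2 (surf d) ≤ ENNReal.ofReal (M * noiseLevel d T (2 * ρ) N))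
    (hsup : ∀ x, |u x| ≤ M' * noiseLevel d T (2 * ρ + 1) N) :
    eLpNorm u q (surf d) ≤ ENNReal.ofReal
      (max M M' * ((surf d).real Set.univ + 1) * noiseLevel d T (logExponent ρ q) N) := by
  have hσ : 0 ≤ (surf d).real Set.univ := measureReal_nonneg
  have hn := noiseLevel_nonneg d T
  by_cases hq2 : 2 ≤ q
  · have hq' : (q⁻¹).toReal ≤ 2⁻¹ := by
      have := ENNReal.toReal_mono (by simp) (ENNReal.inv_le_inv.2 hq2)
      simpa using this
    have hq0 : 0 ≤ (q⁻¹).toReal := ENNReal.toReal_nonneg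
    set η := 2 * (q⁻¹).toReal with hη
    have hη0 : 0 ≤ η := by positivity
    have hη1 : 0 ≤ 1 - η := by linarith
    have h := eLpNorm_le_rpow_mul_rpow two_ne_zero ENNReal.ofNat_ne_top hq2 h2
      (M := ENNReal.ofReal (M' * noiseLevel d T (2 * ρ + 1) N)) (fun x => by
        rw [← Real.enorm_abs, Real.enorm_of_nonneg (abs_nonneg _)]
        exact ENNReal.ofReal_le_ofReal (hsup x)) ENNReal.ofReal_ne_top
    rw [ENNReal.toReal_ofNat, ← hη,
      ENNReal.ofReal_rpow_of_nonneg (mul_nonneg hM.le (hn _ _)) hη0,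
      ENNReal.ofReal_rpow_of_nonneg (mul_nonneg hM'.le (hn _ _)) hη1,
      ← ENNReal.ofReal_mul (Real.rpow_nonneg (mul_nonneg hM.le (hn _ _)) _)] at h
    refine h.trans (ENNReal.ofReal_le_ofReal ?_)
    have hM0 : 0 < max M M' := lt_max_of_lt_left hM
    have e1 : M ^ η * M' ^ (1 - η) ≤ max M M' := by
      calc _ ≤ max M M' ^ η * max M M' ^ (1 - η) := by
            gcongr
            · exact le_max_left _ _
            · exact le_max_right _ _
        _ = max M M' := by
            rw [← Real.rpow_add hM0]
            simp
    rw [Real.mul_rpow hM.le (hn _ _), Real.mul_rpow hM'.le (hn _ _), logExponent, if_pos hq2, ← hη,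
      ← noiseLevel_rpow_mul_rpow d T (2 * ρ) hL hη0 (by linarith)]
    have e2 : 0 ≤ noiseLevel d T (2 * ρ) N ^ η * noiseLevel d T (2 * ρ + 1) N ^ (1 - η) :=
      mul_nonneg (Real.rpow_nonneg (hn _ _) _) (Real.rpow_nonneg (hn _ _) _)
    calc _ = (M ^ η * M' ^ (1 - η)) *
          (noiseLevel d T (2 * ρ) N ^ η * noiseLevel d T (2 * ρ + 1) N ^ (1 - η)) := by ring
      _ ≤ (max M M' * ((surf d).real Set.univ + 1)) *
          (noiseLevel d T (2 * ρ) N ^ η * noiseLevel d T (2 * ρ + 1) N ^ (1 - η)) := by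
          refine mul_le_mul_of_nonneg_right ?_ e2
          nlinarith [mul_nonneg hM0.le hσ]
  · have hq2' : q ≤ 2 := (not_le.1 hq2).le
    have hqt : q ≠ ∞ := ne_top_of_le_ne_top ENNReal.ofNat_ne_top hq2'
    have hq1 : 1 ≤ q.toReal := by
      have := ENNReal.toReal_mono hqt hq
      simpa using this
    have hq2r : q.toReal ≤ 2 := by
      have := ENNReal.toReal_mono ENNReal.ofNat_ne_top hq2'
      simpa using this
    have hexp0 : 0 ≤ 1 / q.toReal - 1 / 2 := by
      have := one_div_le_one_div_of_le (by linarith) hq2r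
      linarith
    have hexp1 : 1 / q.toReal - 1 / 2 ≤ 1 := by
      have := one_div_le_one_div_of_le one_pos hq1
      linarith
    have h := eLpNorm_le_eLpNorm_mul_rpow_measure_univ hq2' hu
    rw [ENNReal.toReal_ofNat, ← ofReal_measureReal (μ := surf d) (s := Set.univ),
      ENNReal.ofReal_rpow_of_nonneg hσ hexp0] at h
    refine (h.trans (mul_le_mul_left h2 _)).trans ?_
    rw [← ENNReal.ofReal_mul (mul_nonneg hM.le (hn _ _)), logExponent, if_neg hq2, add_zero]
    refine ENNReal.ofReal_le_ofReal ?_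
    have hσ1 : (surf d).real Set.univ ^ (1 / q.toReal - 1 / 2) ≤ (surf d).real Set.univ + 1 := by
      calc _ ≤ ((surf d).real Set.univ + 1) ^ (1 / q.toReal - 1 / 2) := by
            gcongr
            linarith
        _ ≤ ((surf d).real Set.univ + 1) ^ (1 : ℝ) :=
            Real.rpow_le_rpow_of_exponent_le (by linarith) hexp1
        _ = _ := Real.rpow_one _
    have hn2 := hn (2 * ρ) N
    have hM0 : 0 < max M M' := lt_max_of_lt_left hM
    calc _ ≤ max M M' * noiseLevel d T (2 * ρ) N * ((surf d).real Set.univ + 1) := by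
          gcongr
          exact le_max_left _ _
      _ = _ := by ring

/-! ### Convergence rates -/

theorem plugIn_le {A L θ ρ M : ℝ} (hA : 0 < A) {D : ℝ≥0∞}
    (h : ENNReal.ofReal (A ^ θ * L ^ ρ) * D ≤ ENNReal.ofReal M) :
    ENNReal.ofReal (L ^ ρ) * D ≤ ENNReal.ofReal (M * A ^ (-θ)) := by
  have h1 : L ^ ρ = A ^ (-θ) * (A ^ θ * L ^ ρ) := by
    rw [← mul_assoc, ← Real.rpow_add hA]
    simp
  rw [h1, ENNReal.ofReal_mul (by positivity), mul_assoc, mul_comm M,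
    ENNReal.ofReal_mul (p := A ^ (-θ)) (by positivity)]
  gcongr

theorem ofReal_div_trim {ρ M : ℝ} (hM : 0 ≤ M) {N : ℕ} (hL : 1 ≤ Real.log N) :
    ENNReal.ofReal (M / trim ρ N) = ENNReal.ofReal M * ENNReal.ofReal (Real.log N ^ ρ) := by
  rw [← ENNReal.ofReal_mul hM, trim, Real.rpow_neg (by linarith), div_inv_eq_mul]

theorem logExponent_top (ρ : ℝ) : logExponent ρ ∞ = 2 * ρ + 1 := by
  simp [logExponent]

theorem ae_eventually_notMem_of_measure_le {Ω : Type*} [MeasurableSpace Ω] {P : Measure Ω}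
    {E : ℕ → Set Ω}
    (h : ∀ᶠ N : ℕ in atTop, P (E N) ≤ ENNReal.ofReal (8 / (N : ℝ) ^ 2)) :
    ∀ᵐ ω ∂P, ∀ᶠ N in atTop, ω ∉ E N := by
  obtain ⟨N₀, hN₀⟩ := eventually_atTop.1 h
  have hsum : Summable fun N : ℕ => 8 / (N : ℝ) ^ 2 := by
    simp_rw [div_eq_mul_inv]
    exact (Real.summable_nat_pow_inv.2 one_lt_two).mul_left 8
  have hfin : ∑' N, P (E (N + N₀)) ≠ ∞ := by
    refine ne_top_of_le_ne_top ?_ (ENNReal.tsum_le_tsum fun N => hN₀ (N + N₀) (by omega))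
    have := (summable_nat_add_iff N₀).2 hsum
    exact this.tsum_ofReal_ne_top
  filter_upwards [ae_eventually_notMem hfin] with ω hω
  obtain ⟨N₁, hN₁⟩ := eventually_atTop.1 hω
  refine eventually_atTop.2 ⟨N₁ + N₀, fun N hN => ?_⟩
  have := hN₁ (N - N₀) (by omega)
  rwa [Nat.sub_add_cancel (by omega)] at this

section Rates

variable {Ω : Type*} [MeasurableSpace Ω] {P : Measure Ω} [IsProbabilityMeasure P] {d : ℕ} [NeZero d]
  {X β : ℕ → Ω → Sph d} {Y : ℕ → Ω → ℝ} {fX r : Sph d → ℝ} {fhat : ℕ → Ω → Sph d → ℝ}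
  {χ : ℕ → ℕ → ℝ} {s ρ : ℝ} {q : ℝ≥0∞} {T : ℕ → ℕ}

/-- Off the bad event, the error is at most of the order of the rate when the noise and the
plug-in error are. -/
theorem exists_eventually_eLpNorm_Rhat_sub_le (hd : 2 ≤ d) (hmodel : IsModelSample P d X β Y fX)
    (hsupp : SupportAssumption d fX) (hr : IsChoiceProbability P d X Y r) (hs : 0 < s)
    (hq : 1 ≤ q) (hK : KernelAssumption d χ q s)
    (htrim : TrimmingAssumption d q s ρ fX) (hR : MemSobolev d q s (extendedChoice d r))
    (hT : SameOrder (fun N => (T N : ℝ)) (fun N => effSize ρ q N ^ (1 / (2 * s + d - 1))))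
    {M M' M₁ M₂ : ℝ} (hM : 0 ≤ M) (hM₁ : 0 ≤ M₁) (hM₂ : 0 ≤ M₂) :
    ∃ C : ℝ, 0 ≤ C ∧ ∀ᶠ N in atTop, ∀ ω ∉ badEvent d χ T ρ X Y fX r M M' N,
      ENNReal.ofReal (effSize ρ q N ^ (s / (2 * s + d - 1)) * Real.log N ^ ρ) *
        plugInError ρ X fX fhat N ω ≤ ENNReal.ofReal M₁ →
      eLpNorm (fun x => oracleMean d χ (2 * T N) (trim ρ N) X Y fX N ω x -
        trimmedMean d χ (2 * T N) (trim ρ N) fX r x) q (surf d) ≤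
          ENNReal.ofReal (M₂ * noiseLevel d (T N) (logExponent ρ q) N) →
      eLpNorm (fun x => Rhat d χ T ρ X Y fhat N ω x - extendedChoice d r x) q (surf d) ≤
        ENNReal.ofReal (C * effSize ρ q N ^ (-(s / (2 * s + d - 1)))) := by
  obtain ⟨B, hB1, hB⟩ := exists_kernel_bound hK
  obtain ⟨C₁, hC₁, h₁⟩ := eventually_approx_le hd hs hq hK hR hT
  obtain ⟨C₂, hC₂, h₂⟩ := eventually_trimming_bias_le (χ := χ) hd hs hq hmodel.measurable_fX
    hmodel.nonneg_fX hsupp hr.1 (abs_two_mul_choiceProbability_sub_one_le hmodel hr)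
    (hR.1.integrable hq) hB1 hB htrim hT
  obtain ⟨C₃, hC₃, h₃⟩ := eventually_noiseLevel_le hd hs hT
  have hσ : surf d Set.univ ^ (q.toReal⁻¹) ≠ ∞ :=
    ENNReal.rpow_ne_top_of_nonneg (by positivity) (measure_ne_top _ _)
  set σ := (surf d Set.univ ^ (q.toReal⁻¹)).toReal with hσdef
  have hσ0 : 0 ≤ σ := ENNReal.toReal_nonneg
  refine ⟨σ * (M * M₁) + M₂ * C₃ + C₂ + C₁, by positivity, ?_⟩
  filter_upwards [h₁, h₂, h₃, eventually_one_le_log] with N h₁ h₂ h₃ hL ω hω hplug hnoise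
  have hA := effSize_pos (ρ := ρ) (q := q) hL
  have hrate : 0 < effSize ρ q N ^ (-(s / (2 * s + d - 1))) := by positivity
  set rate := effSize ρ q N ^ (-(s / (2 * s + d - 1)))
  have hker : ∀ x, kernelMean d χ (2 * T N) X N ω x ≤ M := fun x =>
    not_lt.1 fun h => hω (Or.inl ⟨x, h⟩)
  refine (eLpNorm_Rhat_sub_le (fhat := fhat) hmodel hr hq hR.1 (trim_pos hL) hM hker).trans ?_
  have hsplit : ENNReal.ofReal ((σ * (M * M₁) + M₂ * C₃ + C₂ + C₁) * rate) =
      surf d Set.univ ^ (q.toReal⁻¹) * (ENNReal.ofReal M * ENNReal.ofReal (M₁ * rate)) +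
        ENNReal.ofReal (M₂ * (C₃ * rate)) + ENNReal.ofReal (C₂ * rate) +
        ENNReal.ofReal (C₁ * rate) := by
    rw [← ENNReal.ofReal_toReal hσ, ← hσdef, ← ENNReal.ofReal_mul hM, ← ENNReal.ofReal_mul hσ0,
      ← ENNReal.ofReal_add (by positivity) (by positivity),
      ← ENNReal.ofReal_add (by positivity) (by positivity),
      ← ENNReal.ofReal_add (by positivity) (by positivity)]
    congr 1
    ring
  rw [hsplit]
  refine add_le_add (add_le_add (add_le_add ?_ ?_) h₂) h₁
  · rw [ofReal_div_trim hM hL, mul_assoc]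
    gcongr
    exact plugIn_le hA hplug
  · refine hnoise.trans (ENNReal.ofReal_le_ofReal ?_)
    gcongr

theorem isBigOInProb_eLpNorm_Rhat_sub (hd : 2 ≤ d) (hmodel : IsModelSample P d X β Y fX)
    (hsupp : SupportAssumption d fX) (hr : IsChoiceProbability P d X Y r) (hs : 0 < s)
    (hρ : 0 < ρ) (hq : 1 ≤ q) (hK : KernelAssumption d χ q s)
    (htrim : TrimmingAssumption d q s ρ fX) (hplug : PlugInAssumptionProb P d q s ρ X fX fhat)
    (hR : MemSobolev d q s (extendedChoice d r))
    (hT : SameOrder (fun N => (T N : ℝ)) (fun N => effSize ρ q N ^ (1 / (2 * s + d - 1)))) :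
    IsBigOInProb P
      (fun N ω => eLpNorm (fun x => Rhat d χ T ρ X Y fhat N ω x - extendedChoice d r x) q (surf d))
      (fun N => effSize ρ q N ^ (-(s / (2 * s + d - 1)))) := by
  intro ε hε
  obtain ⟨B, hB1, hB⟩ := exists_kernel_bound hK
  obtain ⟨F, hF1, hF⟩ := exists_density_bound hsupp htrim
  have hT1 : ∀ᶠ N in atTop, 1 ≤ T N := by
    obtain ⟨_, -, h⟩ := hT.bounds hd hs
    exact h.mono fun N h => h.1
  obtain ⟨M, M', hM, hM', hbad⟩ := eventually_measure_badEvent_le (ρ := ρ) hd hmodel hr hF hF1 hB1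
    hB hT1 (eventually_mul_pow_mul_log_le hd hs hρ hT)
  obtain ⟨M₂, hM₂, hL2⟩ := exists_eventually_measure_eLpNorm_two_gt_le (ρ := ρ) hmodel hr hF hF1 hB
    hT1 (show 0 < ε / 3 by positivity)
  obtain ⟨M₁, hM₁⟩ := hplug (ε / 3) (by positivity)
  have hσ : 0 ≤ (surf d).real Set.univ := measureReal_nonneg
  obtain ⟨C, -, hC⟩ := exists_eventually_eLpNorm_Rhat_sub_le (fhat := fhat) (M' := M') hd hmodel
    hsupp hr hs hq hK htrim hR hT hM.le (le_max_right M₁ 0)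
    (show 0 ≤ max M₂ M' * ((surf d).real Set.univ + 1) by
      have : 0 < max M₂ M' := lt_max_of_lt_left hM₂
      positivity)
  have hsmall : ∀ᶠ N : ℕ in atTop, 8 / (N : ℝ) ^ 2 ≤ ε / 3 := by
    have h : Tendsto (fun N : ℕ => 8 / (N : ℝ) ^ 2) atTop (𝓝 0) :=
      tendsto_const_nhds.div_atTop
        ((tendsto_pow_atTop two_ne_zero).comp tendsto_natCast_atTop_atTop)
    exact h.eventually_le_const (by positivity)
  refine ⟨C, ?_⟩
  filter_upwards [hbad, hL2, hM₁, hC, hsmall, eventually_one_le_log]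
    with N hbad hL2 hM₁ hC hsmall hL
  set E₂ := {ω | ENNReal.ofReal (M₂ * noiseLevel d (T N) (2 * ρ) N) < eLpNorm (fun x =>
        oracleMean d χ (2 * T N) (trim ρ N) X Y fX N ω x -
          trimmedMean d χ (2 * T N) (trim ρ N) fX r x) 2 (surf d)}
  set E₁ := {ω | ENNReal.ofReal (M₁ * 1) <
    ENNReal.ofReal (effSize ρ q N ^ (s / (2 * s + d - 1)) * Real.log N ^ ρ) *
      plugInError ρ X fX fhat N ω}
  have hsub : {ω | ENNReal.ofReal (C * effSize ρ q N ^ (-(s / (2 * s + d - 1)))) <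
      eLpNorm (fun x => Rhat d χ T ρ X Y fhat N ω x - extendedChoice d r x) q (surf d)} ⊆
      badEvent d χ T ρ X Y fX r M M' N ∪ E₂ ∪ E₁ := by
    intro ω hω
    by_contra hcon
    simp only [Set.mem_union, not_or] at hcon
    obtain ⟨⟨h0, h2⟩, h1⟩ := hcon
    refine absurd hω (not_lt.2 (hC ω h0 ?_ ?_))
    · refine (not_lt.1 h1).trans (ENNReal.ofReal_le_ofReal ?_)
      rw [mul_one]
      exact le_max_left _ _
    · refine eLpNorm_le_noiseLevel hq hM₂ hM' hL
        (continuous_centred hmodel hr ω).aestronglyMeasurable (not_lt.1 h2) fun x => ?_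
      exact not_lt.1 fun h => h0 (Or.inr ⟨x, h⟩)
  calc _ ≤ P (badEvent d χ T ρ X Y fX r M M' N) + P E₂ + P E₁ :=
        (measure_mono hsub).trans ((measure_union_le _ _).trans
          (add_le_add_left (measure_union_le _ _) _))
    _ ≤ ENNReal.ofReal (ε / 3) + ENNReal.ofReal (ε / 3) + ENNReal.ofReal (ε / 3) :=
        add_le_add (add_le_add (hbad.trans (ENNReal.ofReal_le_ofReal hsmall)) hL2) hM₁
    _ = ENNReal.ofReal ε := by
        rw [← ENNReal.ofReal_add (by positivity) (by positivity),
          ← ENNReal.ofReal_add (by positivity) (by positivity)]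
        congr 1
        ring

theorem exists_ae_limsup_eLpNorm_Rhat_sub_le (hd : 2 ≤ d) (hmodel : IsModelSample P d X β Y fX)
    (hsupp : SupportAssumption d fX) (hr : IsChoiceProbability P d X Y r) (hs : 0 < s)
    (hρ : 0 < ρ) (hK : KernelAssumption d χ ∞ s)
    (htrim : TrimmingAssumption d ∞ s ρ fX) (hplug : PlugInAssumptionAS P d s ρ X fX fhat)
    (hR : MemSobolev d ∞ s (extendedChoice d r))
    (hT : SameOrder (fun N => (T N : ℝ)) (fun N => effSize ρ ∞ N ^ (1 / (2 * s + d - 1)))) :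
    ∃ C : ℝ≥0, ∀ᵐ ω ∂P, limsup (fun N : ℕ =>
      ENNReal.ofReal ((N / Real.log N ^ (2 * ρ + 1)) ^ (s / (2 * s + d - 1))) *
        eLpNorm (fun x => Rhat d χ T ρ X Y fhat N ω x - extendedChoice d r x) ∞ (surf d))
      atTop ≤ C := by
  obtain ⟨B, hB1, hB⟩ := exists_kernel_bound hK
  obtain ⟨F, hF1, hF⟩ := exists_density_bound hsupp htrim
  have hT1 : ∀ᶠ N in atTop, 1 ≤ T N := by
    obtain ⟨_, -, h⟩ := hT.bounds hd hs
    exact h.mono fun N h => h.1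
  obtain ⟨M, M', hM, hM', hbad⟩ := eventually_measure_badEvent_le (ρ := ρ) hd hmodel hr hF hF1 hB1
    hB hT1 (eventually_mul_pow_mul_log_le hd hs hρ hT)
  obtain ⟨C₀, hC₀⟩ := hplug
  obtain ⟨C, hC0, hC⟩ := exists_eventually_eLpNorm_Rhat_sub_le (fhat := fhat) (M' := M')
    (M₁ := C₀ + 1) (M₂ := M') hd hmodel hsupp hr hs le_top hK htrim hR hT hM.le (by positivity)
    hM'.le
  have heff : ∀ N : ℕ, (N : ℝ) / Real.log N ^ (2 * ρ + 1) = effSize ρ ∞ N := fun N => by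
    rw [effSize, logExponent_top]
  refine ⟨⟨C, hC0⟩, ?_⟩
  filter_upwards [hC₀, ae_eventually_notMem_of_measure_le hbad] with ω hω hωbad
  have hlt : limsup (fun N : ℕ =>
      ENNReal.ofReal ((N / Real.log N ^ (2 * ρ + 1)) ^ (s / (2 * s + d - 1)) * Real.log N ^ ρ) *
        plugInError ρ X fX fhat N ω) atTop < ((C₀ + 1 : ℝ≥0) : ℝ≥0∞) :=
    hω.trans_lt (by exact_mod_cast lt_add_one C₀)
  refine limsup_le_of_le (by isBoundedDefault) ?_
  filter_upwards [eventually_lt_of_limsup_lt hlt, hωbad, hC, eventually_one_le_log]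
    with N h1 h0 hC hL
  have hA := effSize_pos (ρ := ρ) (q := ∞) hL
  simp only [heff] at h1 ⊢
  have h := hC ω h0 ?_ ?_
  · calc _ ≤ ENNReal.ofReal (effSize ρ ∞ N ^ (s / (2 * s + d - 1))) *
          ENNReal.ofReal (C * effSize ρ ∞ N ^ (-(s / (2 * s + d - 1)))) := by gcongr
      _ = ENNReal.ofReal C := by
          rw [← ENNReal.ofReal_mul (by positivity), mul_left_comm, ← Real.rpow_add hA]
          simp
      _ = _ := ENNReal.ofReal_eq_coe_nnreal hC0
  · refine h1.le.trans (le_of_eq ?_)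
    rw [← ENNReal.ofReal_coe_nnreal]
    simp
  · rw [eLpNorm_exponent_top, logExponent_top]
    refine eLpNormEssSup_le_of_ae_bound (Eventually.of_forall fun x => ?_)
    exact not_lt.1 fun h => h0 (Or.inr ⟨x, h⟩)

end Rates

end BinaryChoice

end

theorem theorem4p2 {Ω : Type*} [MeasurableSpace Ω] (P : Measure Ω) [IsProbabilityMeasure P]
    {d : ℕ} [NeZero d] (hd : 2 ≤ d)
    (X β : ℕ → Ω → Sph d) (Y : ℕ → Ω → ℝ) (fX : Sph d → ℝ)
    (hmodel : IsModelSample P d X β Y fX)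
    (hsupp : SupportAssumption d fX)
    (r : Sph d → ℝ) (hr : IsChoiceProbability P d X Y r)
    (fhat : ℕ → Ω → Sph d → ℝ) (χ : ℕ → ℕ → ℝ)
    (s ρ : ℝ) (hs : 0 < s) (hρ : 0 < ρ) (T : ℕ → ℕ) :
    (∀ q : ℝ≥0∞, 1 ≤ q →
      KernelAssumption d χ q s →
      TrimmingAssumption d q s ρ fX →
      PlugInAssumptionProb P d q s ρ X fX fhat →
      MemSobolev d q s (extendedChoice d r) →
      SameOrder (fun N => (T N : ℝ)) (fun N => effSize ρ q N ^ (1 / (2 * s + d - 1))) →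
      IsBigOInProb P
        (fun N ω => eLpNorm (fun x => Rhat d χ T ρ X Y fhat N ω x - extendedChoice d r x) q (surf d))
        (fun N => effSize ρ q N ^ (-(s / (2 * s + d - 1))))) ∧
    (KernelAssumption d χ ∞ s →
      TrimmingAssumption d ∞ s ρ fX →
      PlugInAssumptionAS P d s ρ X fX fhat →
      MemSobolev d ∞ s (extendedChoice d r) →
      SameOrder (fun N => (T N : ℝ)) (fun N => effSize ρ ∞ N ^ (1 / (2 * s + d - 1))) →
      ∃ C : ℝ≥0, ∀ᵐ ω ∂P, limsup (fun N : ℕ =>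
        ENNReal.ofReal ((N / Real.log N ^ (2 * ρ + 1)) ^ (s / (2 * s + d - 1))) *
          eLpNorm (fun x => Rhat d χ T ρ X Y fhat N ω x - extendedChoice d r x) ∞ (surf d))
        atTop ≤ C) := by
  exact
    ⟨fun _ hq hK htrim hplug hR hT =>
      isBigOInProb_eLpNorm_Rhat_sub hd hmodel hsupp hr hs hρ hq hK htrim hplug hR hT,
    fun hK htrim hplug hR hT =>
      exists_ae_limsup_eLpNorm_Rhat_sub_le hd hmodel hsupp hr hs hρ hK htrim hplug hR hT⟩
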